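/- **Definitions.** A *strip* is a set $S$ with $\mathbb{R}\times(u,v)\subset S\subset\mathbb{R}\times[u,v]$ for some real $u<v$, open in $\mathbb{R}\times[u,v]$. Put $\partial_-S=S\cap(\mathbb{R}\times\{u\})$ and $\partial_+S=S\cap(\mathbb{R}\times\{v\})$ (the *sides*); the connected components of $\partial S=\partial_-S\cup\partial_+S$ are its *boundary intervals*. $S$ is a *model* strip if its boundary intervals are bounded and have mutually disjoint closures in $\mathbb{R}\times[u,v]$. The leaves of a strip are the lines $\mathbb{R}\times\{t\}$, $t\in(u,v)$, and the boundary intervals. A *striped atlas* on a two-dimensional topological manifold $Z$ (possibly with boundary) is a quotient map $q:\bigsqcup_{\lambda\in\Lambda}S_\lambda\to Z$ from an at most countable disjoint union of strips for which there are mutually distinct boundary intervals $X_\gamma,Y_\gamma$ ($\gamma\in\Gamma$) such that $q(X_\gamma)=q(Y_\gamma)$, $q$ restricts to embeddings with closed images on each $X_\gamma$ and each $Y_\gamma$, and $q$ makes no other identifications, that is, $q$ is injective off $\bigcup_\gamma (X_\gamma\cup Y_\gamma)$ and $q^{-1}(q(X_\gamma))=X_\gamma\cup Y_\gamma$ for each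 $\gamma$. The *gluing maps* are $\phi_\gamma=(q|_{X_\gamma})^{-1}\circ q|_{Y_\gamma}:Y_\gamma\to X_\gamma$. The atlas is *affine* if all strips are model and all $\phi_\gamma$ are affine in the first coordinate. The images under $q$ of the leaves of the strips are the leaves of the *canonical foliation* $\Delta$ of $Z$. A leaf $\omega$ is *special* if it differs from the intersection of the closures of all its saturated neighbourhoods (saturated: a union of leaves). The atlas is *reduced* if the union of the images of all boundary intervals of the strips equals the union of all special leaves and of $\partial Z$. A homeomorphism between foliated surfaces is *foliated* if it maps leaves onto leaves. $H(\Delta)$ is the group of foliated homeomorphisms of $(Z,\Delta)$ onto itself with the compact-open topology, $H_0(\Delta)$ is the path component of $\mathrm{id}_Z$ (a normal subgroup), and $\pi_0H(\Delta)=H(\Delta)/H_0(\Delta)$. The *foliated open cylinder* (resp. *foliated open Möbius band*) is obtained from $\mathbb{R}\times[0,1]$ by gluing $(x,0)$ with $(x,1)$ (resp. with $(-x,1)$) for all $x$, and is foliated by the images of the lines $\mathbb{R}\times\{t\}$. The *graph* $G$ of the atlas consists of: the set $\Lambda$ of vertices; the set $H$ of all boundary intervals of the strips (half-edges), where $d_{\pm1}(\lambda)$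 denotes the set of boundary intervals in $\partial_\pm S_\lambda$, linearly ordered by the first coordinate; the involution $\xi$ of $H$ that exchanges $X_\gamma$ and $Y_\gamma$ and fixes all intervals that are not glued; and the function $\sigma$ on $H\setminus\mathrm{Fix}(\xi)$ with $\sigma(X_\gamma)=\sigma(Y_\gamma)=+1$ if $\phi_\gamma$ increases the first coordinate and $-1$ if it decreases it. An element of $\mathrm{Aut}(G)$ is a quadruple $(\nu,\eta,l,\tau)$ of bijections $\nu:\Lambda\to\Lambda$, $\eta:H\to H$ and functions $l,\tau:\Lambda\to\{\pm1\}$ such that (a) $\eta(d_s(\lambda))=d_{\tau(\lambda)s}(\nu(\lambda))$ for all $\lambda$ and $s=\pm1$, and $\eta$ is increasing on $d_{s}(\lambda)$ if $l(\lambda)=1$ and decreasing if $l(\lambda)=-1$; (b) $\xi\circ\eta=\eta\circ\xi$; (c) $l(\lambda)\,\sigma(X)=\sigma(\eta(X))\,l(\mu)$ whenever $X\in d_{\pm1}(\lambda)$, $\xi(X)\ne X$ and $\xi(X)\in d_{\pm1}(\mu)$. The product is $(\nu',\eta',l',\tau')(\nu,\eta,l,\tau)=(\nu'\nu,\ \eta'\eta,\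 (l'\circ\nu)\,l,\ (\tau'\circ\nu)\,\tau)$. **Theorem.** Let $q$ be an affine striped atlas on a connected surface $Z$, with graph $G$ and canonical foliation $\Delta$. Assume that either $q$ is reduced, or $q$ consists of a single strip and $(Z,\Delta)$ is foliated homeomorphic to the foliated open cylinder or to the foliated open Möbius band. 1. If $(Z,\Delta)$ is foliated homeomorphic to the foliated open cylinder or to the foliated open Möbius band, then $H_0(\Delta)$ is homotopy equivalent to the circle $S^1$. 2. Otherwise $H_0(\Delta)$ is contractible. 3. If $q$ is reduced, or if $(Z,\Delta)$ is foliated homeomorphic to the foliated open cylinder, then the groups $\pi_0H(\Delta)$ and $\mathrm{Aut}(G)$ are isomorphic. -/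

import Mathlib

open Set Topology

universe u v w

noncomputable section

namespace Striped

/-! ### Strips -/

/-- A strip: a subset `S` of the plane with `ℝ × (lo, hi) ⊆ S ⊆ ℝ × [lo, hi]` which is open in
`ℝ × [lo, hi]`. -/
structure Strip where
  lo : ℝ
  hi : ℝ
  lo_lt_hi : lo < hi
  carrier : Set (ℝ × ℝ)
  interior_subset : (univ : Set ℝ) ×ˢ Ioo lo hi ⊆ carrier
  subset_closed : carrier ⊆ (univ : Set ℝ) ×ˢ Icc lo hi
  relOpen : ∃ O : Set (ℝ × ℝ), IsOpen O ∧ carrier = O ∩ (univ : Set ℝ) ×ˢ Icc lo hi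

namespace Strip

/-- The height of the side `∂₊S` (for `s = 1`) or `∂₋S` (for `s = -1`). -/
def level (S : Strip) (s : ℤˣ) : ℝ := if s = 1 then S.hi else S.lo

/-- The side `∂ₛS`, described by the first coordinates of its points. -/
def sideSet (S : Strip) (s : ℤˣ) : Set ℝ := {x | (x, S.level s) ∈ S.carrier}

/-- `I × {level s}` is a boundary interval of `S`, that is a connected component of `∂ₛS`. -/
def IsBoundaryInterval (S : Strip) (s : ℤˣ) (I : Set ℝ) : Prop :=
  ∃ x ∈ S.sideSet s, I = connectedComponentIn (S.sideSet s) x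

/-- Model strips: all boundary intervals are bounded and have mutually disjoint closures
(for intervals on different sides the latter is automatic). -/
def IsModel (S : Strip) : Prop :=
  (∀ s I, S.IsBoundaryInterval s I → Bornology.IsBounded I) ∧
  (∀ s I J, S.IsBoundaryInterval s I → S.IsBoundaryInterval s J → I ≠ J →
    Disjoint (closure I) (closure J))

end Strip

/-- A boundary interval (half-edge) of a family of strips: the strip it belongs to, the side, and
the set of first coordinates of its points. -/
@[ext]
structure HalfEdge {Λ : Type v} (S : Λ → Strip) where
  vertex : Λ
  side : ℤˣ
  interval : Set ℝ
  isInterval : (S vertex).IsBoundaryInterval side interval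

namespace HalfEdge

variable {Λ : Type v} {S : Λ → Strip}

/-- The point of the disjoint union of the strips which lies on the boundary interval `e` and has
the given first coordinate. -/
def point (e : HalfEdge S) (x : e.interval) : Σ l, (S l).carrier :=
  ⟨e.vertex, (x.1, (S e.vertex).level e.side), by
    obtain ⟨y, -, hI⟩ := e.isInterval
    exact connectedComponentIn_subset _ y (Eq.subset hI x.2)⟩

/-- The boundary interval as a subset of the disjoint union of the strips. -/
def toSet (e : HalfEdge S) : Set (Σ l, (S l).carrier) := range e.point

/-- The order of boundary intervals (used only for two intervals of the same side of the same
strip). -/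
def Before (e f : HalfEdge S) : Prop := ∀ a ∈ e.interval, ∀ b ∈ f.interval, a < b

theorem nonempty (e : HalfEdge S) : e.interval.Nonempty := by
  obtain ⟨y, hy, hI⟩ := e.isInterval
  exact ⟨y, hI ▸ mem_connectedComponentIn hy⟩

theorem ordConnected (e : HalfEdge S) : e.interval.OrdConnected := by
  obtain ⟨y, hy, hI⟩ := e.isInterval
  rw [hI]
  exact isPreconnected_connectedComponentIn.ordConnected

theorem disjoint_of_ne {e f : HalfEdge S} (hv : e.vertex = f.vertex) (hs : e.side = f.side)
    (h : e ≠ f) : Disjoint e.interval f.interval := by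
  obtain ⟨l, s, I, x, hx, hI⟩ := e
  obtain ⟨l', s', J, y, hy, hJ⟩ := f
  dsimp only at hv hs
  subst hv hs
  rw [Set.disjoint_left]
  intro a ha hb
  dsimp only at ha hb
  have hIJ : I = J := by
    rw [hI] at ha
    rw [hJ] at hb
    rw [hI, hJ, connectedComponentIn_eq ha, connectedComponentIn_eq hb]
  subst hIJ
  exact h rfl

theorem not_before_self (e : HalfEdge S) : ¬ e.Before e := fun h => by
  obtain ⟨x, hx⟩ := e.nonempty
  exact lt_irrefl x (h x hx x hx)

theorem before_trans {e f g : HalfEdge S} (h : e.Before f) (h' : f.Before g) : e.Before g := by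
  intro a ha c hc
  obtain ⟨b, hb⟩ := f.nonempty
  exact (h a ha b hb).trans (h' b hb c hc)

theorem before_total {e f : HalfEdge S} (hv : e.vertex = f.vertex) (hs : e.side = f.side)
    (h : e ≠ f) : e.Before f ∨ f.Before e := by
  have hd := disjoint_of_ne hv hs h
  obtain ⟨x, hx⟩ := e.nonempty
  obtain ⟨y, hy⟩ := f.nonempty
  have he := e.ordConnected
  have hf := f.ordConnected
  have key : ∀ {I J : Set ℝ}, I.OrdConnected → J.OrdConnected → Disjoint I J →
      ∀ {x y : ℝ}, x ∈ I → y ∈ J → x < y → ∀ a ∈ I, ∀ b ∈ J, a < b := by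
    intro I J hI hJ hd x y hx hy hxy a ha b hb
    rw [Set.disjoint_left] at hd
    by_contra hab
    rw [not_lt] at hab
    rcases le_total a y with hay | hay
    · exact hd ha (hJ.out hb hy ⟨hab, hay⟩)
    · exact hd (hI.out hx ha ⟨hxy.le, hay⟩) hy
  rcases lt_trichotomy x y with hxy | hxy | hxy
  · exact Or.inl (key he hf hd hx hy hxy)
  · exact (Set.disjoint_left.1 hd hx (hxy ▸ hy)).elim
  · exact Or.inr (key hf he hd.symm hy hx hxy)

end HalfEdge

/-! ### Striped atlases -/

/-- A striped atlas on `Z`: a quotient map `q` from a disjoint union of at most countably many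
strips onto `Z`, which glues together the boundary intervals `X γ` and `Y γ` (all of them being
mutually distinct, hence disjoint), and identifies no other points. -/
structure StripedAtlas (Z : Type u) [TopologicalSpace Z] where
  Λ : Type v
  countable : Countable Λ
  S : Λ → Strip
  q : (Σ l, (S l).carrier) → Z
  isQuotientMap : IsQuotientMap q
  Γ : Type w
  X : Γ → HalfEdge S
  Y : Γ → HalfEdge S
  X_injective : Function.Injective X
  Y_injective : Function.Injective Y
  X_ne_Y : ∀ γ δ, X γ ≠ Y δ
  injOn : InjOn q (⋃ γ, (X γ).toSet ∪ (Y γ).toSet)ᶜ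
  image_eq : ∀ γ, q '' (X γ).toSet = q '' (Y γ).toSet
  preimage_eq : ∀ γ, q ⁻¹' (q '' (X γ).toSet) = (X γ).toSet ∪ (Y γ).toSet
  embedding_X : ∀ γ, IsEmbedding (fun p : (X γ).toSet => q p) ∧ IsClosed (q '' (X γ).toSet)
  embedding_Y : ∀ γ, IsEmbedding (fun p : (Y γ).toSet => q p) ∧ IsClosed (q '' (Y γ).toSet)

namespace StripedAtlas

variable {Z : Type u} [TopologicalSpace Z] (A : StripedAtlas.{u, v, w} Z)

/-- The leaves of the canonical foliation of the disjoint union of strips: the horizontal lines of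
the interiors of the strips, and the boundary intervals. -/
def stripLeaves : Set (Set (Σ l, (A.S l).carrier)) :=
  {L | ∃ l, ∃ t ∈ Ioo (A.S l).lo (A.S l).hi,
      L = {p : Σ l, (A.S l).carrier | p.1 = l ∧ (p.2 : ℝ × ℝ).2 = t}} ∪
    range (fun e : HalfEdge A.S => e.toSet)

/-- The canonical foliation of `Z`, as the set of its leaves. -/
def foliation : Set (Set Z) := (fun L => A.q '' L) '' A.stripLeaves

/-- The union of the images of all boundary intervals of the strips. -/
def boundaryImage : Set Z := ⋃ e : HalfEdge A.S, A.q '' e.toSet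

/-- The gluing map `φ : Y γ → X γ`, `q (φ p) = q p`, is given in the first coordinate by one of the
two affine homeomorphisms `(c, d) → (a, b)`. -/
def IsAffineGluing (γ : A.Γ) : Prop :=
  ∃ a b c d : ℝ, a < b ∧ c < d ∧ (A.X γ).interval = Ioo a b ∧ (A.Y γ).interval = Ioo c d ∧
    ((∀ (y : (A.Y γ).interval) (x : (A.X γ).interval),
        A.q ((A.X γ).point x) = A.q ((A.Y γ).point y) →
          (x : ℝ) = (b - a) / (d - c) * ((y : ℝ) - c) + a) ∨
      (∀ (y : (A.Y γ).interval) (x : (A.X γ).interval),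
        A.q ((A.X γ).point x) = A.q ((A.Y γ).point y) →
          (x : ℝ) = (a - b) / (d - c) * ((y : ℝ) - c) + b))

/-- Affine atlases: all strips are model, and all gluing maps are affine. -/
def IsAffine : Prop := (∀ l, (A.S l).IsModel) ∧ ∀ γ, A.IsAffineGluing γ

end StripedAtlas

/-! ### Surfaces, special leaves, reduced atlases -/

/-- Two-dimensional topological manifolds, possibly with boundary. -/
def IsSurface (Z : Type u) [TopologicalSpace Z] : Prop :=
  T2Space Z ∧ ∀ z : Z, ∃ U : Set Z, IsOpen U ∧ z ∈ U ∧
    ∃ V : Set (ℝ × Ici (0 : ℝ)), IsOpen V ∧ Nonempty (U ≃ₜ V)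

/-- The boundary `∂Z` of a surface: the points without an open neighbourhood homeomorphic to the
plane. -/
def surfaceBoundary (Z : Type u) [TopologicalSpace Z] : Set Z :=
  {z | ¬ ∃ U : Set Z, IsOpen U ∧ z ∈ U ∧ Nonempty (U ≃ₜ ℝ × ℝ)}

/-- The intersection of the closures of all saturated neighbourhoods of the leaf `ω`; a set is
saturated when it is a union of leaves. -/
def hcl {Z : Type u} [TopologicalSpace Z] (Δ : Set (Set Z)) (ω : Set Z) : Set Z :=
  ⋂ U ∈ {U : Set Z | (∃ T ⊆ Δ, U = ⋃₀ T) ∧ U ∈ 𝓝ˢ ω}, closure U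

/-- The family of all special leaves of `Δ`. -/
def specialLeaves {Z : Type u} [TopologicalSpace Z] (Δ : Set (Set Z)) : Set (Set Z) :=
  {ω ∈ Δ | ω ≠ hcl Δ ω}

/-- Reduced atlases: the images of the boundary intervals of the strips are exactly the special
leaves and the boundary leaves of `Z`. -/
def StripedAtlas.IsReduced {Z : Type u} [TopologicalSpace Z] (A : StripedAtlas.{u, v, w} Z) :
    Prop :=
  A.boundaryImage = ⋃₀ specialLeaves A.foliation ∪ surfaceBoundary Z

/-! ### The graph of a striped atlas -/

/-- Graphs with half-edges `(Λ, H, ξ, σ)`; every half-edge `e` belongs to one of the two sets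
`d s l`, `s = ±1`, of half-edges incident to a vertex `l`, each of which is linearly ordered by
`lt`. The fixed points of the involution `ξ` are the half-open edges, the pairs `{e, ξ e}` with
`ξ e ≠ e` are the closed edges, and the values of `σ` matter on closed edges only. -/
structure StripedGraph where
  V : Type v
  H : Type w
  vertex : H → V
  side : H → ℤˣ
  lt : H → H → Prop
  lt_irrefl : ∀ e, ¬ lt e e
  lt_trans : ∀ e f g, lt e f → lt f g → lt e g
  lt_total : ∀ e f, vertex e = vertex f → side e = side f → e ≠ f → lt e f ∨ lt f e
  ξ : H → H
  ξ_ξ : ∀ e, ξ (ξ e) = e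
  σ : H → ℤˣ
  σ_ξ : ∀ e, σ (ξ e) = σ e

namespace StripedGraph

/-- The set `d_s(l)` of half-edges incident to `l` on the side `s`. -/
def d (G : StripedGraph.{v, w}) (l : G.V) (s : ℤˣ) : Set G.H := {e | G.vertex e = l ∧ G.side e = s}

/-- Automorphisms `(ν, η, lori, tori)` of a graph. -/
@[ext]
structure Aut (G : StripedGraph.{v, w}) where
  ν : Equiv.Perm G.V
  η : Equiv.Perm G.H
  lori : G.V → ℤˣ
  tori : G.V → ℤˣ
  image_d : ∀ l s, η '' G.d l s = G.d (ν l) (tori l * s)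
  increasing : ∀ l s, lori l = 1 → ∀ e ∈ G.d l s, ∀ f ∈ G.d l s, G.lt e f → G.lt (η e) (η f)
  decreasing : ∀ l s, lori l = -1 → ∀ e ∈ G.d l s, ∀ f ∈ G.d l s, G.lt e f → G.lt (η f) (η e)
  comm_ξ : ∀ e, G.ξ (η e) = η (G.ξ e)
  gluing : ∀ e, G.ξ e ≠ e →
    lori (G.vertex e) * G.σ e = G.σ (η e) * lori (G.vertex (G.ξ e))

namespace Aut

variable {G : StripedGraph.{v, w}}

theorem mem_d (a : Aut G) {l : G.V} {s : ℤˣ} {e : G.H} (he : e ∈ G.d l s) :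
    a.η e ∈ G.d (a.ν l) (a.tori l * s) := a.image_d l s ▸ mem_image_of_mem _ he

theorem vertex_η (a : Aut G) (e : G.H) : G.vertex (a.η e) = a.ν (G.vertex e) :=
  (a.mem_d (l := G.vertex e) (s := G.side e) ⟨rfl, rfl⟩).1

theorem side_η (a : Aut G) (e : G.H) : G.side (a.η e) = a.tori (G.vertex e) * G.side e :=
  (a.mem_d (l := G.vertex e) (s := G.side e) ⟨rfl, rfl⟩).2

instance : One (Aut G) where
  one :=
    { ν := 1
      η := 1
      lori := fun _ => 1
      tori := fun _ => 1
      image_d := by intro l s; simp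
      increasing := fun _ _ _ _ _ _ _ h => h
      decreasing := fun _ _ h => absurd h (by decide)
      comm_ξ := fun _ => rfl
      gluing := by intro e _; simp }

instance : Mul (Aut G) where
  mul a' a :=
    { ν := a'.ν * a.ν
      η := a'.η * a.η
      lori := fun l => a'.lori (a.ν l) * a.lori l
      tori := fun l => a'.tori (a.ν l) * a.tori l
      image_d := by
        intro l s
        rw [Equiv.Perm.coe_mul, image_comp, a.image_d, a'.image_d, mul_assoc, Equiv.Perm.mul_apply]
      increasing := by
        intro l s h e he f hf hef
        rcases Int.units_eq_one_or (a.lori l) with h1 | h1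
        · exact a'.increasing _ _ (by simpa [h1] using h) _ (a.mem_d he) _ (a.mem_d hf)
            (a.increasing l s h1 e he f hf hef)
        · exact a'.decreasing _ _ (by simpa [h1, neg_eq_iff_eq_neg] using h) _ (a.mem_d hf) _
            (a.mem_d he) (a.decreasing l s h1 e he f hf hef)
      decreasing := by
        intro l s h e he f hf hef
        rcases Int.units_eq_one_or (a.lori l) with h1 | h1
        · exact a'.decreasing _ _ (by simpa [h1] using h) _ (a.mem_d he) _ (a.mem_d hf)
            (a.increasing l s h1 e he f hf hef)
        · exact a'.increasing _ _ (by simpa [h1] using h) _ (a.mem_d hf) _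
            (a.mem_d he) (a.decreasing l s h1 e he f hf hef)
      comm_ξ := fun e => by simp [a.comm_ξ, a'.comm_ξ]
      gluing := by
        intro e he
        have h1 := a.gluing e he
        have h2 := a'.gluing (a.η e) (by rw [a.comm_ξ]; exact fun h => he (a.η.injective h))
        rw [a.comm_ξ, a.vertex_η, a.vertex_η] at h2
        rw [mul_assoc, h1, ← mul_assoc, h2, Equiv.Perm.mul_apply, mul_assoc] }

instance : Inv (Aut G) where
  inv a :=
    { ν := a.ν.symm
      η := a.η.symm
      lori := fun l => a.lori (a.ν.symm l)
      tori := fun l => a.tori (a.ν.symm l)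
      image_d := by
        intro l s
        have h := a.image_d (a.ν.symm l) (a.tori (a.ν.symm l) * s)
        rw [← mul_assoc, Int.units_mul_self, one_mul, Equiv.apply_symm_apply] at h
        rw [← h, ← image_comp, Equiv.symm_comp_self, image_id]
      increasing := by
        intro l s h e he f hf hef
        obtain ⟨e, rfl⟩ := a.η.surjective e
        obtain ⟨f, rfl⟩ := a.η.surjective f
        rw [Equiv.symm_apply_apply, Equiv.symm_apply_apply]
        have hv : G.vertex e = G.vertex f := a.ν.injective (by
          rw [← a.vertex_η, ← a.vertex_η, he.1, hf.1])
        have hl : a.ν.symm l = G.vertex e := by rw [← he.1, a.vertex_η, Equiv.symm_apply_apply]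
        have hs : G.side e = G.side f := by
          have h1 := he.2.trans hf.2.symm
          rw [a.side_η, a.side_η, hv] at h1
          exact mul_left_cancel h1
        rw [hl] at h
        rcases eq_or_ne e f with rfl | hne
        · exact (G.lt_irrefl _ hef).elim
        · refine (G.lt_total e f hv hs hne).resolve_right fun hfe => ?_
          exact G.lt_irrefl _ (G.lt_trans _ _ _ hef
            (a.increasing _ (G.side e) h f ⟨hv.symm, hs.symm⟩ e ⟨rfl, rfl⟩ hfe))
      decreasing := by
        intro l s h e he f hf hef
        obtain ⟨e, rfl⟩ := a.η.surjective e
        obtain ⟨f, rfl⟩ := a.η.surjective f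
        rw [Equiv.symm_apply_apply, Equiv.symm_apply_apply]
        have hv : G.vertex e = G.vertex f := a.ν.injective (by
          rw [← a.vertex_η, ← a.vertex_η, he.1, hf.1])
        have hl : a.ν.symm l = G.vertex e := by rw [← he.1, a.vertex_η, Equiv.symm_apply_apply]
        have hs : G.side e = G.side f := by
          have h1 := he.2.trans hf.2.symm
          rw [a.side_η, a.side_η, hv] at h1
          exact mul_left_cancel h1
        rw [hl] at h
        rcases eq_or_ne e f with rfl | hne
        · exact (G.lt_irrefl _ hef).elim
        · refine (G.lt_total e f hv hs hne).resolve_left fun hfe => ?_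
          exact G.lt_irrefl _ (G.lt_trans _ _ _ hef
            (a.decreasing _ (G.side e) h e ⟨rfl, rfl⟩ f ⟨hv.symm, hs.symm⟩ hfe))
      comm_ξ := fun e => by
        obtain ⟨e, rfl⟩ := a.η.surjective e
        rw [a.comm_ξ, Equiv.symm_apply_apply, Equiv.symm_apply_apply]
      gluing := by
        intro e he
        obtain ⟨e, rfl⟩ := a.η.surjective e
        have he' : G.ξ e ≠ e := fun h => he (by rw [a.comm_ξ, h])
        have h1 := a.gluing e he'
        rw [a.comm_ξ, a.vertex_η, a.vertex_η, Equiv.symm_apply_apply, Equiv.symm_apply_apply,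
          Equiv.symm_apply_apply]
        calc a.lori (G.vertex e) * G.σ (a.η e)
            = a.lori (G.vertex e) * (G.σ (a.η e) * a.lori (G.vertex (G.ξ e))) *
                a.lori (G.vertex (G.ξ e)) := by
              rw [mul_assoc, mul_assoc, Int.units_mul_self, mul_one]
          _ = G.σ e * a.lori (G.vertex (G.ξ e)) := by
              rw [← h1, ← mul_assoc, Int.units_mul_self, one_mul] }

/-- The group of automorphisms of a graph, with the multiplication
`(ν', η', l', t') (ν, η, l, t) = (ν' ∘ ν, η' ∘ η, (l' ∘ ν) · l, (t' ∘ ν) · t)`. -/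
instance : Group (Aut G) where
  mul_assoc a b c := by
    apply Aut.ext
    · exact mul_assoc a.ν b.ν c.ν
    · exact mul_assoc a.η b.η c.η
    · funext l; exact mul_assoc (a.lori _) (b.lori _) (c.lori _)
    · funext l; exact mul_assoc (a.tori _) (b.tori _) (c.tori _)
  one_mul a := by
    apply Aut.ext
    · exact one_mul a.ν
    · exact one_mul a.η
    · funext l; exact one_mul (a.lori l)
    · funext l; exact one_mul (a.tori l)
  mul_one a := by
    apply Aut.ext
    · exact mul_one a.ν
    · exact mul_one a.η
    · funext l; exact mul_one (a.lori l)
    · funext l; exact mul_one (a.tori l)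
  inv_mul_cancel a := by
    apply Aut.ext
    · exact inv_mul_cancel a.ν
    · exact inv_mul_cancel a.η
    · funext l
      change a.lori (a.ν.symm (a.ν l)) * a.lori l = 1
      rw [Equiv.symm_apply_apply, Int.units_mul_self]
    · funext l
      change a.tori (a.ν.symm (a.ν l)) * a.tori l = 1
      rw [Equiv.symm_apply_apply, Int.units_mul_self]

end Aut

end StripedGraph

namespace StripedAtlas

variable {Z : Type u} [TopologicalSpace Z] (A : StripedAtlas.{u, v, w} Z)

open Classical in
/-- The involution of the boundary intervals which interchanges `X γ` with `Y γ` and fixes all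
intervals that are not glued. -/
def ξ (e : HalfEdge A.S) : HalfEdge A.S :=
  if h : ∃ γ, A.X γ = e then A.Y h.choose
  else if h : ∃ γ, A.Y γ = e then A.X h.choose
  else e

theorem ξ_X (γ : A.Γ) : A.ξ (A.X γ) = A.Y γ := by
  have h : ∃ δ, A.X δ = A.X γ := ⟨γ, rfl⟩
  rw [ξ, dif_pos h, A.X_injective h.choose_spec]

theorem ξ_Y (γ : A.Γ) : A.ξ (A.Y γ) = A.X γ := by
  have h0 : ¬ ∃ δ, A.X δ = A.Y γ := fun ⟨δ, h⟩ => A.X_ne_Y δ γ h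
  have h : ∃ δ, A.Y δ = A.Y γ := ⟨γ, rfl⟩
  rw [ξ, dif_neg h0, dif_pos h, A.Y_injective h.choose_spec]

theorem ξ_eq_self {e : HalfEdge A.S} (hX : ¬ ∃ γ, A.X γ = e) (hY : ¬ ∃ γ, A.Y γ = e) :
    A.ξ e = e := by
  rw [ξ, dif_neg hX, dif_neg hY]

theorem ξ_ξ (e : HalfEdge A.S) : A.ξ (A.ξ e) = e := by
  by_cases hX : ∃ γ, A.X γ = e
  · obtain ⟨γ, rfl⟩ := hX
    rw [ξ_X, ξ_Y]
  · by_cases hY : ∃ γ, A.Y γ = e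
    · obtain ⟨γ, rfl⟩ := hY
      rw [ξ_Y, ξ_X]
    · rw [A.ξ_eq_self hX hY, A.ξ_eq_self hX hY]

/-- The gluing of `e` with `ξ e` preserves the orientation of the first coordinate. -/
def PreservesOrientation (e : HalfEdge A.S) : Prop :=
  ∀ (s t : e.interval) (s' t' : (A.ξ e).interval),
    A.q (e.point s) = A.q ((A.ξ e).point s') → A.q (e.point t) = A.q ((A.ξ e).point t') →
      s < t → s' < t'

open Classical in
/-- The orientation of gluing of `e` with `ξ e`. -/
def σ (e : HalfEdge A.S) : ℤˣ := if A.PreservesOrientation e then 1 else -1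

theorem preservesOrientation_symm_X (γ : A.Γ) :
    A.PreservesOrientation (A.X γ) ↔ A.PreservesOrientation (A.Y γ) := by
  have inj : ∀ {e : HalfEdge A.S}, IsEmbedding (fun p : e.toSet => A.q p) → ∀ s t : e.interval,
      A.q (e.point s) = A.q (e.point t) → s = t := by
    intro e he s t h
    have h1 := congrArg Subtype.val
      (he.injective (a₁ := ⟨e.point s, s, rfl⟩) (a₂ := ⟨e.point t, t, rfl⟩) h)
    simp only [HalfEdge.point, Sigma.mk.injEq, heq_eq_eq, true_and, Subtype.mk.injEq,
      Prod.mk.injEq, and_true] at h1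
    exact Subtype.ext h1
  unfold PreservesOrientation
  rw [ξ_X, ξ_Y]
  constructor
  · intro h s t s' t' hs ht hst
    rcases lt_trichotomy s' t' with h1 | h1 | h1
    · exact h1
    · subst h1
      exact absurd (inj (A.embedding_Y γ).1 s t (hs.trans ht.symm)) hst.ne
    · exact absurd (h t' s' t s ht.symm hs.symm h1) hst.asymm
  · intro h s t s' t' hs ht hst
    rcases lt_trichotomy s' t' with h1 | h1 | h1
    · exact h1
    · subst h1
      exact absurd (inj (A.embedding_X γ).1 s t (hs.trans ht.symm)) hst.ne
    · exact absurd (h t' s' t s ht.symm hs.symm h1) hst.asymm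

theorem σ_ξ (e : HalfEdge A.S) : A.σ (A.ξ e) = A.σ e := by
  by_cases hX : ∃ γ, A.X γ = e
  · obtain ⟨γ, rfl⟩ := hX
    rw [ξ_X, σ, σ, A.preservesOrientation_symm_X γ]
  · by_cases hY : ∃ γ, A.Y γ = e
    · obtain ⟨γ, rfl⟩ := hY
      rw [ξ_Y, σ, σ, A.preservesOrientation_symm_X γ]
    · rw [A.ξ_eq_self hX hY]

/-- The graph of a striped atlas. -/
def graph : StripedGraph where
  V := A.Λ
  H := HalfEdge A.S
  vertex := HalfEdge.vertex
  side := HalfEdge.side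
  lt := HalfEdge.Before
  lt_irrefl := HalfEdge.not_before_self
  lt_trans _ _ _ := HalfEdge.before_trans
  lt_total _ _ := HalfEdge.before_total
  ξ := A.ξ
  ξ_ξ := A.ξ_ξ
  σ := A.σ
  σ_ξ := A.σ_ξ

end StripedAtlas

/-! ### Foliated homeomorphisms and the homeotopy group -/

section Homeo

variable {Z : Type u} [TopologicalSpace Z]

/-- Foliated homeomorphisms: leaves are sent onto leaves by `h` and by its inverse (when both
families of leaves are partitions, the second half follows from the first). -/
def IsFoliated {Z' : Type v} [TopologicalSpace Z'] (Δ : Set (Set Z)) (Δ' : Set (Set Z'))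
    (h : Z ≃ₜ Z') : Prop :=
  (∀ ω ∈ Δ, h '' ω ∈ Δ') ∧ ∀ ω ∈ Δ', h.symm '' ω ∈ Δ

def FoliatedHomeomorphic {Z' : Type v} [TopologicalSpace Z'] (Δ : Set (Set Z))
    (Δ' : Set (Set Z')) : Prop :=
  ∃ h : Z ≃ₜ Z', IsFoliated Δ Δ' h

/-- The group `H(Δ)` of foliated homeomorphisms of `(Z, Δ)`. -/
def homeoGroup (Δ : Set (Set Z)) : Subgroup (Z ≃ₜ Z) where
  carrier := {h | IsFoliated Δ Δ h}
  one_mem' := by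
    refine ⟨fun ω hω => ?_, fun ω hω => ?_⟩
    · rwa [show ((1 : Z ≃ₜ Z) : Z → Z) '' ω = ω from image_id ω]
    · rwa [show ((1 : Z ≃ₜ Z).symm : Z → Z) '' ω = ω from image_id ω]
  mul_mem' := by
    intro f g hf hg
    refine ⟨fun ω hω => ?_, fun ω hω => ?_⟩
    · rw [show ((f * g : Z ≃ₜ Z) : Z → Z) '' ω = f '' (g '' ω) from image_comp f g ω]
      exact hf.1 _ (hg.1 _ hω)
    · rw [show ((f * g : Z ≃ₜ Z).symm : Z → Z) '' ω = g.symm '' (f.symm '' ω) from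
        image_comp g.symm f.symm ω]
      exact hg.2 _ (hf.2 _ hω)
  inv_mem' := fun h => ⟨h.2, h.1⟩

/-- The compact-open topology on `H(Δ)`. -/
instance (Δ : Set (Set Z)) : TopologicalSpace (homeoGroup Δ) :=
  TopologicalSpace.induced (fun h => (⟨h.1, h.1.continuous⟩ : C(Z, Z))) inferInstance

theorem homeoGroup_isInducing (Δ : Set (Set Z)) :
    IsInducing (fun h : homeoGroup Δ => (⟨h.1, h.1.continuous⟩ : C(Z, Z))) := ⟨rfl⟩

theorem continuous_homeoGroup_mul_left {Δ : Set (Set Z)} (g : homeoGroup Δ) :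
    Continuous (fun f : homeoGroup Δ => g * f) := by
  rw [(homeoGroup_isInducing Δ).continuous_iff]
  exact (ContinuousMap.continuous_postcomp (⟨g.1, g.1.continuous⟩ : C(Z, Z))).comp
    (homeoGroup_isInducing Δ).continuous

theorem continuous_homeoGroup_mul_right {Δ : Set (Set Z)} (g : homeoGroup Δ) :
    Continuous (fun f : homeoGroup Δ => f * g) := by
  rw [(homeoGroup_isInducing Δ).continuous_iff]
  exact (ContinuousMap.continuous_precomp (⟨g.1, g.1.continuous⟩ : C(Z, Z))).comp
    (homeoGroup_isInducing Δ).continuous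

/-- `H₀(Δ)`: the path component of the identity in `H(Δ)`. -/
def identityComponent (Δ : Set (Set Z)) : Subgroup (homeoGroup Δ) where
  carrier := pathComponent 1
  one_mem' := mem_pathComponent_self 1
  mul_mem' := by
    intro f g hf hg
    have h := Joined.map (show Joined 1 g from hg) (continuous_homeoGroup_mul_left f)
    rw [mul_one] at h
    exact Joined.trans (show Joined 1 f from hf) h
  inv_mem' := by
    intro f hf
    have h := Joined.map (show Joined 1 f from hf) (continuous_homeoGroup_mul_left f⁻¹)
    rw [mul_one, inv_mul_cancel] at h
    exact h.symm

instance (Δ : Set (Set Z)) : (identityComponent Δ).Normal where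
  conj_mem f hf g := by
    have h := Joined.map (show Joined 1 f from hf)
      ((continuous_homeoGroup_mul_right g⁻¹).comp (continuous_homeoGroup_mul_left g))
    simp only [Function.comp_apply, mul_one, mul_inv_cancel] at h
    exact h

/-- The homeotopy group `π₀ H(Δ) = H(Δ) / H₀(Δ)`. -/
abbrev HomeotopyGroup (Δ : Set (Set Z)) : Type u := homeoGroup Δ ⧸ identityComponent Δ

end Homeo

/-! ### The foliated open cylinder and the foliated open Möbius band -/

/-- The strip `ℝ × [0, 1]` with `(x, 0)` glued to `(f x, 1)` for all `x`. -/
def Band (f : ℝ → ℝ) : Type :=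
  Quot (fun p p' : ℝ × unitInterval => p.2 = 0 ∧ p'.2 = 1 ∧ p'.1 = f p.1)

instance (f : ℝ → ℝ) : TopologicalSpace (Band f) :=
  inferInstanceAs (TopologicalSpace (Quot _))

/-- The foliation of a band by the images of the lines `ℝ × {t}`, `0 ≤ t ≤ 1`. -/
def bandFoliation (f : ℝ → ℝ) : Set (Set (Band f)) :=
  range (fun t : unitInterval => range (fun x : ℝ => (Quot.mk _ (x, t) : Band f)))

/-- `(Z, Δ)` is foliated homeomorphic to the open cylinder. -/
def IsOpenCylinder {Z : Type u} [TopologicalSpace Z] (Δ : Set (Set Z)) : Prop :=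
  FoliatedHomeomorphic Δ (bandFoliation fun x => x)

/-- `(Z, Δ)` is foliated homeomorphic to the open Möbius band. -/
def IsOpenMoebius {Z : Type u} [TopologicalSpace Z] (Δ : Set (Set Z)) : Prop :=
  FoliatedHomeomorphic Δ (bandFoliation fun x => -x)

end Striped

end

/-!
The proof separates the reduced atlases from the two exceptional surfaces.

*Reduced atlases.* The special leaves and the boundary of `Z` are preserved by every foliated
homeomorphism `h`, hence so is the union of the images of the boundary intervals. On its complement
`q` is injective, so `h` lifts there to the interiors of the strips. Since `q` is a proper map with
fibres of at most two points and the strips are locally connected up to the boundary, the lift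
extends continuously to the sides (`StripedAtlas.exists_continuous_lift`), and it depends
continuously on `h` (`StripedAtlas.continuous_of_continuous_q`). A lift permutes the strips, their
horizontal lines and their boundary intervals, and this combinatorial information is an automorphism
of the graph (`StripedAtlas.exists_induces`). The resulting homomorphism
`StripedAtlas.graphAction : H(Δ) → Aut G` has the following properties.

* It is constant on connected families. If `h` lies in its kernel, the lift `k` preserves every
  strip, side and boundary interval and is increasing in both coordinates, so the convex combinations
  `(1 - s) k + s id` are homeomorphisms of the strips. The gluing maps are affine, so these descend to
  `Z`. The kernel is therefore contractible, and it is the identity component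
  (`StripedAtlas.identityComponent_eq_ker`, `StripedAtlas.contractibleSpace_identityComponent`).
* It is surjective (`StripedAtlas.graphAction_surjective`). An automorphism of the graph prescribes
  affine maps of the boundary intervals, which on each side of a strip combine to a monotone function
  on an open subset of the line. There is a family of increasing homeomorphisms of the line that
  converges to two prescribed functions of this kind at its two ends
  (`exists_two_sided_interpolation`); it is built from averages of a monotone extension.

That a continuous bijection between strips which is strictly monotone in both coordinates is
a homeomorphism is `isHomeomorph_of_strictMono`.

*The open cylinder and the open Möbius band.* Both are quotients of the plane by the group generated
by `(x, t) ↦ (ε x, t + 1)` with `ε = ±1`. Foliated homeomorphisms lift to the plane, continuously in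
the homeomorphism and the image of the origin (`exists_bandLift`). The identity component consists of
the homeomorphisms that have a lift which is increasing in both coordinates
(`mem_identityComponent_iff`); the straight line from such a lift to a vertical translation descends
to a deformation of the identity component to a circle of rotations (`nonempty_homotopyEquiv_circle`).
For the cylinder, two signs detect the component of a homeomorphism
(`nonempty_homeotopyGroup_cylinder`). An atlas of the cylinder with a single strip has exactly one
boundary interval on each side (`StripedAtlas.existsUnique_halfEdge_of_cylinder`), so the
automorphisms of its graph are also given by two signs (`StripedGraph.nonempty_aut_mulEquiv`).
-/

noncomputable section

namespace Striped

open Filter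

/-! ### Monotone homeomorphisms of plane sets -/

/-- A continuous bijection between plane sets that maps rows to rows and is strictly monotone on
rows and between rows is a homeomorphism, if its source is relatively open in the union of the
rows it meets: the strict inequalities between the images of a point and of its neighbours on the
same row and on nearby rows persist near the image point and confine the inverse. -/
theorem isHomeomorph_of_strictMono {W W' : Set (ℝ × ℝ)}
    (hW : ∀ w ∈ W, ∀ᶠ v in 𝓝 w, (∃ x, (x, v.2) ∈ W) → v ∈ W)
    (hJ : OrdConnected {y : ℝ | ∃ x, (x, y) ∈ W})
    (F : W → W') (hF : Continuous F) (hb : Function.Bijective F) (τ ε : ℝ)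
    (hyy : ∀ p p' : W, p.1.2 = p'.1.2 → (F p).1.2 = (F p').1.2)
    (hy : ∀ p p' : W, p.1.2 < p'.1.2 → 0 < τ * ((F p').1.2 - (F p).1.2))
    (hx : ∀ p p' : W, p.1.2 = p'.1.2 → p.1.1 < p'.1.1 → 0 < ε * ((F p').1.1 - (F p).1.1)) :
    IsHomeomorph F := by
  set e := Equiv.ofBijective F hb with he
  have eF : ∀ p', F (e.symm p') = p' := fun p' => e.apply_symm_apply p'
  refine (Equiv.isHomeomorph_iff e).2 ⟨hF, ?_⟩
  rw [continuous_iff_continuousAt]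
  intro z
  obtain ⟨w₀, rfl⟩ := hb.2 z
  have ew : e.symm (F w₀) = w₀ := e.symm_apply_apply w₀
  have cfst : Continuous fun p : W => (F p).1.1 := continuous_fst.comp (continuous_subtype_val.comp hF)
  have c2 : Continuous fun p : W' => p.1.2 := continuous_snd.comp continuous_subtype_val
  have c1 : Continuous fun p : W' => p.1.1 := continuous_fst.comp continuous_subtype_val
  -- signs of height differences to a fixed point persist
  have keyY : ∀ p₁ : W, p₁.1.2 ≠ w₀.1.2 → ∀ᶠ p' in 𝓝 (F w₀),
      0 < (w₀.1.2 - p₁.1.2) * ((e.symm p').1.2 - p₁.1.2) := by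
    intro p₁ h1
    have h0 : 0 < (w₀.1.2 - p₁.1.2) * (τ * ((F w₀).1.2 - (F p₁).1.2)) := by
      rcases lt_or_gt_of_ne h1 with h | h
      · exact mul_pos (sub_pos.2 h) (hy _ _ h)
      · have := hy _ _ h
        nlinarith [mul_pos (sub_pos.2 h) this]
    have hc : Continuous fun p' : W' => (w₀.1.2 - p₁.1.2) * (τ * (p'.1.2 - (F p₁).1.2)) := by
      fun_prop
    filter_upwards [hc.continuousAt.eventually (lt_mem_nhds h0)] with p' hp'
    set p := e.symm p' with hp
    rw [← eF p', ← hp] at hp'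
    rcases lt_trichotomy p.1.2 p₁.1.2 with h | h | h
    · have := hy _ _ h
      have h3 : w₀.1.2 - p₁.1.2 < 0 := by
        by_contra h4
        nlinarith [mul_nonneg (not_lt.1 h4) this.le]
      nlinarith
    · rw [hyy _ _ h] at hp'
      simp at hp'
    · have := hy _ _ h
      have h3 : 0 < w₀.1.2 - p₁.1.2 := by
        by_contra h4
        nlinarith [mul_nonneg (neg_nonneg.2 (not_lt.1 h4)) this.le]
      exact mul_pos h3 (sub_pos.2 h)
  have tendY : Tendsto (fun p' => (e.symm p').1.2) (𝓝 (F w₀)) (𝓝 w₀.1.2) := by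
    rw [tendsto_order]
    constructor
    · intro a ha
      by_cases hex : ∃ p : W, p.1.2 < w₀.1.2
      · obtain ⟨p, hp⟩ := hex
        obtain ⟨x, hx⟩ : max a p.1.2 ∈ {y : ℝ | ∃ x, (x, y) ∈ W} :=
          hJ.out ⟨p.1.1, p.2⟩ ⟨w₀.1.1, w₀.2⟩ ⟨le_max_right _ _, (max_lt ha hp).le⟩
        have hlt : max a p.1.2 < w₀.1.2 := max_lt ha hp
        filter_upwards [keyY ⟨_, hx⟩ hlt.ne] with p' hp'
        have := (pos_iff_pos_of_mul_pos hp').1 (sub_pos.2 hlt)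
        exact (le_max_left _ _).trans_lt (sub_pos.1 this)
      · push Not at hex
        exact Eventually.of_forall fun p' => ha.trans_le (hex _)
    · intro a ha
      by_cases hex : ∃ p : W, w₀.1.2 < p.1.2
      · obtain ⟨p, hp⟩ := hex
        obtain ⟨x, hx⟩ : min a p.1.2 ∈ {y : ℝ | ∃ x, (x, y) ∈ W} :=
          hJ.out ⟨w₀.1.1, w₀.2⟩ ⟨p.1.1, p.2⟩ ⟨(lt_min ha hp).le, min_le_right _ _⟩
        have hlt : w₀.1.2 < min a p.1.2 := lt_min ha hp
        filter_upwards [keyY ⟨_, hx⟩ hlt.ne'] with p' hp'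
        have := (neg_iff_neg_of_mul_pos hp').1 (sub_neg.2 hlt)
        exact (sub_neg.1 this).trans_le (min_le_left _ _)
      · push Not at hex
        exact Eventually.of_forall fun p' => (hex _).trans_lt ha
  have keyX : ∀ x₁ : ℝ, (∀ᶠ y in 𝓝 w₀.1.2, (∃ x, (x, y) ∈ W) → (x₁, y) ∈ W) → x₁ ≠ w₀.1.1 →
      ∀ᶠ p' in 𝓝 (F w₀), 0 < (w₀.1.1 - x₁) * ((e.symm p').1.1 - x₁) := by
    intro x₁ h1 hne
    have hx₁ : (x₁, w₀.1.2) ∈ W := h1.self_of_nhds ⟨_, w₀.2⟩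
    set p₁ : W := ⟨(x₁, w₀.1.2), hx₁⟩ with hp₁
    classical
    set G : W' → W := fun p' => if h : (x₁, (e.symm p').1.2) ∈ W then ⟨_, h⟩ else p₁ with hG
    have hGW : ∀ᶠ p' in 𝓝 (F w₀), (G p').1 = (x₁, (e.symm p').1.2) := by
      filter_upwards [tendY.eventually h1] with p' hp'
      have h := hp' ⟨_, (e.symm p').2⟩
      simp only [hG, dif_pos h]
    have tG : Tendsto G (𝓝 (F w₀)) (𝓝 p₁) := by
      rw [tendsto_subtype_rng]
      exact Tendsto.congr' (hGW.mono fun _ h => h.symm) (tendsto_const_nhds.prodMk_nhds tendY)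
    have h0 : 0 < (w₀.1.1 - x₁) * (ε * ((F w₀).1.1 - (F p₁).1.1)) := by
      rcases lt_or_gt_of_ne hne with h | h
      · exact mul_pos (sub_pos.2 h) (hx p₁ w₀ rfl h)
      · have := hx w₀ p₁ rfl h
        nlinarith [mul_pos (sub_pos.2 h) this]
    have hT : Tendsto (fun p' : W' => (w₀.1.1 - x₁) * (ε * (p'.1.1 - (F (G p')).1.1))) (𝓝 (F w₀))
        (𝓝 ((w₀.1.1 - x₁) * (ε * ((F w₀).1.1 - (F p₁).1.1)))) :=
      ((c1.continuousAt.tendsto.sub ((cfst.tendsto p₁).comp tG)).const_mul _).const_mul _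
    filter_upwards [hT.eventually (lt_mem_nhds h0), hGW] with p' hp' hG'
    set p := e.symm p' with hp
    rw [← eF p', ← hp] at hp'
    set g := G (F p)
    have hg : g = G p' := by rw [← eF p', ← hp]
    rw [← hg] at hG'
    have hgy : g.1.2 = p.1.2 := by rw [hG']
    have hgx : g.1.1 = x₁ := by rw [hG']
    rcases lt_trichotomy p.1.1 x₁ with h | h | h
    · have := hx p g hgy.symm (hgx ▸ h)
      have h3 : w₀.1.1 - x₁ < 0 := by
        by_contra h4
        nlinarith [mul_nonneg (not_lt.1 h4) this.le]
      nlinarith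
    · have : p = g := Subtype.ext (Prod.ext (h.trans hgx.symm) hgy.symm)
      rw [← this] at hp'
      simp at hp'
    · have := hx g p hgy (hgx ▸ h)
      have h3 : 0 < w₀.1.1 - x₁ := by
        by_contra h4
        nlinarith [mul_nonneg (neg_nonneg.2 (not_lt.1 h4)) this.le]
      exact mul_pos h3 (sub_pos.2 h)
  have hcur : ∀ᶠ x in 𝓝 w₀.1.1, ∀ᶠ y in 𝓝 w₀.1.2, (∃ x, (x, y) ∈ W) → (x, y) ∈ W := by
    have := hW w₀.1 w₀.2
    rw [show w₀.1 = (w₀.1.1, w₀.1.2) from rfl, nhds_prod_eq] at this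
    exact this.curry
  have tendX : Tendsto (fun p' => (e.symm p').1.1) (𝓝 (F w₀)) (𝓝 w₀.1.1) := by
    rw [tendsto_order]
    constructor
    · intro a ha
      obtain ⟨x₁, h1, h2⟩ :=
        ((hcur.filter_mono nhdsWithin_le_nhds).and (Ioo_mem_nhdsLT ha)).exists
      filter_upwards [keyX x₁ h1 h2.2.ne] with p' hp'
      have := (pos_iff_pos_of_mul_pos hp').1 (sub_pos.2 h2.2)
      exact h2.1.trans (sub_pos.1 this)
    · intro a ha
      obtain ⟨x₁, h1, h2⟩ :=
        ((hcur.filter_mono nhdsWithin_le_nhds).and (Ioo_mem_nhdsGT ha)).exists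
      filter_upwards [keyX x₁ h1 h2.1.ne'] with p' hp'
      have := (neg_iff_neg_of_mul_pos hp').1 (sub_neg.2 h2.1)
      exact (sub_neg.1 this).trans h2.2
  unfold ContinuousAt
  rw [ew, tendsto_subtype_rng]
  exact tendX.prodMk_nhds tendY

/-! ### Convex combinations of increasing surjections -/

/-- A convex combination of the identity with a monotone surjection of an interval is onto. -/
theorem exists_convexComb_eq {J : Set ℝ} (hJ : OrdConnected J) {f : J → ℝ} (hf : Continuous f)
    (hmono : ∀ a b : J, (a : ℝ) ≤ b → f a ≤ f b) (hs : ∀ y ∈ J, ∃ a, f a = y) {s : ℝ} (h0 : 0 ≤ s)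
    (h1 : s ≤ 1) {y : ℝ} (hy : y ∈ J) : ∃ a : J, (1 - s) * f a + s * a = y := by
  have : PreconnectedSpace J := Subtype.preconnectedSpace hJ.isPreconnected
  obtain ⟨a, ha⟩ := hs y hy
  -- the combination is at most `y` at the smaller one of `a` and `y`, and at least `y` at the other
  have key : ∀ b : J, (b : ℝ) ≤ y → f b ≤ y → (1 - s) * f b + s * b ≤ y := fun b h2 h3 => by
    nlinarith
  have key' : ∀ b : J, y ≤ b → y ≤ f b → y ≤ (1 - s) * f b + s * b := fun b h2 h3 => by
    nlinarith
  have hF : Continuous fun a : J => (1 - s) * f a + s * a := by fun_prop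
  rcases le_total (a : ℝ) y with h | h
  · exact mem_range_of_exists_le_of_exists_ge hF ⟨a, key a h ha.le⟩
      ⟨⟨y, hy⟩, key' ⟨y, hy⟩ le_rfl (ha ▸ hmono a ⟨y, hy⟩ h)⟩
  · exact mem_range_of_exists_le_of_exists_ge hF
      ⟨⟨y, hy⟩, key ⟨y, hy⟩ le_rfl (ha ▸ hmono ⟨y, hy⟩ a h)⟩ ⟨a, key' a h ha.ge⟩

/-! ### Interpolation between monotone maps on the two sides of a strip -/

/-- The average of `Ψ` over `[x, x + δ]`, which is `Ψ x` for `δ = 0`. -/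
def rightAverage (Ψ : ℝ → ℝ) (δ x : ℝ) : ℝ := ∫ u in (0 : ℝ)..1, Ψ (x + δ * u)

theorem intervalIntegrable_rightAverage {Ψ : ℝ → ℝ} (hΨ : Monotone Ψ) {δ : ℝ} (hδ : 0 ≤ δ)
    (x : ℝ) : IntervalIntegrable (fun u => Ψ (x + δ * u)) MeasureTheory.volume 0 1 :=
  Monotone.intervalIntegrable fun _ _ h => hΨ (by nlinarith)

theorem rightAverage_mono {Ψ : ℝ → ℝ} (hΨ : Monotone Ψ) {δ : ℝ} (hδ : 0 ≤ δ) :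
    Monotone (rightAverage Ψ δ) := fun x y hxy =>
  intervalIntegral.integral_mono_on zero_le_one (intervalIntegrable_rightAverage hΨ hδ x)
    (intervalIntegrable_rightAverage hΨ hδ y) fun _ _ => hΨ (by linarith)

theorem abs_rightAverage_le {Ψ : ℝ → ℝ} {C : ℝ} (hC : ∀ x, |Ψ x| ≤ C) (δ x : ℝ) :
    |rightAverage Ψ δ x| ≤ C := by
  have := intervalIntegral.norm_integral_le_of_norm_le_const (a := 0) (b := 1)
    (f := fun u => Ψ (x + δ * u)) (C := C) fun u _ => hC _
  simpa [rightAverage] using this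

/-- Averages of a bounded monotone function depend continuously on the interval, since the function
has only countably many discontinuities. -/
theorem continuousAt_rightAverage {Ψ : ℝ → ℝ} (hΨ : Monotone Ψ) {C : ℝ} (hC : ∀ x, |Ψ x| ≤ C)
    {δ x : ℝ} (h : δ ≠ 0 ∨ ContinuousAt Ψ x) :
    ContinuousAt (fun p : ℝ × ℝ => rightAverage Ψ p.1 p.2) (δ, x) := by
  refine intervalIntegral.continuousAt_of_dominated_interval (bound := fun _ => C) ?_ ?_ ?_ ?_
  · exact Eventually.of_forall fun p =>
      (hΨ.measurable.comp (by fun_prop)).aestronglyMeasurable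
  · exact Eventually.of_forall fun p => Eventually.of_forall fun u _ => hC _
  · exact intervalIntegrable_const
  · have hlin : ∀ u : ℝ, ContinuousAt (fun p : ℝ × ℝ => p.2 + p.1 * u) (δ, x) := fun u => by
      fun_prop
    by_cases hδ : δ = 0
    · subst hδ
      refine Eventually.of_forall fun u _ => ?_
      have hu : ContinuousAt Ψ (x + 0 * u) := by simpa using h.resolve_left (by simp)
      exact ContinuousAt.comp (f := fun p : ℝ × ℝ => p.2 + p.1 * u) hu (hlin u)
    · have hinj : Function.Injective fun u : ℝ => x + δ * u := fun a b hab => by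
        simpa [hδ] using hab
      have hcount : {u : ℝ | ¬ ContinuousAt Ψ (x + δ * u)}.Countable :=
        hΨ.countable_not_continuousAt.preimage hinj
      filter_upwards [hcount.ae_notMem MeasureTheory.volume] with u hu _
      have hu' : ContinuousAt Ψ (x + δ * u) := by simpa using hu
      exact ContinuousAt.comp (f := fun p : ℝ × ℝ => p.2 + p.1 * u) hu' (hlin u)

/-- A continuous monotone map `φ` on an open set `D` of reals is the limit, for `δ → 0`, of
increasing homeomorphisms `f δ` of the line: extend `arctan ∘ φ` to a bounded monotone function,
average it over `[x, x + δ]`, apply `tan` after a slight contraction, and add `δ * x`. -/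
theorem exists_interpolation {D : Set ℝ} (hD : IsOpen D) {φ : ℝ → ℝ} (hc : ContinuousOn φ D)
    (hm : MonotoneOn φ D) : ∃ f : ℝ → ℝ → ℝ, (∀ x ∈ D, f 0 x = φ x) ∧
      (∀ δ ∈ Ioc (0 : ℝ) 1, StrictMono (f δ)) ∧
      (∀ δ ∈ Ioc (0 : ℝ) 1, ∃ C, ∀ x, |f δ x - δ * x| ≤ C) ∧
      ∀ δ ∈ Icc (0 : ℝ) 1, ∀ x, 0 < δ ∨ x ∈ D →
        ContinuousAt (fun p : ℝ × ℝ => f p.1 p.2) (δ, x) := by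
  have hπ := Real.pi_pos
  have hm' : MonotoneOn (fun x => Real.arctan (φ x)) D := fun x hx y hy hxy =>
    Real.arctan_strictMono.monotone (hm hx hy hxy)
  obtain ⟨Ψ₀, hΨ₀, hEq⟩ := hm'.exists_monotone_extension
    ⟨-(Real.pi / 2), by rintro _ ⟨x, -, rfl⟩; exact (Real.neg_pi_div_two_lt_arctan _).le⟩
    ⟨Real.pi / 2, by rintro _ ⟨x, -, rfl⟩; exact (Real.arctan_lt_pi_div_two _).le⟩
  set Ψ : ℝ → ℝ := fun x => max (-(Real.pi / 2)) (min (Real.pi / 2) (Ψ₀ x)) with hΨdef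
  have hΨ : Monotone Ψ := fun x y hxy => max_le_max le_rfl (min_le_min le_rfl (hΨ₀ hxy))
  have hC : ∀ x, |Ψ x| ≤ Real.pi / 2 := fun x => abs_le.2
    ⟨le_max_left _ _, max_le (by linarith) (min_le_left _ _)⟩
  have hΨD : ∀ x ∈ D, Ψ x = Real.arctan (φ x) := fun x hx => by
    simp only [hΨdef, ← hEq hx]
    rw [min_eq_right (Real.arctan_lt_pi_div_two _).le,
      max_eq_right (Real.neg_pi_div_two_lt_arctan _).le]
  have hΨc : ∀ x ∈ D, ContinuousAt Ψ x := fun x hx => by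
    have h1 : ContinuousAt (fun x => Real.arctan (φ x)) x :=
      Real.continuous_arctan.continuousAt.comp (hc.continuousAt (hD.mem_nhds hx))
    exact h1.congr (Filter.mem_of_superset (hD.mem_nhds hx) fun y hy => (hΨD y hy).symm)
  set M := rightAverage Ψ with hM
  have hM0 : ∀ x, M 0 x = Ψ x := fun x => by simp [hM, rightAverage]
  have hMb : ∀ δ ∈ Ioc (0 : ℝ) 1, ∀ x, |(1 - δ) * M δ x| ≤ (1 - δ) * (Real.pi / 2) :=
    fun δ hδ x => by
      rw [abs_mul, abs_of_nonneg (by linarith [hδ.2])]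
      exact mul_le_mul_of_nonneg_left (abs_rightAverage_le hC δ x) (by linarith [hδ.2])
  have hMlt : ∀ δ ∈ Icc (0 : ℝ) 1, ∀ x, 0 < δ ∨ x ∈ D →
      (1 - δ) * M δ x ∈ Ioo (-(Real.pi / 2)) (Real.pi / 2) := fun δ hδ x h => by
    by_cases hδ0 : 0 < δ
    · have h1 := hMb δ ⟨hδ0, hδ.2⟩ x
      rw [mem_Ioo, ← abs_lt]
      nlinarith
    · have : δ = 0 := le_antisymm (not_lt.1 hδ0) hδ.1
      subst this
      rw [hM0, hΨD x (h.resolve_left hδ0)]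
      simpa using ⟨Real.neg_pi_div_two_lt_arctan _, Real.arctan_lt_pi_div_two _⟩
  refine ⟨fun δ x => Real.tan ((1 - δ) * M δ x) + δ * x, ?_, ?_, ?_, ?_⟩
  · intro x hx
    simp [hM0, hΨD x hx, Real.tan_arctan]
  · intro δ hδ x y hxy
    have hδ' : δ ∈ Icc (0 : ℝ) 1 := Ioc_subset_Icc_self hδ
    refine add_lt_add_of_le_of_lt ?_ (mul_lt_mul_of_pos_left hxy hδ.1)
    exact Real.strictMonoOn_tan.monotoneOn (hMlt δ hδ' x (Or.inl hδ.1))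
      (hMlt δ hδ' y (Or.inl hδ.1))
      (mul_le_mul_of_nonneg_left (rightAverage_mono hΨ hδ.1.le hxy.le) (by linarith [hδ.2]))
  · intro δ hδ
    refine ⟨Real.tan ((1 - δ) * (Real.pi / 2)), fun x => ?_⟩
    have h1 := abs_le.1 (hMb δ hδ x)
    have hIoo : ∀ y, |y| ≤ (1 - δ) * (Real.pi / 2) → y ∈ Ioo (-(Real.pi / 2)) (Real.pi / 2) := by
      intro y hy
      rw [mem_Ioo, ← abs_lt]
      have := hδ.1
      nlinarith
    have hA : |(1 - δ) * (Real.pi / 2)| ≤ (1 - δ) * (Real.pi / 2) :=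
      (abs_of_nonneg (mul_nonneg (by linarith [hδ.2]) (by linarith))).le
    have hT := Real.strictMonoOn_tan.monotoneOn
    simp only [add_sub_cancel_right]
    rw [abs_le, ← Real.tan_neg]
    exact ⟨hT (hIoo _ (by rwa [abs_neg])) (hIoo _ (hMb δ hδ x)) h1.1,
      hT (hIoo _ (hMb δ hδ x)) (hIoo _ hA) h1.2⟩
  · intro δ hδ x h
    have hMc : ContinuousAt (fun p : ℝ × ℝ => M p.1 p.2) (δ, x) :=
      continuousAt_rightAverage hΨ hC (h.imp (fun h => h.ne') (hΨc x))
    have hcos := (Real.cos_pos_of_mem_Ioo (hMlt δ hδ x h)).ne'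
    have h1 : ContinuousAt (fun p : ℝ × ℝ => (1 - p.1) * M p.1 p.2) (δ, x) :=
      ContinuousAt.mul (by fun_prop) hMc
    exact ((Real.continuousAt_tan.2 hcos).comp (f := fun p : ℝ × ℝ => (1 - p.1) * M p.1 p.2)
      h1).add (continuousAt_fst.mul continuousAt_snd)

/-- A family of increasing homeomorphisms of the line, parametrized by `0 < t < 1`, which extends
continuously by prescribed monotone maps on open sets at `t = 0` and at `t = 1`. -/
theorem exists_two_sided_interpolation {D₀ D₁ : Set ℝ} (hD₀ : IsOpen D₀) (hD₁ : IsOpen D₁)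
    {φ₀ φ₁ : ℝ → ℝ} (hc₀ : ContinuousOn φ₀ D₀) (hm₀ : MonotoneOn φ₀ D₀)
    (hc₁ : ContinuousOn φ₁ D₁) (hm₁ : MonotoneOn φ₁ D₁) :
    ∃ F : ℝ → ℝ → ℝ, (∀ x ∈ D₀, F 0 x = φ₀ x) ∧ (∀ x ∈ D₁, F 1 x = φ₁ x) ∧
      (∀ t ∈ Ioo (0 : ℝ) 1, StrictMono (F t) ∧ Function.Surjective (F t)) ∧
      ∀ t x, t ∈ Ioo (0 : ℝ) 1 ∨ (t = 0 ∧ x ∈ D₀) ∨ (t = 1 ∧ x ∈ D₁) →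
        ContinuousAt (fun p : ℝ × ℝ => F p.1 p.2) (t, x) := by
  obtain ⟨f, f1, f2, f3, f4⟩ := exists_interpolation hD₀ hc₀ hm₀
  obtain ⟨g, g1, g2, g3, g4⟩ := exists_interpolation hD₁ hc₁ hm₁
  have hcont : ∀ t x, t ∈ Ioo (0 : ℝ) 1 ∨ (t = 0 ∧ x ∈ D₀) ∨ (t = 1 ∧ x ∈ D₁) →
      ContinuousAt (fun p : ℝ × ℝ => p.1 * g (1 - p.1) p.2 + (1 - p.1) * f p.1 p.2) (t, x) := by
    intro t x h
    have ht : t ∈ Icc (0 : ℝ) 1 := by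
      rcases h with h | ⟨rfl, -⟩ | ⟨rfl, -⟩
      · exact Ioo_subset_Icc_self h
      · simp
      · simp
    have hf := f4 t ht x (by
      rcases h with h | ⟨-, h⟩ | ⟨rfl, -⟩
      · exact Or.inl h.1
      · exact Or.inr h
      · exact Or.inl one_pos)
    have hg := g4 (1 - t) ⟨by linarith [ht.2], by linarith [ht.1]⟩ x (by
      rcases h with h | ⟨rfl, -⟩ | ⟨-, h⟩
      · exact Or.inl (by linarith [h.2])
      · exact Or.inl (by norm_num)
      · exact Or.inr h)
    have hg' : ContinuousAt (fun p : ℝ × ℝ => g (1 - p.1) p.2) (t, x) :=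
      ContinuousAt.comp (f := fun p : ℝ × ℝ => (1 - p.1, p.2)) (x := (t, x)) hg (by fun_prop)
    exact (ContinuousAt.mul (by fun_prop) hg').add (ContinuousAt.mul (by fun_prop) hf)
  refine ⟨fun t x => t * g (1 - t) x + (1 - t) * f t x, ?_, ?_, ?_, hcont⟩
  · intro x hx
    simp [f1 x hx]
  · intro x hx
    simp [g1 x hx]
  · intro t ht
    have ht1 : t ∈ Ioc (0 : ℝ) 1 := ⟨ht.1, ht.2.le⟩
    have ht2 : 1 - t ∈ Ioc (0 : ℝ) 1 := ⟨by linarith [ht.2], by linarith [ht.1]⟩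
    have hp : 0 < 1 - t := ht2.1
    have hp' : 0 < t := ht.1
    refine ⟨fun x y hxy => add_lt_add (mul_lt_mul_of_pos_left (g2 _ ht2 hxy) hp')
      (mul_lt_mul_of_pos_left (f2 _ ht1 hxy) hp), ?_⟩
    obtain ⟨C₁, h1⟩ := f3 t ht1
    obtain ⟨C₂, h2⟩ := g3 _ ht2
    have hcx : Continuous fun x => t * g (1 - t) x + (1 - t) * f t x := by
      rw [continuous_iff_continuousAt]
      intro x
      exact ContinuousAt.comp (f := fun x : ℝ => (t, x)) (x := x) (hcont t x (Or.inl ht))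
        (by fun_prop)
    have hcp : 0 < 2 * (t * (1 - t)) := by positivity
    refine hcx.surjective ?_ ?_
    · refine tendsto_atTop_mono (f := fun x => 2 * (t * (1 - t)) * x - (t * C₂ + (1 - t) * C₁)) ?_
        (tendsto_atTop_add_const_right _ _ (tendsto_id.const_mul_atTop hcp))
      intro x
      have a1 := (abs_le.1 (h1 x)).1
      have a2 := (abs_le.1 (h2 x)).1
      nlinarith
    · refine tendsto_atBot_mono (f := fun x => 2 * (t * (1 - t)) * x + (t * C₂ + (1 - t) * C₁)) ?_
        (tendsto_atBot_add_const_right _ _ (tendsto_id.const_mul_atBot hcp))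
      intro x
      have a1 := (abs_le.1 (h1 x)).2
      have a2 := (abs_le.1 (h2 x)).2
      nlinarith

/-! ### Disjoint unions of strips -/

section Family

variable {Λ : Type v} {S : Λ → Strip}

/-- The disjoint union of a family of strips. -/
abbrev Total (S : Λ → Strip) : Type v := Σ l, (S l).carrier

namespace Total

/-- The first coordinate of a point of a strip. -/
def x (p : Total S) : ℝ := p.2.1.1

/-- The height of a point of a strip. -/
def y (p : Total S) : ℝ := p.2.1.2

theorem ext_iff' {p p' : Total S} : p = p' ↔ p.1 = p'.1 ∧ p.x = p'.x ∧ p.y = p'.y := by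
  constructor
  · rintro rfl; exact ⟨rfl, rfl, rfl⟩
  · obtain ⟨l, ⟨⟨a, b⟩, h⟩⟩ := p
    obtain ⟨l', ⟨⟨a', b'⟩, h'⟩⟩ := p'
    rintro ⟨h1, h2, h3⟩
    simp only [x, y] at h1 h2 h3
    subst h1 h2 h3
    rfl

theorem continuous_x : Continuous (x : Total S → ℝ) :=
  continuous_sigma fun _ => continuous_fst.comp continuous_subtype_val

theorem continuous_y : Continuous (y : Total S → ℝ) :=
  continuous_sigma fun _ => continuous_snd.comp continuous_subtype_val

theorem eventually_vertex_eq (p : Total S) : ∀ᶠ p' in 𝓝 p, p'.1 = p.1 := by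
  rw [Sigma.nhds_eq, eventually_map]
  exact Eventually.of_forall fun _ => rfl

/-- A map into a disjoint union of strips is continuous at a point as soon as it does not leave the
strip and both coordinates are continuous. -/
theorem tendsto_nhds_iff {α : Type*} {f : α → Total S} {F : Filter α} {p : Total S} :
    Tendsto f F (𝓝 p) ↔ (∀ᶠ a in F, (f a).1 = p.1) ∧ Tendsto (fun a => (f a).x) F (𝓝 p.x) ∧
      Tendsto (fun a => (f a).y) F (𝓝 p.y) := by
  constructor
  · intro h
    exact ⟨h.eventually p.eventually_vertex_eq, (continuous_x.tendsto p).comp h,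
      (continuous_y.tendsto p).comp h⟩
  · rintro ⟨h1, h2, h3⟩
    intro U hU
    rw [Sigma.nhds_eq, mem_map, nhds_subtype_eq_comap, mem_comap] at hU
    obtain ⟨V, hV, hVU⟩ := hU
    have h4 : ∀ᶠ a in F, ((f a).x, (f a).y) ∈ V := (h2.prodMk_nhds h3) hV
    change ∀ᶠ a in F, f a ∈ U
    filter_upwards [h1, h4] with a ha1 ha2
    rcases hfa : f a with ⟨l, w⟩
    rw [hfa] at ha1 ha2
    dsimp only at ha1
    subst ha1
    exact hVU (show w ∈ Subtype.val ⁻¹' V from ha2)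

theorem mem_Icc (p : Total S) : p.y ∈ Icc (S p.1).lo (S p.1).hi :=
  ((S p.1).subset_closed p.2.2).2

instance : T3Space (Total S) :=
  letI := Metric.Sigma.metricSpace (E := fun l => (S l).carrier)
  inferInstance

instance : LocallyCompactSpace (Total S) := by
  have h1 : ∀ l, LocallyCompactSpace (S l).carrier := fun l => by
    obtain ⟨O, hO, h⟩ := (S l).relOpen
    refine IsLocallyClosed.locallyCompactSpace ?_
    rw [h]
    exact hO.isLocallyClosed.inter (isClosed_univ.prod isClosed_Icc).isLocallyClosed
  have : WeaklyLocallyCompactSpace (Total S) := ⟨fun p => by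
    obtain ⟨K, hK, hp⟩ := exists_compact_mem_nhds p.2
    refine ⟨Sigma.mk p.1 '' K, hK.image continuous_sigmaMk, ?_⟩
    rw [Sigma.nhds_eq]
    exact image_mem_map hp⟩
  infer_instance

/-- The points of the strips off their sides. -/
def interior (S : Λ → Strip) : Set (Total S) := {p | p.y ∈ Ioo (S p.1).lo (S p.1).hi}

/-- The point with given coordinates in the interior of a strip. -/
def mkInt (l : Λ) (a t : ℝ) (ht : t ∈ Ioo (S l).lo (S l).hi) : Total S :=
  ⟨l, (a, t), (S l).interior_subset ⟨mem_univ _, ht⟩⟩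

theorem mkInt_mem (l : Λ) (a t : ℝ) (ht : t ∈ Ioo (S l).lo (S l).hi) :
    mkInt l a t ht ∈ interior S := ht

theorem isOpen_interior : IsOpen (interior S) := by
  rw [isOpen_sigma_iff]
  intro l
  have h : Continuous fun w : (S l).carrier => w.1.2 :=
    continuous_snd.comp continuous_subtype_val
  exact (isOpen_Ioo (a := (S l).lo) (b := (S l).hi)).preimage h

/-- Neighbourhoods of a point of a strip contain neighbourhoods which are connected and have a
connected and nonempty trace on the interior of the strips. -/
theorem exists_connected_nhds (p : Total S) {U : Set (Total S)} (hU : U ∈ 𝓝 p) :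
    ∃ D ∈ 𝓝 p, D ⊆ U ∧ IsPreconnected D ∧ IsPreconnected (D ∩ interior S) ∧
      (D ∩ interior S).Nonempty := by
  obtain ⟨l, w⟩ := p
  rw [Sigma.nhds_eq, mem_map, nhds_subtype_eq_comap, mem_comap] at hU
  obtain ⟨V, hV, hVU⟩ := hU
  obtain ⟨O, hO, hSO⟩ := (S l).relOpen
  have hwO : w.1 ∈ O := (hSO.subset w.2).1
  obtain ⟨r, hr, hball⟩ := Metric.mem_nhds_iff.1 (inter_mem hV (hO.mem_nhds hwO))
  set B := Metric.ball w.1 r with hB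
  have hwy := ((S l).subset_closed w.2).2
  have hlt := (S l).lo_lt_hi
  have hBS : B ∩ (univ : Set ℝ) ×ˢ Icc (S l).lo (S l).hi ⊆ (S l).carrier := fun z hz => by
    rw [hSO]; exact ⟨(hball hz.1).2, hz.2⟩
  set D : Set (Total S) := {p | p.1 = l ∧ (p.x, p.y) ∈ B} with hD
  have conv : ∀ J : Set ℝ, Convex ℝ J → J ⊆ Icc (S l).lo (S l).hi →
      IsPreconnected (D ∩ {p : Total S | p.1 = l ∧ p.y ∈ J}) := by
    intro J hJ hJI
    have hc : Convex ℝ (B ∩ (univ : Set ℝ) ×ˢ J) :=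
      (convex_ball _ _).inter (convex_univ.prod hJ)
    have hsub : B ∩ (univ : Set ℝ) ×ˢ J ⊆ (S l).carrier := fun z hz =>
      hBS ⟨hz.1, hz.2.1, hJI hz.2.2⟩
    have h1 : IsPreconnected (B ∩ (univ : Set ℝ) ×ˢ J) := hc.isPreconnected
    have h2 : IsPreconnected ((Subtype.val : (S l).carrier → ℝ × ℝ) ⁻¹'
        (B ∩ (univ : Set ℝ) ×ˢ J)) := by
      rw [← IsInducing.subtypeVal.isPreconnected_image, Subtype.image_preimage_coe,
        inter_eq_right.2 hsub]
      exact h1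
    convert h2.image (Sigma.mk l : _ → Total S) continuous_sigmaMk.continuousOn using 1
    ext p
    constructor
    · obtain ⟨l', w'⟩ := p
      rintro ⟨⟨h1, h2⟩, -, h3⟩
      dsimp only at h1
      subst h1
      exact ⟨w', ⟨h2, mem_univ _, h3⟩, rfl⟩
    · rintro ⟨w', h, rfl⟩
      exact ⟨⟨rfl, h.1⟩, rfl, h.2.2⟩
  have hDint : D ∩ interior S = D ∩ {p : Total S | p.1 = l ∧ p.y ∈ Ioo (S l).lo (S l).hi} := by
    ext p
    constructor
    · rintro ⟨h1, h2⟩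
      obtain ⟨l', w'⟩ := p
      obtain ⟨h3, h4⟩ := h1
      dsimp only at h3
      subst h3
      exact ⟨⟨rfl, h4⟩, rfl, h2⟩
    · rintro ⟨h1, h2⟩
      obtain ⟨l', w'⟩ := p
      obtain ⟨h3, h4⟩ := h1
      dsimp only at h3
      subst h3
      exact ⟨⟨rfl, h4⟩, h2.2⟩
  refine ⟨D, ?_, ?_, ?_, ?_, ?_⟩
  · rw [Sigma.nhds_eq, mem_map, nhds_subtype_eq_comap]
    exact mem_comap.2 ⟨B, Metric.ball_mem_nhds _ hr, fun z hz => ⟨rfl, hz⟩⟩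
  · rintro ⟨l', w'⟩ ⟨h1, h2⟩
    dsimp only at h1
    subst h1
    exact hVU (show w' ∈ Subtype.val ⁻¹' V from (hball h2).1)
  · convert conv (Icc (S l).lo (S l).hi) (convex_Icc _ _) le_rfl using 1
    refine (inter_eq_left.2 ?_).symm
    rintro ⟨l', w'⟩ ⟨h1, h2⟩
    dsimp only at h1
    subst h1
    exact ⟨rfl, ((S _).subset_closed w'.2).2⟩
  · rw [hDint]
    exact conv _ (convex_Ioo _ _) Ioo_subset_Icc_self
  · rw [hDint]
    -- a height in the strip close to that of the centre
    obtain ⟨t, ht1, ht2⟩ : ∃ t ∈ Ioo (S l).lo (S l).hi, |t - w.1.2| < r := by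
      rcases lt_or_ge w.1.2 (S l).hi with h | h
      · refine ⟨min (w.1.2 + r / 2) ((w.1.2 + (S l).hi) / 2), ⟨lt_min ?_ ?_, ?_⟩, ?_⟩
        · linarith [hwy.1]
        · linarith [hwy.1]
        · exact (min_le_right _ _).trans_lt (by linarith)
        · rw [abs_lt]
          constructor
          · have : w.1.2 ≤ min (w.1.2 + r / 2) ((w.1.2 + (S l).hi) / 2) :=
              le_min (by linarith) (by linarith)
            linarith
          · linarith [min_le_left (w.1.2 + r / 2) ((w.1.2 + (S l).hi) / 2)]
      · refine ⟨max (w.1.2 - r / 2) ((w.1.2 + (S l).lo) / 2), ⟨?_, max_lt ?_ ?_⟩, ?_⟩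
        · exact lt_of_lt_of_le (by linarith) (le_max_right _ _)
        · linarith [hwy.2]
        · linarith [hwy.2]
        · rw [abs_lt]
          constructor
          · linarith [le_max_left (w.1.2 - r / 2) ((w.1.2 + (S l).lo) / 2)]
          · have : max (w.1.2 - r / 2) ((w.1.2 + (S l).lo) / 2) ≤ w.1.2 :=
              max_le (by linarith) (by linarith)
            linarith
    refine ⟨mkInt l w.1.1 t ht1, ⟨rfl, ?_⟩, rfl, ht1⟩
    change (w.1.1, t) ∈ Metric.ball w.1 r
    rw [Metric.mem_ball, Prod.dist_eq, max_lt_iff, Real.dist_eq, Real.dist_eq]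
    exact ⟨by simpa using hr, ht2⟩

theorem dense_interior : Dense (interior S) := fun p => by
  rw [mem_closure_iff_nhds]
  intro U hU
  obtain ⟨D, -, hDU, -, -, hD⟩ := exists_connected_nhds p hU
  exact hD.mono (inter_subset_inter_left _ hDU)

end Total

/-! ### Boundary intervals and their affine parametrizations -/

namespace HalfEdge

theorem mem_toSet {e : HalfEdge S} {p : Total S} :
    p ∈ e.toSet ↔ p.1 = e.vertex ∧ p.y = (S e.vertex).level e.side ∧ p.x ∈ e.interval := by
  constructor
  · rintro ⟨x, rfl⟩
    exact ⟨rfl, rfl, x.2⟩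
  · rintro ⟨h1, h2, h3⟩
    exact ⟨⟨p.x, h3⟩, Total.ext_iff'.2 ⟨h1.symm, rfl, h2.symm⟩⟩

theorem level_injective (T : Strip) {s s' : ℤˣ} (h : T.level s = T.level s') : s = s' := by
  have := T.lo_lt_hi
  rcases Int.units_eq_one_or s with rfl | rfl <;> rcases Int.units_eq_one_or s' with rfl | rfl <;>
    simp [Strip.level] at h ⊢ <;> linarith

/-- A point lies on at most one boundary interval. -/
theorem eq_of_mem_toSet {e f : HalfEdge S} {p : Total S} (he : p ∈ e.toSet) (hf : p ∈ f.toSet) :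
    e = f := by
  rw [mem_toSet] at he hf
  by_contra hne
  have hv : e.vertex = f.vertex := he.1.symm.trans hf.1
  have hs : e.side = f.side := level_injective _ (by
    rw [← he.2.1, hf.2.1, hv])
  exact Set.disjoint_left.1 (disjoint_of_ne hv hs hne) he.2.2 hf.2.2

theorem level_notMem_Ioo (T : Strip) (s : ℤˣ) : T.level s ∉ Ioo T.lo T.hi := by
  rcases Int.units_eq_one_or s with rfl | rfl <;> simp [Strip.level]

theorem notMem_interior {e : HalfEdge S} {p : Total S} (he : p ∈ e.toSet) :
    p ∉ Total.interior S := by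
  rw [mem_toSet] at he
  intro h
  have h' : p.y ∈ Ioo (S p.1).lo (S p.1).hi := h
  rw [he.2.1, he.1] at h'
  exact level_notMem_Ioo _ _ h'

theorem exists_mem_toSet {p : Total S} (hp : p ∉ Total.interior S) :
    ∃ e : HalfEdge S, p ∈ e.toSet := by
  have h := p.mem_Icc
  obtain ⟨s, hs⟩ : ∃ s, p.y = (S p.1).level s := by
    by_cases h1 : p.y = (S p.1).hi
    · exact ⟨1, by simpa [Strip.level] using h1⟩
    · refine ⟨-1, ?_⟩
      have h2 : p.y = (S p.1).lo := by
        by_contra h2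
        exact hp ⟨lt_of_le_of_ne h.1 (Ne.symm h2), lt_of_le_of_ne h.2 h1⟩
      simpa [Strip.level] using h2
  have hx : p.x ∈ (S p.1).sideSet s := by
    change (p.x, (S p.1).level s) ∈ (S p.1).carrier
    rw [← hs]
    exact p.2.2
  exact ⟨⟨p.1, s, _, p.x, hx, rfl⟩, mem_toSet.2 ⟨rfl, hs, mem_connectedComponentIn hx⟩⟩

theorem _root_.Striped.Strip.isOpen_sideSet (T : Strip) (s : ℤˣ) : IsOpen (T.sideSet s) := by
  obtain ⟨O, hO, h⟩ := T.relOpen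
  have : T.sideSet s = (fun x => (x, T.level s)) ⁻¹' O := by
    ext x
    simp only [Strip.sideSet, mem_ofPred_eq, mem_preimage, h]
    refine and_iff_left ⟨mem_univ _, ?_⟩
    have := T.lo_lt_hi.le
    rcases Int.units_eq_one_or s with rfl | rfl <;> simpa [Strip.level]
  rw [this]
  exact hO.preimage (by fun_prop)

theorem isOpen_interval (e : HalfEdge S) : IsOpen e.interval := by
  obtain ⟨y, hy, hI⟩ := e.isInterval
  rw [hI]
  exact ((S e.vertex).isOpen_sideSet e.side).connectedComponentIn

theorem interval_subset_sideSet (e : HalfEdge S) : e.interval ⊆ (S e.vertex).sideSet e.side := by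
  obtain ⟨y, hy, hI⟩ := e.isInterval
  rw [hI]
  exact connectedComponentIn_subset _ _

/-- The left end of a boundary interval. -/
def left (e : HalfEdge S) : ℝ := sInf e.interval

/-- The right end of a boundary interval. -/
def right (e : HalfEdge S) : ℝ := sSup e.interval

theorem interval_eq_of_isBounded (e : HalfEdge S) (he : Bornology.IsBounded e.interval) :
    e.interval = Ioo e.left e.right := by
  have hb := isBounded_iff_bddBelow_bddAbove.1 he
  refine Subset.antisymm (fun x hx => ?_) ?_
  · obtain ⟨l, u, hxm, hsub⟩ := mem_nhds_iff_exists_Ioo_subset.1 (e.isOpen_interval.mem_nhds hx)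
    obtain ⟨a, ha⟩ := exists_between hxm.1
    obtain ⟨b, hb'⟩ := exists_between hxm.2
    exact ⟨(csInf_le hb.1 (hsub ⟨ha.1, ha.2.trans hxm.2⟩)).trans_lt ha.2,
      hb'.1.trans_le (le_csSup hb.2 (hsub ⟨hxm.1.trans hb'.1, hb'.2⟩))⟩
  · rintro x ⟨h1, h2⟩
    obtain ⟨a, ha, hax⟩ := exists_lt_of_csInf_lt e.nonempty h1
    obtain ⟨b, hb, hxb⟩ := exists_lt_of_lt_csSup e.nonempty h2
    exact e.ordConnected.out ha hb ⟨hax.le, hxb.le⟩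

/-- The open interval that parametrizes all boundary intervals of model strips. -/
abbrev UnitIoo : Type := Ioo (0 : ℝ) 1

variable (hS : ∀ l, (S l).IsModel) (e : HalfEdge S)

include hS in
theorem interval_eq : e.interval = Ioo e.left e.right :=
  e.interval_eq_of_isBounded ((hS e.vertex).1 _ _ e.isInterval)

include hS in
theorem left_lt_right : e.left < e.right := by
  obtain ⟨x, hx⟩ := e.nonempty
  rw [e.interval_eq hS] at hx
  exact hx.1.trans hx.2

/-- The affine parametrization of a boundary interval of a model strip by the unit interval. -/
def pt (u : UnitIoo) : Total S :=
  e.point ⟨e.left + (e.right - e.left) * u, by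
    rw [e.interval_eq hS]
    have := e.left_lt_right hS
    have h1 := u.2.1
    have h2 := u.2.2
    constructor <;> nlinarith⟩

theorem pt_mem (u : UnitIoo) : e.pt hS u ∈ e.toSet := mem_range_self _

@[simp] theorem pt_fst (u : UnitIoo) : (e.pt hS u).1 = e.vertex := rfl

@[simp] theorem pt_y (u : UnitIoo) : (e.pt hS u).y = (S e.vertex).level e.side := rfl

@[simp] theorem pt_x (u : UnitIoo) : (e.pt hS u).x = e.left + (e.right - e.left) * u := rfl

theorem pt_injective : Function.Injective (e.pt hS) := fun u v h => by
  have h1 := congrArg Total.x h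
  simp only [pt_x, add_right_inj] at h1
  exact Subtype.ext (mul_left_cancel₀ (sub_pos.2 (e.left_lt_right hS)).ne' h1)

theorem exists_pt_eq {p : Total S} (hp : p ∈ e.toSet) : ∃ u, e.pt hS u = p := by
  rw [mem_toSet, e.interval_eq hS] at hp
  obtain ⟨h1, h2, h3⟩ := hp
  have hlt := sub_pos.2 (e.left_lt_right hS)
  refine ⟨⟨(p.x - e.left) / (e.right - e.left), div_pos (sub_pos.2 h3.1) hlt,
    (div_lt_one hlt).2 (by linarith [h3.2])⟩, Total.ext_iff'.2 ⟨h1.symm, ?_, h2.symm⟩⟩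
  rw [pt_x, mul_div_cancel₀ _ hlt.ne']
  ring

theorem continuous_pt : Continuous (e.pt hS) := by
  refine continuous_sigmaMk.comp (Continuous.subtype_mk ?_ _)
  fun_prop

/-- Near a boundary point, a strip consists of interior points and points of the same boundary
interval with nearby parameter. -/
theorem eventually_pt (u : UnitIoo) {V : Set UnitIoo} (hV : V ∈ 𝓝 u) :
    ∀ᶠ p in 𝓝 (e.pt hS u), p ∈ Total.interior S ∨ ∃ v ∈ V, p = e.pt hS v := by
  rw [nhds_subtype_eq_comap, mem_comap] at hV
  obtain ⟨V', hV', hVV⟩ := hV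
  have hlt := sub_pos.2 (e.left_lt_right hS)
  have hx : (e.pt hS u).x ∈ e.interval := (mem_toSet.1 (e.pt_mem hS u)).2.2
  have h1 : ∀ᶠ p in 𝓝 (e.pt hS u), p.x ∈ e.interval :=
    (Total.continuous_x.tendsto _).eventually (e.isOpen_interval.mem_nhds hx)
  have hc : Continuous fun p : Total S => (p.x - e.left) / (e.right - e.left) :=
    (Total.continuous_x.sub continuous_const).div_const _
  have h2 : ∀ᶠ p in 𝓝 (e.pt hS u), (p.x - e.left) / (e.right - e.left) ∈ V' := by
    refine (hc.tendsto _).eventually ?_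
    rwa [pt_x, add_sub_cancel_left, mul_div_cancel_left₀ _ hlt.ne']
  have hne : (e.pt hS u).y ≠ (S e.vertex).level (-e.side) := fun h => by
    have := level_injective _ h
    rcases Int.units_eq_one_or e.side with h | h <;> rw [h] at this <;> revert this <;> decide
  have h3 : ∀ᶠ p in 𝓝 (e.pt hS u), p.y ≠ (S e.vertex).level (-e.side) :=
    (Total.continuous_y.tendsto _).eventually (isOpen_ne.mem_nhds hne)
  filter_upwards [h1, h2, h3, Total.eventually_vertex_eq _] with p p1 p2 p3 p4
  by_cases hp : p ∈ Total.interior S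
  · exact Or.inl hp
  · right
    have hpe : p ∈ e.toSet := by
      obtain ⟨f, hf⟩ := exists_mem_toSet hp
      rw [mem_toSet] at hf
      refine mem_toSet.2 ⟨p4, ?_, p1⟩
      have hfe : f.vertex = e.vertex := hf.1.symm.trans p4
      rw [hfe] at hf
      have : f.side = e.side := by
        by_contra hs
        exact p3 (hf.2.1.trans (by rw [Int.units_ne_iff_eq_neg.1 hs]))
      rw [hf.2.1, this]
    obtain ⟨v, rfl⟩ := e.exists_pt_eq hS hpe
    refine ⟨v, hVV ?_, rfl⟩
    rwa [pt_x, add_sub_cancel_left, mul_div_cancel_left₀ _ hlt.ne'] at p2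

include hS in
theorem isOpen_interior_union : IsOpen (Total.interior S ∪ e.toSet) := by
  rw [isOpen_iff_mem_nhds]
  rintro p (hp | hp)
  · exact mem_of_superset (Total.isOpen_interior.mem_nhds hp) subset_union_left
  · obtain ⟨u, rfl⟩ := e.exists_pt_eq hS hp
    filter_upwards [e.eventually_pt hS u univ_mem] with p' hp'
    rcases hp' with h | ⟨v, -, rfl⟩
    · exact Or.inl h
    · exact Or.inr (e.pt_mem hS v)

end HalfEdge

end Family

/-! ### The fibres of an affine atlas -/

/-- The two affine homeomorphisms of the unit interval, as an action of the signs. -/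
def flip (ε : ℤˣ) (u : HalfEdge.UnitIoo) : HalfEdge.UnitIoo :=
  if ε = 1 then u else ⟨1 - u, by linarith [u.2.2], by linarith [u.2.1]⟩

@[simp] theorem flip_one (u : HalfEdge.UnitIoo) : flip 1 u = u := rfl

theorem flip_neg_one (u : HalfEdge.UnitIoo) : ((flip (-1) u : HalfEdge.UnitIoo) : ℝ) = 1 - u := rfl

theorem flip_flip (ε ε' : ℤˣ) (u : HalfEdge.UnitIoo) : flip ε (flip ε' u) = flip (ε * ε') u := by
  rcases Int.units_eq_one_or ε with rfl | rfl <;> rcases Int.units_eq_one_or ε' with rfl | rfl <;>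
    apply Subtype.ext <;> simp [flip_neg_one]

theorem flip_self (ε : ℤˣ) (u : HalfEdge.UnitIoo) : flip ε (flip ε u) = u := by
  rw [flip_flip, Int.units_mul_self, flip_one]

theorem continuous_flip (ε : ℤˣ) : Continuous (flip ε) := by
  rcases Int.units_eq_one_or ε with rfl | rfl
  · exact continuous_id
  · exact (continuous_const.sub continuous_subtype_val).subtype_mk _

theorem flip_injective (ε : ℤˣ) : Function.Injective (flip ε) :=
  Function.LeftInverse.injective (flip_self ε)

/-- The flips are the affine maps of slope `±1` that fix the midpoint. -/
theorem coe_flip (ε : ℤˣ) (u : HalfEdge.UnitIoo) :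
    ((flip ε u : HalfEdge.UnitIoo) : ℝ) = 1 / 2 + ((ε : ℤ) : ℝ) * (u - 1 / 2) := by
  rcases Int.units_eq_one_or ε with rfl | rfl
  · simp
  · rw [flip_neg_one]; push_cast; ring

namespace StripedAtlas

variable {Z : Type u} [TopologicalSpace Z] (A : StripedAtlas.{u, v, w} Z)

theorem ξ_ne_self_iff {e : HalfEdge A.S} : A.ξ e ≠ e ↔ ∃ γ, e = A.X γ ∨ e = A.Y γ := by
  constructor
  · intro h
    by_contra hne
    push Not at hne
    exact h (A.ξ_eq_self (fun ⟨γ, hγ⟩ => (hne γ).1 hγ.symm) fun ⟨γ, hγ⟩ => (hne γ).2 hγ.symm)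
  · rintro ⟨γ, rfl | rfl⟩
    · rw [A.ξ_X]; exact (A.X_ne_Y γ γ).symm
    · rw [A.ξ_Y]; exact A.X_ne_Y γ γ

variable {A} (hA : A.IsAffine)
include hA

theorem exists_glue (γ : A.Γ) : ∃ ε, ∀ u v,
    A.q ((A.X γ).pt hA.1 u) = A.q ((A.Y γ).pt hA.1 v) ↔ u = flip ε v := by
  obtain ⟨a, b, c, d, hab, hcd, hX, hY, h⟩ := hA.2 γ
  have hXl : (A.X γ).left = a := by rw [HalfEdge.left, hX, csInf_Ioo hab]
  have hXr : (A.X γ).right = b := by rw [HalfEdge.right, hX, csSup_Ioo hab]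
  have hYl : (A.Y γ).left = c := by rw [HalfEdge.left, hY, csInf_Ioo hcd]
  have hYr : (A.Y γ).right = d := by rw [HalfEdge.right, hY, csSup_Ioo hcd]
  have hex : ∀ v, ∃ u, A.q ((A.X γ).pt hA.1 u) = A.q ((A.Y γ).pt hA.1 v) := by
    intro v
    have : A.q ((A.Y γ).pt hA.1 v) ∈ A.q '' (A.X γ).toSet := by
      rw [A.image_eq]
      exact mem_image_of_mem _ (HalfEdge.pt_mem _ _ _)
    obtain ⟨p, hp, hpq⟩ := this
    obtain ⟨u, rfl⟩ := HalfEdge.exists_pt_eq hA.1 _ hp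
    exact ⟨u, hpq⟩
  have hdc : d - c ≠ 0 := (sub_pos.2 hcd).ne'
  have hba : b - a ≠ 0 := (sub_pos.2 hab).ne'
  have main : ∃ ε, ∀ u v,
      A.q ((A.X γ).pt hA.1 u) = A.q ((A.Y γ).pt hA.1 v) → u = flip ε v := by
    rcases h with h | h
    · refine ⟨1, fun u v huv => ?_⟩
      have := h _ _ huv
      simp only [hXl, hXr, hYl, hYr] at this
      apply Subtype.ext
      have h2 : (b - a) * (u : ℝ) = (b - a) * v := by
        refine mul_right_cancel₀ hdc ?_
        field_simp at this
        linarith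
      simpa using mul_left_cancel₀ hba h2
    · refine ⟨-1, fun u v huv => ?_⟩
      have := h _ _ huv
      simp only [hXl, hXr, hYl, hYr] at this
      apply Subtype.ext
      rw [flip_neg_one]
      have h2 : (b - a) * (u : ℝ) = (b - a) * (1 - v) := by
        refine mul_right_cancel₀ hdc ?_
        field_simp at this
        linarith
      exact mul_left_cancel₀ hba h2
  obtain ⟨ε, hε⟩ := main
  refine ⟨ε, fun u v => ⟨hε u v, fun h => ?_⟩⟩
  obtain ⟨u', hu'⟩ := hex v
  rw [h, ← hε u' v hu', hu']

theorem glue_X (γ : A.Γ) (u v : HalfEdge.UnitIoo) :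
    A.q ((A.X γ).pt hA.1 u) = A.q ((A.Y γ).pt hA.1 v) ↔ v = flip (A.σ (A.X γ)) u := by
  obtain ⟨ε, hε⟩ := exists_glue hA γ
  have hσ : A.σ (A.X γ) = ε := by
    have key : A.PreservesOrientation (A.X γ) ↔ ε = 1 := by
      unfold PreservesOrientation
      rw [A.ξ_X]
      constructor
      · intro h
        by_contra hne
        have hε1 : ε = -1 := (Int.units_eq_one_or ε).resolve_left hne
        subst hε1
        have hlt := sub_pos.2 ((A.X γ).left_lt_right hA.1)
        have hlt' := sub_pos.2 ((A.Y γ).left_lt_right hA.1)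
        have hq : ∀ u, A.q ((A.X γ).pt hA.1 u) = A.q ((A.Y γ).pt hA.1 (flip (-1) u)) := fun u =>
          (hε _ _).2 (flip_self _ u).symm
        have := h _ _ _ _ (hq ⟨1 / 3, by norm_num, by norm_num⟩)
          (hq ⟨2 / 3, by norm_num, by norm_num⟩) (by
            rw [Subtype.mk_lt_mk]; dsimp only; nlinarith)
        rw [Subtype.mk_lt_mk, flip_neg_one, flip_neg_one] at this
        dsimp only at this
        nlinarith
      · rintro rfl s t s' t' hs ht hst
        obtain ⟨u, hu⟩ := HalfEdge.exists_pt_eq hA.1 (A.X γ) (p := (A.X γ).point s) ⟨s, rfl⟩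
        obtain ⟨v, hv⟩ := HalfEdge.exists_pt_eq hA.1 (A.X γ) (p := (A.X γ).point t) ⟨t, rfl⟩
        obtain ⟨u', hu'⟩ := HalfEdge.exists_pt_eq hA.1 (A.Y γ) (p := (A.Y γ).point s') ⟨s', rfl⟩
        obtain ⟨v', hv'⟩ := HalfEdge.exists_pt_eq hA.1 (A.Y γ) (p := (A.Y γ).point t') ⟨t', rfl⟩
        rw [← hu, ← hu', hε, flip_one] at hs
        rw [← hv, ← hv', hε, flip_one] at ht
        subst hs ht
        have e1 : _ = (s : ℝ) := congrArg Total.x hu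
        have e2 : _ = (t : ℝ) := congrArg Total.x hv
        have e3 : _ = (s' : ℝ) := congrArg Total.x hu'
        have e4 : _ = (t' : ℝ) := congrArg Total.x hv'
        rw [HalfEdge.pt_x] at e1 e2 e3 e4
        rw [← Subtype.coe_lt_coe] at hst ⊢
        rw [← e1, ← e2, add_lt_add_iff_left,
          mul_lt_mul_iff_right₀ (sub_pos.2 ((A.X γ).left_lt_right hA.1))] at hst
        rw [← e3, ← e4, add_lt_add_iff_left,
          mul_lt_mul_iff_right₀ (sub_pos.2 ((A.Y γ).left_lt_right hA.1))]
        exact hst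
    by_cases h : A.PreservesOrientation (A.X γ)
    · rw [σ, if_pos h, key.1 h]
    · rw [σ, if_neg h]
      exact ((Int.units_eq_one_or ε).resolve_left fun h' => h (key.2 h')).symm
  rw [hε, hσ]
  constructor
  · rintro rfl; exact (flip_self _ _).symm
  · rintro rfl; exact (flip_self _ _).symm

/-- In the affine parametrizations, the gluing of two boundary intervals is one of the two flips. -/
theorem glue_iff {e : HalfEdge A.S} (he : A.ξ e ≠ e) (u v : HalfEdge.UnitIoo) :
    A.q (e.pt hA.1 u) = A.q ((A.ξ e).pt hA.1 v) ↔ v = flip (A.σ e) u := by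
  obtain ⟨γ, rfl | rfl⟩ := A.ξ_ne_self_iff.1 he
  · rw [A.ξ_X]; exact glue_X hA γ u v
  · have h := A.σ_ξ (A.Y γ)
    rw [A.ξ_Y] at h
    rw [A.ξ_Y, eq_comm, glue_X hA γ v u, h]
    constructor
    · rintro rfl; exact (flip_self _ _).symm
    · rintro rfl; exact (flip_self _ _).symm

/-- The only identifications are those of points of glued boundary intervals. -/
theorem q_eq_iff {p p' : Total A.S} : A.q p = A.q p' ↔ p = p' ∨
    ∃ (e : HalfEdge A.S) (u : HalfEdge.UnitIoo), A.ξ e ≠ e ∧ p = e.pt hA.1 u ∧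
      p' = (A.ξ e).pt hA.1 (flip (A.σ e) u) := by
  constructor
  · intro h
    by_cases hp : p ∈ ⋃ γ, (A.X γ).toSet ∪ (A.Y γ).toSet
    · obtain ⟨γ, hγ⟩ := mem_iUnion.1 hp
      have h1 : p ∈ A.q ⁻¹' (A.q '' (A.X γ).toSet) := by rwa [A.preimage_eq]
      have h2 : p' ∈ (A.X γ).toSet ∪ (A.Y γ).toSet := by
        rw [← A.preimage_eq, mem_preimage, ← h]; exact h1
      have mk : ∀ e : HalfEdge A.S, A.ξ e ≠ e → p ∈ e.toSet → p' ∈ (A.ξ e).toSet →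
          ∃ (e : HalfEdge A.S) (u : HalfEdge.UnitIoo), A.ξ e ≠ e ∧ p = e.pt hA.1 u ∧
            p' = (A.ξ e).pt hA.1 (flip (A.σ e) u) := by
        intro e he hp hp'
        obtain ⟨u, rfl⟩ := e.exists_pt_eq hA.1 hp
        obtain ⟨v, rfl⟩ := (A.ξ e).exists_pt_eq hA.1 hp'
        exact ⟨e, u, he, rfl, by rw [(glue_iff hA he u v).1 h]⟩
      rcases hγ with h3 | h3 <;> rcases h2 with h4 | h4
      · exact Or.inl (congrArg Subtype.val
          ((A.embedding_X γ).1.injective (a₁ := ⟨p, h3⟩) (a₂ := ⟨p', h4⟩) h))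
      · exact Or.inr (mk _ (A.ξ_ne_self_iff.2 ⟨γ, Or.inl rfl⟩) h3 (by rwa [A.ξ_X]))
      · exact Or.inr (mk _ (A.ξ_ne_self_iff.2 ⟨γ, Or.inr rfl⟩) h3 (by rwa [A.ξ_Y]))
      · exact Or.inl (congrArg Subtype.val
          ((A.embedding_Y γ).1.injective (a₁ := ⟨p, h3⟩) (a₂ := ⟨p', h4⟩) h))
    · refine Or.inl (A.injOn hp (fun hp' => hp ?_) h)
      obtain ⟨γ, hγ⟩ := mem_iUnion.1 hp'
      refine mem_iUnion.2 ⟨γ, ?_⟩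
      rw [← A.preimage_eq, mem_preimage] at hγ ⊢
      rwa [h]
  · rintro (rfl | ⟨e, u, he, rfl, rfl⟩)
    · rfl
    · exact (glue_iff hA he _ _).2 rfl

theorem q_eq_iff_of_mem_interior {p p' : Total A.S} (hp : p ∈ Total.interior A.S) :
    A.q p = A.q p' ↔ p = p' := by
  rw [q_eq_iff hA]
  refine or_iff_left ?_
  rintro ⟨e, u, -, rfl, -⟩
  exact HalfEdge.notMem_interior (e.pt_mem hA.1 u) hp

theorem q_pt_eq_iff {e : HalfEdge A.S} {u : HalfEdge.UnitIoo} {p : Total A.S} :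
    A.q (e.pt hA.1 u) = A.q p ↔
      p = e.pt hA.1 u ∨ (A.ξ e ≠ e ∧ p = (A.ξ e).pt hA.1 (flip (A.σ e) u)) := by
  rw [q_eq_iff hA, eq_comm]
  refine or_congr Iff.rfl ⟨?_, fun h => ⟨e, u, h.1, rfl, h.2⟩⟩
  rintro ⟨f, v, hf, h1, rfl⟩
  have hef : e = f := HalfEdge.eq_of_mem_toSet (e.pt_mem hA.1 u) (h1 ▸ f.pt_mem hA.1 v)
  subst hef
  rw [HalfEdge.pt_injective hA.1 e h1]
  exact ⟨hf, rfl⟩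

omit hA in
theorem boundaryImage_eq : A.boundaryImage = A.q '' (Total.interior A.S)ᶜ := by
  ext z
  simp only [boundaryImage, mem_iUnion, mem_image]
  constructor
  · rintro ⟨e, p, hp, rfl⟩
    exact ⟨p, HalfEdge.notMem_interior hp, rfl⟩
  · rintro ⟨p, hp, rfl⟩
    obtain ⟨e, he⟩ := HalfEdge.exists_mem_toSet hp
    exact ⟨e, p, he, rfl⟩

theorem q_mem_boundaryImage_iff {p : Total A.S} :
    A.q p ∈ A.boundaryImage ↔ p ∉ Total.interior A.S := by
  rw [boundaryImage_eq]
  constructor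
  · rintro ⟨p', hp', h⟩ hp
    rw [eq_comm, q_eq_iff_of_mem_interior hA hp] at h
    exact hp' (h ▸ hp)
  · exact fun h => mem_image_of_mem _ h

/-- A quotient map of an affine atlas is closed: the gluing is a homeomorphism of intervals which
are relatively open in the boundary of the strips. -/
theorem isClosedMap_q : IsClosedMap A.q := by
  -- the largest saturated subset of an open set is open
  have hopen : ∀ O : Set (Total A.S), IsOpen O → IsOpen {p | ∀ p', A.q p = A.q p' → p' ∈ O} := by
    intro O hO
    rw [isOpen_iff_mem_nhds]
    intro p hp
    by_cases hpi : p ∈ Total.interior A.S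
    · filter_upwards [hO.mem_nhds (hp p rfl), Total.isOpen_interior.mem_nhds hpi] with p' h1 h2 p'' h3
      rw [q_eq_iff_of_mem_interior hA h2] at h3
      exact h3 ▸ h1
    · obtain ⟨e, he⟩ := HalfEdge.exists_mem_toSet hpi
      obtain ⟨u, rfl⟩ := e.exists_pt_eq hA.1 he
      have hV : ∀ᶠ v in 𝓝 u, A.ξ e ≠ e → (A.ξ e).pt hA.1 (flip (A.σ e) v) ∈ O := by
        by_cases hξ : A.ξ e = e
        · exact Eventually.of_forall fun v h => (h hξ).elim
        · have hc : Continuous fun v => (A.ξ e).pt hA.1 (flip (A.σ e) v) :=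
            ((A.ξ e).continuous_pt hA.1).comp (continuous_flip _)
          refine (hc.tendsto u).eventually (hO.mem_nhds ?_) |>.mono fun v hv _ => hv
          exact hp _ ((q_pt_eq_iff hA).2 (Or.inr ⟨hξ, rfl⟩))
      filter_upwards [hO.mem_nhds (hp _ rfl), e.eventually_pt hA.1 u hV] with p' h1 h2 p'' h3
      rcases h2 with h2 | ⟨v, hv, rfl⟩
      · rw [q_eq_iff_of_mem_interior hA h2] at h3
        exact h3 ▸ h1
      · rw [q_pt_eq_iff hA] at h3
        rcases h3 with rfl | ⟨hξ, rfl⟩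
        · exact h1
        · exact hv hξ
  intro C hC
  rw [← A.isQuotientMap.isClosed_preimage, ← isOpen_compl_iff]
  convert hopen Cᶜ hC.isOpen_compl using 1
  ext p
  simp only [mem_compl_iff, mem_preimage, mem_image, not_exists, not_and]
  exact ⟨fun h p' h1 h2 => h p' h2 h1.symm, fun h p' h1 h2 => h p' h2.symm h1⟩

theorem isProperMap_q : IsProperMap A.q := by
  rw [isProperMap_iff_isClosedMap_and_compact_fibers]
  refine ⟨A.isQuotientMap.continuous, isClosedMap_q hA, fun z => Set.Finite.isCompact ?_⟩
  obtain ⟨p, rfl⟩ := A.isQuotientMap.surjective z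
  by_cases hpi : p ∈ Total.interior A.S
  · refine (finite_singleton p).subset fun p' hp' => ?_
    exact ((q_eq_iff_of_mem_interior hA hpi).1 (Eq.symm hp')).symm
  · obtain ⟨e, he⟩ := HalfEdge.exists_mem_toSet hpi
    obtain ⟨u, rfl⟩ := e.exists_pt_eq hA.1 he
    refine (Set.toFinite {e.pt hA.1 u, (A.ξ e).pt hA.1 (flip (A.σ e) u)}).subset fun p' hp' => ?_
    rcases (q_pt_eq_iff hA).1 (Eq.symm hp') with h | h
    · exact Or.inl h
    · exact Or.inr h.2

/-- Products of a space with the quotient map of an affine atlas are quotient maps. -/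
theorem isQuotientMap_prodMap_q (P : Type*) [TopologicalSpace P] :
    IsQuotientMap (Prod.map id A.q : P × Total A.S → P × Z) :=
  ((isProperMap_id (X := P)).prodMap (isProperMap_q hA)).isClosedMap.isQuotientMap
    (continuous_id.prodMap A.isQuotientMap.continuous)
    (Function.surjective_id.prodMap A.isQuotientMap.surjective)

end StripedAtlas

/-! ### Lifting homeomorphisms to the strips -/

/-- A homeomorphism that preserves the fibres of a quotient map descends to the quotient. -/
theorem exists_homeomorph_of_isQuotientMap {T : Type*} {Z : Type*} [TopologicalSpace T]
    [TopologicalSpace Z] {q : T → Z} (hq : IsQuotientMap q) (k : T ≃ₜ T)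
    (hk : ∀ p p', q p = q p' ↔ q (k p) = q (k p')) : ∃ h : Z ≃ₜ Z, ∀ p, h (q p) = q (k p) := by
  have aux : ∀ k : T ≃ₜ T, (∀ p p', q p = q p' → q (k p) = q (k p')) →
      ∃ f : Z → Z, Continuous f ∧ ∀ p, f (q p) = q (k p) := by
    intro k hk
    have hf : ∀ p, q (k (hq.surjective (q p)).choose) = q (k p) := fun p =>
      hk _ _ (hq.surjective (q p)).choose_spec
    refine ⟨fun z => q (k (hq.surjective z).choose), hq.continuous_iff.2 ?_, hf⟩
    exact (hq.continuous.comp k.continuous).congr fun p => (hf p).symm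
  obtain ⟨f, hf, hfk⟩ := aux k fun p p' => (hk p p').1
  obtain ⟨g, hg, hgk⟩ := aux k.symm fun p p' h => by
    rw [hk, k.apply_symm_apply, k.apply_symm_apply]; exact h
  refine ⟨⟨⟨f, g, fun z => ?_, fun z => ?_⟩, hf, hg⟩, hfk⟩
  · obtain ⟨p, rfl⟩ := hq.surjective z
    rw [hfk, hgk, k.symm_apply_apply]
  · obtain ⟨p, rfl⟩ := hq.surjective z
    rw [hgk, hfk, k.apply_symm_apply]

namespace StripedAtlas

variable {Z : Type u} [TopologicalSpace Z] {A : StripedAtlas.{u, v, w} Z} (hA : A.IsAffine)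
include hA

theorem tendsto_nhdsSet_fibre {α : Type*} {F : Filter α} {f : α → Total A.S} {r : Total A.S}
    (hf : Tendsto (fun a => A.q (f a)) F (𝓝 (A.q r))) :
    Tendsto f F (𝓝ˢ (A.q ⁻¹' {A.q r})) := by
  rw [← (isClosedMap_q hA).comap_nhds_eq A.isQuotientMap.continuous]
  exact tendsto_comap_iff.2 hf

/-- If `q ∘ f` converges to `q r` and `f` stays in a set that is disjoint from neighbourhoods of the
other points of the fibre of `r`, then `f` converges to `r`. -/
theorem tendsto_of_tendsto_q {α : Type*} {F : Filter α} {f : α → Total A.S} {r : Total A.S}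
    {O : Set (Total A.S)} (hf : Tendsto (fun a => A.q (f a)) F (𝓝 (A.q r)))
    (hO : ∀ᶠ a in F, f a ∈ O) (hr : ∀ r', A.q r' = A.q r → r' ≠ r → Oᶜ ∈ 𝓝 r') :
    Tendsto f F (𝓝 r) := by
  intro U hU
  have h1 : U ∪ Oᶜ ∈ 𝓝ˢ (A.q ⁻¹' {A.q r}) := by
    rw [mem_nhdsSet_iff_forall]
    intro r' hr'
    by_cases h : r' = r
    · subst h
      exact mem_of_superset hU subset_union_left
    · exact mem_of_superset (hr r' hr' h) subset_union_right
  filter_upwards [tendsto_nhdsSet_fibre hA hf h1, hO] with a h2 h3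
  exact h2.resolve_right fun h => h h3

theorem tendsto_of_tendsto_q_of_mem_interior {α : Type*} {F : Filter α} {f : α → Total A.S}
    {r : Total A.S} (hr : r ∈ Total.interior A.S)
    (hf : Tendsto (fun a => A.q (f a)) F (𝓝 (A.q r))) : Tendsto f F (𝓝 r) :=
  tendsto_of_tendsto_q hA hf (O := univ) (Eventually.of_forall fun _ => mem_univ _)
    fun _ h1 h2 => (h2 ((q_eq_iff_of_mem_interior hA hr).1 h1.symm).symm).elim

theorem exists_fibre_eq (r : Total A.S) : ∃ r', A.q r' = A.q r ∧
    ∀ r'', A.q r'' = A.q r → r'' = r ∨ r'' = r' := by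
  by_cases hr : r ∈ Total.interior A.S
  · exact ⟨r, rfl, fun r'' h => Or.inl ((q_eq_iff_of_mem_interior hA hr).1 h.symm).symm⟩
  · obtain ⟨e, he⟩ := HalfEdge.exists_mem_toSet hr
    obtain ⟨u, rfl⟩ := e.exists_pt_eq hA.1 he
    by_cases hξ : A.ξ e = e
    · refine ⟨_, rfl, fun r'' h => Or.inl ?_⟩
      exact ((q_pt_eq_iff hA).1 h.symm).resolve_right fun h => h.1 hξ
    · refine ⟨_, ((q_pt_eq_iff hA).2 (Or.inr ⟨hξ, rfl⟩)).symm, fun r'' h => ?_⟩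
      exact ((q_pt_eq_iff hA).1 h.symm).imp id And.right

/-- A point can be separated from the rest of its fibre. -/
theorem exists_separation (r : Total A.S) : ∃ O O' : Set (Total A.S), IsOpen O ∧ IsOpen O' ∧
    Disjoint O O' ∧ r ∈ O ∧ ∀ r', A.q r' = A.q r → r' ≠ r → r' ∈ O' := by
  obtain ⟨r', -, h⟩ := exists_fibre_eq hA r
  by_cases hr : r' = r
  · refine ⟨univ, ∅, isOpen_univ, isOpen_empty, disjoint_bot_right, mem_univ _, fun r'' h1 h2 => ?_⟩
    rcases h r'' h1 with h3 | h3
    · exact (h2 h3).elim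
    · exact (h2 (h3.trans hr)).elim
  · obtain ⟨O', O, h1, h2, h3, h4, h5⟩ := t2_separation hr
    exact ⟨O, O', h2, h1, h5.symm, h4, fun r'' h6 h7 => ((h r'' h6).resolve_left h7) ▸ h3⟩

theorem eventually_mem_union {α : Type*} {F : Filter α} {f : α → Total A.S} {r : Total A.S}
    {O O' : Set (Total A.S)} (hO : IsOpen O) (hO' : IsOpen O') (hrO : r ∈ O)
    (h : ∀ r', A.q r' = A.q r → r' ≠ r → r' ∈ O')
    (hf : Tendsto (fun a => A.q (f a)) F (𝓝 (A.q r))) : ∀ᶠ a in F, f a ∈ O ∪ O' := by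
  refine tendsto_nhdsSet_fibre hA hf ((hO.union hO').mem_nhdsSet.2 fun r' hr' => ?_)
  by_cases h1 : r' = r
  · exact Or.inl (h1 ▸ hrO)
  · exact Or.inr (h r' hr' h1)

/-- Continuity of a family of lifts: if `q ∘ Φ` is jointly continuous and each `Φ (a, ·)` is
continuous and preserves the interior, then `Φ` is jointly continuous. Near a boundary point, the
image of a connected neighbourhood cannot jump to another point of the fibre, because this does not
happen at nearby interior points. -/
theorem continuous_of_continuous_q {P : Type*} [TopologicalSpace P] {Φ : P × Total A.S → Total A.S}
    (hq : Continuous fun x => A.q (Φ x)) (hc : ∀ a, Continuous fun p => Φ (a, p))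
    (hi : ∀ a p, Φ (a, p) ∈ Total.interior A.S ↔ p ∈ Total.interior A.S) : Continuous Φ := by
  rw [continuous_iff_continuousAt]
  rintro ⟨a₀, p₀⟩
  set r := Φ (a₀, p₀) with hr
  obtain ⟨O, O', hO, hO', hd, hrO, hsep⟩ := exists_separation hA r
  have ht : Tendsto (fun x => A.q (Φ x)) (𝓝 (a₀, p₀)) (𝓝 (A.q r)) := hq.tendsto _
  have h1 := eventually_mem_union hA hO hO' hrO hsep ht
  rw [nhds_prod_eq, eventually_prod_iff] at h1
  obtain ⟨pa, hpa, pb, hpb, h1⟩ := h1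
  obtain ⟨D, hD, hDsub, hDc, -, p₂, hp₂, hp₂i⟩ := Total.exists_connected_nhds p₀
    (inter_mem hpb ((hc a₀).tendsto p₀ (hO.mem_nhds hrO)))
  have h2 : Tendsto (fun a => Φ (a, p₂)) (𝓝 a₀) (𝓝 (Φ (a₀, p₂))) := by
    refine tendsto_of_tendsto_q_of_mem_interior hA ((hi a₀ p₂).2 hp₂i) ?_
    exact (hq.comp (Continuous.prodMk_left p₂)).tendsto a₀
  have h3 : ∀ᶠ x in 𝓝 a₀ ×ˢ 𝓝 p₀, Φ x ∈ O := by
    rw [eventually_prod_iff]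
    refine ⟨fun a => pa a ∧ Φ (a, p₂) ∈ O, hpa.and (h2 (hO.mem_nhds (hDsub hp₂).2)),
      fun p => p ∈ D, hD, fun {a} ha {p} hp => ?_⟩
    have h4 : IsPreconnected ((fun p => Φ (a, p)) '' D) := hDc.image _ (hc a).continuousOn
    have h5 : (fun p => Φ (a, p)) '' D ⊆ O ∪ O' := by
      rintro _ ⟨p, hp, rfl⟩
      exact h1 ha.1 (hDsub hp).1
    exact h4.subset_left_of_subset_union hO hO' hd h5 ⟨_, ⟨p₂, hp₂, rfl⟩, ha.2⟩ ⟨p, hp, rfl⟩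
  rw [← nhds_prod_eq] at h3
  exact tendsto_of_tendsto_q hA ht h3 fun r' h4 h5 =>
    mem_of_superset (hO'.mem_nhds (hsep r' h4 h5)) (subset_compl_iff_disjoint_left.2 hd)

/-- Lifts are unique. -/
theorem lift_unique {k k' : Total A.S → Total A.S} (hk : Continuous k) (hk' : Continuous k')
    (hi : ∀ p ∈ Total.interior A.S, k p ∈ Total.interior A.S)
    (h : ∀ p, A.q (k p) = A.q (k' p)) : k = k' :=
  Continuous.ext_on Total.dense_interior hk hk' fun p hp =>
    (q_eq_iff_of_mem_interior hA (hi p hp)).1 (h p)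

/-- A homeomorphism of `Z` that preserves the union of the boundary intervals lifts to the strips.
The lift exists on the interior of the strips; it extends to a boundary point because the images of
interior points nearby accumulate only at a fibre, and by connectedness only at one point of it. -/
theorem exists_continuous_lift (h : Z ≃ₜ Z) (hh : ∀ z, h z ∈ A.boundaryImage ↔ z ∈ A.boundaryImage) :
    ∃ k : Total A.S → Total A.S, Continuous k ∧ ∀ p, A.q (k p) = h (A.q p) := by
  have hex : ∀ p : Total.interior A.S, ∃ p' ∈ Total.interior A.S, A.q p' = h (A.q p) := by
    intro p
    obtain ⟨p', hp'⟩ := A.isQuotientMap.surjective (h (A.q p))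
    refine ⟨p', ?_, hp'⟩
    by_contra hn
    rw [← q_mem_boundaryImage_iff hA, hp', hh, q_mem_boundaryImage_iff hA] at hn
    exact hn p.2
  choose f hfi hf using hex
  have hi : IsDenseInducing (Subtype.val : Total.interior A.S → Total A.S) :=
    ⟨IsInducing.subtypeVal, by
      rw [DenseRange, Subtype.range_coe]; exact Total.dense_interior⟩
  have hq : ∀ p : Total A.S, Tendsto (fun p' => A.q (f p')) (comap Subtype.val (𝓝 p))
      (𝓝 (h (A.q p))) := fun p => by
    simp only [hf]
    exact ((h.continuous.comp A.isQuotientMap.continuous).tendsto p).comp tendsto_comap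
  have hfc : Continuous f := by
    rw [continuous_iff_continuousAt]
    intro p
    refine tendsto_of_tendsto_q_of_mem_interior hA (hfi p) ?_
    rw [hf, nhds_subtype_eq_comap]
    exact hq p
  -- the image of a connected neighbourhood stays near one of the two points of the fibre
  have hlim : ∀ p : Total A.S, ∃ r, A.q r = h (A.q p) ∧
      Tendsto f (comap Subtype.val (𝓝 p)) (𝓝 r) := by
    intro p
    obtain ⟨r, hr⟩ := A.isQuotientMap.surjective (h (A.q p))
    obtain ⟨r', hr', hfib⟩ := exists_fibre_eq hA r
    obtain ⟨O, O', hO, hO', hd, hrO, hsep⟩ := exists_separation hA r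
    have ht := hq p
    rw [← hr] at ht
    obtain ⟨U, hU, hUsub⟩ := mem_comap.1 (eventually_mem_union hA hO hO' hrO hsep ht)
    obtain ⟨D, hD, hDU, -, hDc, p₂, hp₂⟩ := Total.exists_connected_nhds p hU
    have hDc' : IsPreconnected (Subtype.val ⁻¹' D : Set (Total.interior A.S)) := by
      rw [← IsInducing.subtypeVal.isPreconnected_image, Subtype.image_preimage_coe, inter_comm]
      exact hDc
    have hsub : f '' (Subtype.val ⁻¹' D) ⊆ O ∪ O' := by
      rintro _ ⟨p', hp', rfl⟩
      exact hUsub (hDU hp')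
    have hmem : Subtype.val ⁻¹' D ∈ comap (Subtype.val : Total.interior A.S → _) (𝓝 p) :=
      preimage_mem_comap hD
    have hcon := hDc'.image f hfc.continuousOn
    rcases isPreconnected_iff_subset_of_disjoint.1 hcon O O' hO hO' hsub
      (by rw [hd.inter_eq, inter_empty]) with h1 | h1
    · refine ⟨r, hr, tendsto_of_tendsto_q hA ht (O := O)
        (mem_of_superset hmem fun p' hp' => h1 (mem_image_of_mem _ hp')) fun r'' h2 h3 => ?_⟩
      exact mem_of_superset (hO'.mem_nhds (hsep r'' h2 h3)) (subset_compl_iff_disjoint_left.2 hd)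
    · refine ⟨r', hr'.trans hr, tendsto_of_tendsto_q hA (hr'.symm ▸ ht) (O := O')
        (mem_of_superset hmem fun p' hp' => h1 (mem_image_of_mem _ hp')) fun r'' h2 h3 => ?_⟩
      have h4 := (hfib r'' (h2.trans hr')).resolve_right h3
      rw [h4]
      exact mem_of_superset (hO.mem_nhds hrO) (subset_compl_iff_disjoint_right.2 hd)
  refine ⟨hi.extend f, hi.continuous_extend fun p => (hlim p).imp fun _ h => h.2, fun p => ?_⟩
  obtain ⟨r, hr, ht⟩ := hlim p
  rw [hi.extend_eq_of_tendsto ht, hr]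

theorem mem_interior_iff_of_lift {h : Z ≃ₜ Z}
    (hh : ∀ z, h z ∈ A.boundaryImage ↔ z ∈ A.boundaryImage) {k : Total A.S → Total A.S}
    (hk : ∀ p, A.q (k p) = h (A.q p)) (p : Total A.S) :
    k p ∈ Total.interior A.S ↔ p ∈ Total.interior A.S := by
  rw [← not_iff_not, ← q_mem_boundaryImage_iff hA, hk, hh, q_mem_boundaryImage_iff hA]

theorem exists_lift (h : Z ≃ₜ Z) (hh : ∀ z, h z ∈ A.boundaryImage ↔ z ∈ A.boundaryImage) :
    ∃ k : Total A.S ≃ₜ Total A.S, ∀ p, A.q (k p) = h (A.q p) := by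
  have hh' : ∀ z, h.symm z ∈ A.boundaryImage ↔ z ∈ A.boundaryImage := fun z => by
    rw [← hh, h.apply_symm_apply]
  obtain ⟨k, hk, hkq⟩ := exists_continuous_lift hA h hh
  obtain ⟨k', hk', hkq'⟩ := exists_continuous_lift hA h.symm hh'
  have i1 := mem_interior_iff_of_lift hA hh hkq
  have i2 := mem_interior_iff_of_lift hA hh' hkq'
  have e1 : k' ∘ k = id := lift_unique hA (hk'.comp hk) continuous_id
    (fun p hp => (i2 _).2 ((i1 _).2 hp)) fun p => by
      simp [hkq', hkq]
  have e2 : k ∘ k' = id := lift_unique hA (hk.comp hk') continuous_id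
    (fun p hp => (i1 _).2 ((i2 _).2 hp)) fun p => by
      simp [hkq', hkq]
  exact ⟨⟨⟨k, k', congrFun e1, congrFun e2⟩, hk, hk'⟩, hkq⟩

/-- The lift of a homeomorphism that preserves the union of the boundary intervals. -/
def lift (h : Z ≃ₜ Z) (hh : ∀ z, h z ∈ A.boundaryImage ↔ z ∈ A.boundaryImage) :
    Total A.S ≃ₜ Total A.S := (exists_lift hA h hh).choose

theorem q_lift (h : Z ≃ₜ Z) (hh : ∀ z, h z ∈ A.boundaryImage ↔ z ∈ A.boundaryImage)
    (p : Total A.S) : A.q (lift hA h hh p) = h (A.q p) := (exists_lift hA h hh).choose_spec p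

theorem eq_lift {h : Z ≃ₜ Z} (hh : ∀ z, h z ∈ A.boundaryImage ↔ z ∈ A.boundaryImage)
    {k : Total A.S ≃ₜ Total A.S} (hk : ∀ p, A.q (k p) = h (A.q p)) : k = lift hA h hh := by
  refine Homeomorph.ext (congrFun (lift_unique hA k.continuous (lift hA h hh).continuous
    (fun p hp => (mem_interior_iff_of_lift hA hh hk p).2 hp) fun p => ?_))
  rw [hk, q_lift]

omit hA in
/-- A homeomorphism of the strips that preserves the fibres of `q` descends to `Z`. -/
theorem exists_descent (k : Total A.S ≃ₜ Total A.S)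
    (hk : ∀ p p', A.q p = A.q p' ↔ A.q (k p) = A.q (k p')) :
    ∃ h : Z ≃ₜ Z, ∀ p, h (A.q p) = A.q (k p) :=
  exists_homeomorph_of_isQuotientMap A.isQuotientMap k hk

end StripedAtlas

/-! ### Homeomorphisms of the strips that preserve rows -/

/-- A sign as a real number. -/
def sgn (ε : ℤˣ) : ℝ := ((ε : ℤ) : ℝ)

@[simp] theorem sgn_one : sgn 1 = 1 := by simp [sgn]

@[simp] theorem sgn_neg_one : sgn (-1) = -1 := by simp [sgn]

theorem sgn_mul (a b : ℤˣ) : sgn (a * b) = sgn a * sgn b := by simp [sgn]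

theorem sgn_mul_self (a : ℤˣ) : sgn a * sgn a = 1 := by
  rw [← sgn_mul, Int.units_mul_self, sgn_one]

theorem eq_of_sgn_mul_pos {a b : ℤˣ} {X : ℝ} (ha : 0 < sgn a * X) (hb : 0 < sgn b * X) :
    a = b := by
  rcases Int.units_eq_one_or a with rfl | rfl <;> rcases Int.units_eq_one_or b with rfl | rfl <;>
    simp at ha hb ⊢ <;> linarith

/-- A continuous function without zeros on a connected space has constant sign. -/
theorem exists_sign {X : Type*} [TopologicalSpace X] [PreconnectedSpace X] {F : X → ℝ}
    (hF : Continuous F) (hne : ∀ x, F x ≠ 0) : ∃ ε, ∀ x, 0 < sgn ε * F x := by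
  by_cases h : ∃ a, 0 < F a
  · obtain ⟨a, ha⟩ := h
    refine ⟨1, fun b => ?_⟩
    rw [sgn_one, one_mul]
    by_contra hb
    obtain ⟨c, hc⟩ := mem_range_of_exists_le_of_exists_ge hF ⟨b, not_lt.1 hb⟩ ⟨a, ha.le⟩
    exact hne c hc
  · push Not at h
    refine ⟨-1, fun b => ?_⟩
    rw [sgn_neg_one, neg_one_mul, neg_pos]
    exact lt_of_le_of_ne (h b) (hne b)

theorem sgn_mul_level_sub_pos (T : Strip) (s : ℤˣ) {t : ℝ} (ht : t ∈ Ioo T.lo T.hi) :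
    0 < sgn s * (T.level s - t) := by
  rcases Int.units_eq_one_or s with rfl | rfl <;> simp [Strip.level, ht.1, ht.2]

section Family

variable {Λ : Type v} {S : Λ → Strip}

namespace Total

/-- The height of the middle line of a strip. -/
def mid (S : Λ → Strip) (l : Λ) : ℝ := ((S l).lo + (S l).hi) / 2

theorem mid_mem (l : Λ) : mid S l ∈ Ioo (S l).lo (S l).hi := by
  have := (S l).lo_lt_hi
  constructor <;> simp only [mid] <;> linarith

/-- A point of the middle line of a strip. -/
def base (S : Λ → Strip) (l : Λ) : Total S := mkInt l 0 (mid S l) (mid_mem l)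

theorem base_mem (l : Λ) : base S l ∈ interior S := mid_mem l

theorem continuous_mkInt {X : Type*} [TopologicalSpace X] {l : Λ} {f g : X → ℝ} (hf : Continuous f)
    (hg : Continuous g) (h : ∀ x, g x ∈ Ioo (S l).lo (S l).hi) :
    Continuous fun x => mkInt l (f x) (g x) (h x) :=
  continuous_sigmaMk.comp ((hf.prodMk hg).subtype_mk _)

theorem isPreconnected_strip (l : Λ) : IsPreconnected {p : Total S | p.1 = l} := by
  have h1 : IsPreconnected (S l).carrier := by
    have hc : IsPreconnected ((univ : Set ℝ) ×ˢ Ioo (S l).lo (S l).hi) :=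
      (convex_univ.prod (convex_Ioo _ _)).isPreconnected
    refine hc.subset_closure (S l).interior_subset ?_
    rw [closure_prod_eq, closure_univ, closure_Ioo (S l).lo_lt_hi.ne]
    exact (S l).subset_closed
  have h2 : IsPreconnected (univ : Set (S l).carrier) := by
    rwa [← IsInducing.subtypeVal.isPreconnected_image, image_univ, Subtype.range_coe]
  convert h2.image (Sigma.mk l : _ → Total S) continuous_sigmaMk.continuousOn using 1
  ext p
  constructor
  · obtain ⟨l', w⟩ := p
    rintro h
    change l' = l at h
    subst h
    exact ⟨w, mem_univ _, rfl⟩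
  · rintro ⟨w, -, rfl⟩
    rfl

theorem isClopen_strip (l : Λ) : IsClopen {p : Total S | p.1 = l} := by
  have h : IsOpen {p : Total S | p.1 = l} := by
    rw [isOpen_iff_mem_nhds]
    intro p hp
    filter_upwards [p.eventually_vertex_eq] with p' hp'
    exact hp'.trans hp
  refine ⟨⟨?_⟩, h⟩
  rw [isOpen_iff_mem_nhds]
  intro p hp
  filter_upwards [p.eventually_vertex_eq] with p' hp' h'
  exact hp (hp'.symm.trans h')

/-- A point of a strip is the limit of the interior points above or below it. -/
theorem exists_tendsto_vertical (p : Total S) : ∃ f : ℝ → Total S,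
    (∀ t (ht : t ∈ Ioo (S p.1).lo (S p.1).hi), f t = mkInt p.1 p.x t ht) ∧
      Tendsto f (𝓝[Ioo (S p.1).lo (S p.1).hi] p.y) (𝓝 p) ∧
      (𝓝[Ioo (S p.1).lo (S p.1).hi] p.y).NeBot := by
  classical
  refine ⟨fun t => if ht : t ∈ Ioo (S p.1).lo (S p.1).hi then mkInt p.1 p.x t ht else p,
    fun t ht => dif_pos ht, ?_, ?_⟩
  · rw [tendsto_nhds_iff]
    have h : ∀ᶠ t in 𝓝[Ioo (S p.1).lo (S p.1).hi] p.y, t ∈ Ioo (S p.1).lo (S p.1).hi :=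
      self_mem_nhdsWithin
    refine ⟨h.mono fun t ht => ?_, ?_, ?_⟩
    · rw [dif_pos ht]; rfl
    · exact tendsto_const_nhds.congr' (h.mono fun t ht => by dsimp only; rw [dif_pos ht]; rfl)
    · exact (tendsto_id.mono_left nhdsWithin_le_nhds).congr'
        (h.mono fun t ht => by dsimp only; rw [dif_pos ht]; rfl)
  · rw [← mem_closure_iff_nhdsWithin_neBot, closure_Ioo (S p.1).lo_lt_hi.ne]
    exact p.mem_Icc

theorem eq_lo_or_eq_hi {p : Total S} (hp : p ∉ interior S) :
    p.y = (S p.1).lo ∨ p.y = (S p.1).hi := by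
  by_contra h
  push Not at h
  exact hp ⟨lt_of_le_of_ne p.mem_Icc.1 (Ne.symm h.1), lt_of_le_of_ne p.mem_Icc.2 h.2⟩

end Total

/-- A connected family of boundary points stays in one boundary interval. -/
theorem HalfEdge.mem_toSet_of_preconnected (hS : ∀ l, (S l).IsModel) {X : Type*}
    [TopologicalSpace X] [PreconnectedSpace X] {c : X → Total S} (hc : Continuous c)
    (hni : ∀ a, c a ∉ Total.interior S) {f : HalfEdge S} {a : X} (ha : c a ∈ f.toSet) (b : X) :
    c b ∈ f.toSet := by
  have hopen : ∀ g : HalfEdge S, IsOpen {a | c a ∈ g.toSet} := fun g => by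
    convert (g.isOpen_interior_union hS).preimage hc using 1
    ext a
    exact (or_iff_right (hni a)).symm
  have hclosed : IsClosed {a | c a ∈ f.toSet} := by
    refine ⟨?_⟩
    rw [isOpen_iff_mem_nhds]
    intro a ha
    obtain ⟨g, hg⟩ := HalfEdge.exists_mem_toSet (hni a)
    filter_upwards [(hopen g).mem_nhds hg] with a' ha' h
    exact ha (show c a ∈ f.toSet from HalfEdge.eq_of_mem_toSet h ha' ▸ hg)
  exact (eq_univ_iff_forall.1 (IsClopen.eq_univ ⟨hclosed, hopen f⟩ ⟨a, ha⟩)) b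

theorem Total.vertex_eq_of_preconnected {X : Type*} [TopologicalSpace X] [PreconnectedSpace X]
    {c : X → Total S} (hc : Continuous c) (a b : X) : (c b).1 = (c a).1 :=
  (eq_univ_iff_forall.1 (IsClopen.eq_univ ((Total.isClopen_strip (c a).1).preimage hc)
    ⟨a, rfl⟩)) b

/-- A homeomorphism of a disjoint union of strips which, together with its inverse, maps interiors
of strips to interiors and horizontal lines there to horizontal lines. -/
structure IsRowPreserving (k : Total S ≃ₜ Total S) : Prop where
  mem_interior : ∀ p, k p ∈ Total.interior S ↔ p ∈ Total.interior S
  row : ∀ p ∈ Total.interior S, ∀ p' ∈ Total.interior S, p.1 = p'.1 → p.y = p'.y →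
    (k p).y = (k p').y
  row_symm : ∀ p ∈ Total.interior S, ∀ p' ∈ Total.interior S, p.1 = p'.1 → p.y = p'.y →
    (k.symm p).y = (k.symm p').y

namespace IsRowPreserving

open Total

variable {k : Total S ≃ₜ Total S} (hk : IsRowPreserving k)
include hk

theorem symm : IsRowPreserving k.symm where
  mem_interior p := by rw [← hk.mem_interior, k.apply_symm_apply]
  row := hk.row_symm
  row_symm := hk.row

omit hk in
theorem vertex {p p' : Total S} (h : p.1 = p'.1) : (k p).1 = (k p').1 := by
  have h1 := (isPreconnected_strip (S := S) p.1).subset_isClopen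
    ((isClopen_strip (S := S) (k p).1).preimage k.continuous) ⟨p, rfl, rfl⟩
  exact (h1 (show p' ∈ {p' : Total S | p'.1 = p.1} from h.symm)).symm

/-- The lines in the interior of a strip are permuted in an increasing or a decreasing way. -/
theorem exists_height_sign (l : Λ) : ∃ τ, ∀ p p' : Total S, p ∈ interior S → p' ∈ interior S →
    p.1 = l → p'.1 = l → p.y < p'.y → 0 < sgn τ * ((k p').y - (k p).y) := by
  -- the difference of the heights of the images does not vanish on the convex set of pairs of heights
  set D : Set (ℝ × ℝ) := {z | (S l).lo < z.1 ∧ z.1 < z.2 ∧ z.2 < (S l).hi} with hD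
  have hDc : Convex ℝ D := by
    intro z hz z' hz' a b ha hb hab
    have key : ∀ {x y x' y' : ℝ}, x < y → x' < y' → a * x + b * x' < a * y + b * y' := by
      intro x y x' y' h1 h2
      rcases ha.eq_or_lt with rfl | ha'
      · rw [zero_add] at hab; subst hab; linarith
      · nlinarith
    obtain ⟨h1, h2, h3⟩ := hz
    obtain ⟨h1', h2', h3'⟩ := hz'
    refine ⟨?_, key h2 h2', ?_⟩
    · have := key h1 h1'
      rwa [← add_mul, hab, one_mul] at this
    · have := key h3 h3'
      rwa [← add_mul, hab, one_mul] at this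
  have : PreconnectedSpace D := Subtype.preconnectedSpace hDc.isPreconnected
  have m1 : ∀ z : D, z.1.1 ∈ Ioo (S l).lo (S l).hi := fun z => ⟨z.2.1, z.2.2.1.trans z.2.2.2⟩
  have m2 : ∀ z : D, z.1.2 ∈ Ioo (S l).lo (S l).hi := fun z => ⟨z.2.1.trans z.2.2.1, z.2.2.2⟩
  set F : D → ℝ := fun z => (k (mkInt l 0 z.1.2 (m2 z))).y - (k (mkInt l 0 z.1.1 (m1 z))).y with hF
  have hFc : Continuous F :=
    (continuous_y.comp (k.continuous.comp (continuous_mkInt continuous_const (by fun_prop) _))).sub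
    (continuous_y.comp (k.continuous.comp (continuous_mkInt continuous_const (by fun_prop) _)))
  have hF0 : ∀ z, F z ≠ 0 := by
    intro z hz
    have h1 := hk.row_symm (k (mkInt l 0 z.1.2 (m2 z))) ((hk.mem_interior _).2 (mkInt_mem ..))
      (k (mkInt l 0 z.1.1 (m1 z))) ((hk.mem_interior _).2 (mkInt_mem ..)) (vertex rfl)
      (sub_eq_zero.1 hz)
    rw [k.symm_apply_apply, k.symm_apply_apply] at h1
    exact z.2.2.1.ne' h1
  obtain ⟨τ, hτ⟩ := exists_sign hFc hF0
  refine ⟨τ, ?_⟩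
  rintro p p' hp hp' rfl hl hlt
  have hp'' : p'.y ∈ Ioo (S p.1).lo (S p.1).hi := hl ▸ hp'
  have h := hτ ⟨(p.y, p'.y), hp.1, hlt, hp''.2⟩
  rw [hk.row p hp (mkInt p.1 0 p.y hp) hp rfl rfl, hk.row p' hp' (mkInt p.1 0 p'.y hp'') hp'' hl rfl]
  exact h

/-- The lines in the interior of a strip are all mapped in an increasing way, or all in a decreasing
way. -/
theorem exists_order_sign (l : Λ) : ∃ ε, ∀ p p' : Total S, p ∈ interior S → p' ∈ interior S →
    p.1 = l → p'.1 = l → p.y = p'.y → p.x < p'.x → 0 < sgn ε * ((k p').x - (k p).x) := by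
  -- the pairs of points on a common line form a convex set
  set D : Set (ℝ × ℝ × ℝ) := {z | z.1 < z.2.1} ∩ {z | z.2.2 ∈ Ioo (S l).lo (S l).hi} with hD
  have hDc : Convex ℝ D := by
    refine Convex.inter ?_ ?_
    · intro z hz z' hz' a b ha hb hab
      have h1 : z.1 < z.2.1 := hz
      have h2 : z'.1 < z'.2.1 := hz'
      change a * z.1 + b * z'.1 < a * z.2.1 + b * z'.2.1
      rcases ha.eq_or_lt with rfl | ha'
      · rw [zero_add] at hab; subst hab; linarith
      · nlinarith
    · intro z hz z' hz' a b ha hb hab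
      exact (convex_Ioo (S l).lo (S l).hi) hz hz' ha hb hab
  have : PreconnectedSpace D := Subtype.preconnectedSpace hDc.isPreconnected
  set F : D → ℝ := fun z => (k (mkInt l z.1.2.1 z.1.2.2 z.2.2)).x -
    (k (mkInt l z.1.1 z.1.2.2 z.2.2)).x with hF
  have hFc : Continuous F :=
    (continuous_x.comp (k.continuous.comp (continuous_mkInt (by fun_prop) (by fun_prop) _))).sub
    (continuous_x.comp (k.continuous.comp (continuous_mkInt (by fun_prop) (by fun_prop) _)))
  have hF0 : ∀ z, F z ≠ 0 := by
    intro z hz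
    have h1 := hk.row (mkInt l z.1.2.1 z.1.2.2 z.2.2) (mkInt_mem ..)
      (mkInt l z.1.1 z.1.2.2 z.2.2) (mkInt_mem ..) rfl rfl
    have h2 : mkInt l z.1.2.1 z.1.2.2 z.2.2 = mkInt l z.1.1 z.1.2.2 z.2.2 :=
      k.injective (ext_iff'.2 ⟨vertex rfl, sub_eq_zero.1 hz, h1⟩)
    have h3 : z.1.2.1 = z.1.1 := congrArg x h2
    exact (ne_of_gt z.2.1) h3
  obtain ⟨ε, hε⟩ := exists_sign hFc hF0
  refine ⟨ε, ?_⟩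
  rintro p p' hp hp' rfl hl hy hlt
  have h := hε ⟨(p.x, p'.x, p.y), hlt, hp⟩
  have e1 : p' = mkInt p.1 p'.x p.y hp := ext_iff'.2 ⟨hl, rfl, hy.symm⟩
  rw [e1]
  exact h

/-- The sign of the permutation of the lines also compares points on the sides, which are limits of
interior points. -/
theorem exists_height_sign' (l : Λ) : ∃ τ, ∀ p p' : Total S,
    p.1 = l → p'.1 = l → p.y < p'.y → 0 < sgn τ * ((k p').y - (k p).y) := by
  obtain ⟨τ, hτ⟩ := hk.exists_height_sign l
  refine ⟨τ, ?_⟩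
  rintro p p' rfl hl hlt
  have hI := p.mem_Icc
  have hI' : p'.y ∈ Icc (S p.1).lo (S p.1).hi := hl ▸ p'.mem_Icc
  obtain ⟨t, ht, ht'⟩ := exists_between hlt
  obtain ⟨t', htt, ht''⟩ := exists_between ht'
  have m : t ∈ Ioo (S p.1).lo (S p.1).hi := ⟨hI.1.trans_lt ht, ht'.trans_le hI'.2⟩
  have m' : t' ∈ Ioo (S p.1).lo (S p.1).hi := ⟨m.1.trans htt, ht''.trans_le hI'.2⟩
  have hc : Continuous fun p => (k p).y := continuous_y.comp k.continuous
  have h1 : 0 ≤ sgn τ * ((k (mkInt p.1 0 t m)).y - (k p).y) := by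
    obtain ⟨f, hf, hft, hne⟩ := exists_tendsto_vertical p
    refine ge_of_tendsto (((tendsto_const_nhds).sub ((hc.tendsto p).comp hft)).const_mul (sgn τ)) ?_
    filter_upwards [self_mem_nhdsWithin, mem_nhdsWithin_of_mem_nhds (Iio_mem_nhds ht)] with r h1 h2
    rw [Function.comp_apply, hf r h1]
    exact (hτ (mkInt p.1 p.x r h1) (mkInt p.1 0 t m) h1 m rfl rfl h2).le
  have h2 : 0 ≤ sgn τ * ((k p').y - (k (mkInt p.1 0 t' m')).y) := by
    obtain ⟨f, hf, hft, hne⟩ := exists_tendsto_vertical p'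
    refine ge_of_tendsto ((((hc.tendsto p').comp hft).sub tendsto_const_nhds).const_mul (sgn τ)) ?_
    filter_upwards [self_mem_nhdsWithin, mem_nhdsWithin_of_mem_nhds (Ioi_mem_nhds ht'')]
      with r h1 h2
    rw [Function.comp_apply, hf r h1]
    exact (hτ (mkInt p.1 0 t' m') (mkInt p'.1 p'.x r h1) m' h1 rfl hl h2).le
  have h3 := hτ (mkInt p.1 0 t m) (mkInt p.1 0 t' m') (mkInt_mem ..) (mkInt_mem ..) rfl rfl htt
  linarith

/-- Points of a line or of a side are mapped to the same height. For a side, the heights of the images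
lie at the ends of the target strip, on the same side of the image of the middle line. -/
theorem row' {p p' : Total S} (hv : p.1 = p'.1) (hy : p.y = p'.y) : (k p).y = (k p').y := by
  have hkv : (k p).1 = (k p').1 := vertex hv
  by_cases hp : p ∈ Total.interior S
  · refine hk.row p hp p' ?_ hv hy
    change p'.y ∈ Ioo (S p'.1).lo (S p'.1).hi
    rw [← hv, ← hy]
    exact hp
  · have hp' : p' ∉ Total.interior S := by
      intro h
      apply hp
      change p.y ∈ Ioo (S p.1).lo (S p.1).hi
      rw [hv, hy]
      exact h
    obtain ⟨τ, hτ⟩ := hk.exists_height_sign' p.1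
    have hb : k (base S p.1) ∈ Total.interior S := (hk.mem_interior _).2 (base_mem _)
    have hb' : (k (base S p.1)).y ∈ Ioo (S (k p).1).lo (S (k p).1).hi := by
      rw [show (k p).1 = (k (base S p.1)).1 from vertex rfl]; exact hb
    have e1 := eq_lo_or_eq_hi fun h => hp ((hk.mem_interior p).1 h)
    have e2 := eq_lo_or_eq_hi fun h => hp' ((hk.mem_interior p').1 h)
    rw [← hkv] at e2
    have hsign : (0 < sgn τ * ((k p).y - (k (base S p.1)).y) ∧
        0 < sgn τ * ((k p').y - (k (base S p.1)).y)) ∨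
        (0 < sgn τ * ((k (base S p.1)).y - (k p).y) ∧
        0 < sgn τ * ((k (base S p.1)).y - (k p').y)) := by
      rcases lt_trichotomy p.y (base S p.1).y with h | h | h
      · exact Or.inr ⟨hτ _ _ rfl rfl h, hτ _ _ hv.symm rfl (hy ▸ h)⟩
      · exact (hp (show p.y ∈ Ioo _ _ from h ▸ mid_mem p.1)).elim
      · exact Or.inl ⟨hτ _ _ rfl rfl h, hτ _ _ rfl hv.symm (hy ▸ h)⟩
    obtain ⟨hb1, hb2⟩ := hb'
    rcases Int.units_eq_one_or τ with rfl | rfl <;>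
    simp only [sgn_one, sgn_neg_one, one_mul, neg_one_mul] at hsign <;>
    rcases e1 with e1 | e1 <;> rcases e2 with e2 | e2 <;>
    rcases hsign with ⟨h1, h2⟩ | ⟨h1, h2⟩ <;> linarith

/-- The order on the boundary intervals is the limit of the order on the lines nearby; injectivity
makes the limit inequality strict. -/
theorem exists_order_sign' (l : Λ) : ∃ ε, ∀ p p' : Total S,
    p.1 = l → p'.1 = l → p.y = p'.y → p.x < p'.x → 0 < sgn ε * ((k p').x - (k p).x) := by
  obtain ⟨ε, hε⟩ := hk.exists_order_sign l
  refine ⟨ε, ?_⟩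
  rintro p p' rfl hl hy hlt
  have hc : Continuous fun p => (k p).x := continuous_x.comp k.continuous
  have h1 : 0 ≤ sgn ε * ((k p').x - (k p).x) := by
    obtain ⟨f, hf, hft, hne⟩ := exists_tendsto_vertical p
    obtain ⟨f', hf', hft', hne'⟩ := exists_tendsto_vertical p'
    rw [← hy, hl] at hft'
    refine ge_of_tendsto ((((hc.tendsto p').comp hft').sub ((hc.tendsto p).comp hft)).const_mul
      (sgn ε)) ?_
    filter_upwards [self_mem_nhdsWithin] with r hr
    rw [Function.comp_apply, Function.comp_apply, hf r hr, hf' r (hl ▸ hr)]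
    exact (hε (mkInt p.1 p.x r hr) (mkInt p'.1 p'.x r (hl ▸ hr)) hr (mkInt_mem ..) rfl hl rfl hlt).le
  refine lt_of_le_of_ne h1 fun h => ?_
  have hs : sgn ε ≠ 0 := fun h => by simpa [h] using sgn_mul_self ε
  have h2 : (k p').x = (k p).x := sub_eq_zero.1 ((mul_eq_zero.1 h.symm).resolve_left hs)
  have h3 := k.injective (ext_iff'.2 ⟨vertex hl, h2, (hk.row' hl.symm hy).symm⟩)
  exact hlt.ne' (congrArg x h3)

theorem exists_edge (hS : ∀ l, (S l).IsModel) (e : HalfEdge S) :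
    ∃ f : HalfEdge S, ∀ p ∈ e.toSet, k p ∈ f.toSet := by
  have hni : ∀ u, k (e.pt hS u) ∉ Total.interior S := fun u h =>
    HalfEdge.notMem_interior (e.pt_mem hS u) ((hk.mem_interior _).1 h)
  obtain ⟨f, hf⟩ := HalfEdge.exists_mem_toSet (hni ⟨1 / 2, by norm_num, by norm_num⟩)
  refine ⟨f, fun p hp => ?_⟩
  obtain ⟨u, rfl⟩ := e.exists_pt_eq hS hp
  have : PreconnectedSpace HalfEdge.UnitIoo := Subtype.preconnectedSpace isPreconnected_Ioo
  exact HalfEdge.mem_toSet_of_preconnected hS (k.continuous.comp (e.continuous_pt hS)) hni hf u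

end IsRowPreserving

end Family

/-! ### The graph automorphism induced by a foliated homeomorphism -/

namespace StripedAtlas

variable {Z : Type u} [TopologicalSpace Z] {A : StripedAtlas.{u, v, w} Z}

/-- The map `k` of the strips acts on strips, boundary intervals and orientations as the
automorphism `a` of the graph does. -/
structure Induces (k : Total A.S → Total A.S) (a : A.graph.Aut) : Prop where
  vertex : ∀ p, (k p).1 = a.ν p.1
  mem_interior : ∀ p, k p ∈ Total.interior A.S ↔ p ∈ Total.interior A.S
  row : ∀ p p', p.1 = p'.1 → p.y = p'.y → (k p).y = (k p').y
  height : ∀ p p', p.1 = p'.1 → p.y < p'.y → 0 < sgn (a.tori p.1) * ((k p').y - (k p).y)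
  order : ∀ p p', p.1 = p'.1 → p.y = p'.y → p.x < p'.x →
    0 < sgn (a.lori p.1) * ((k p').x - (k p).x)
  edge : ∀ (e : HalfEdge A.S), ∀ p ∈ e.toSet, k p ∈ HalfEdge.toSet (a.η e)

theorem _root_.Striped.HalfEdge.toSet_nonempty {Λ : Type v} {S : Λ → Strip} (e : HalfEdge S) :
    e.toSet.Nonempty := by
  obtain ⟨x, hx⟩ := e.nonempty
  exact ⟨_, ⟨x, hx⟩, rfl⟩

theorem _root_.Striped.Total.exists_above_base {Λ : Type v} {S : Λ → Strip} (l : Λ) :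
    ∃ p : Total S, p.1 = l ∧ (Total.base S l).y < p.y := by
  obtain ⟨t, ht, ht'⟩ := exists_between (Total.mid_mem (S := S) l).2
  exact ⟨Total.mkInt l 0 t ⟨(Total.mid_mem l).1.trans ht, ht'⟩, rfl, ht⟩

theorem _root_.Striped.Total.exists_right_of_base {Λ : Type v} {S : Λ → Strip} (l : Λ) :
    ∃ p : Total S, p.1 = l ∧ (Total.base S l).y = p.y ∧ (Total.base S l).x < p.x :=
  ⟨Total.mkInt l 1 _ (Total.mid_mem l), rfl, rfl, zero_lt_one⟩

theorem Induces.unique {k : Total A.S → Total A.S} {a a' : A.graph.Aut} (h : Induces k a)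
    (h' : Induces k a') : a = a' := by
  apply StripedGraph.Aut.ext
  · ext l
    exact (h.vertex (Total.base A.S l)).symm.trans (h'.vertex (Total.base A.S l))
  · ext e
    obtain ⟨p, hp⟩ := HalfEdge.toSet_nonempty (S := A.S) e
    exact HalfEdge.eq_of_mem_toSet (h.edge e p hp) (h'.edge e p hp)
  · ext1 l
    obtain ⟨p, h1, h2, h3⟩ := Total.exists_right_of_base (S := A.S) l
    exact eq_of_sgn_mul_pos (h.order _ p h1.symm h2 h3) (h'.order _ p h1.symm h2 h3)
  · ext1 l
    obtain ⟨p, h1, h2⟩ := Total.exists_above_base (S := A.S) l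
    exact eq_of_sgn_mul_pos (h.height _ p h1.symm h2) (h'.height _ p h1.symm h2)

theorem Induces.id : Induces (A := A) (fun p => p) 1 where
  vertex _ := rfl
  mem_interior _ := Iff.rfl
  row _ _ _ h := h
  height p p' _ h := by
    change 0 < sgn 1 * (p'.y - p.y)
    simpa using h
  order p p' _ _ h := by
    change 0 < sgn 1 * (p'.x - p.x)
    simpa using h
  edge _ _ h := h

theorem Induces.comp {k k' : Total A.S → Total A.S} {a a' : A.graph.Aut} (h' : Induces k' a')
    (h : Induces k a) : Induces (fun p => k' (k p)) (a' * a) where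
  vertex p := by rw [h'.vertex, h.vertex]; rfl
  mem_interior p := by rw [h'.mem_interior, h.mem_interior]
  row p p' hv hy := h'.row _ _ (by rw [h.vertex, h.vertex, hv]) (h.row p p' hv hy)
  height p p' hv hy := by
    change 0 < sgn (a'.tori (a.ν p.1) * a.tori p.1) * _
    have hkv : (k p).1 = (k p').1 := by rw [h.vertex, h.vertex, hv]
    have h1 := h.height p p' hv hy
    rw [← h.vertex, sgn_mul]
    rcases Int.units_eq_one_or (a.tori p.1) with h2 | h2 <;> rw [h2] at h1 ⊢
    · have := h'.height _ _ hkv (by simpa using h1)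
      simpa using this
    · have := h'.height _ _ hkv.symm (by simpa using h1)
      rw [← hkv] at this
      simp only [sgn_neg_one]
      linarith
  order p p' hv hy hx := by
    change 0 < sgn (a'.lori (a.ν p.1) * a.lori p.1) * _
    have hkv : (k p).1 = (k p').1 := by rw [h.vertex, h.vertex, hv]
    have hky := h.row p p' hv hy
    have h1 := h.order p p' hv hy hx
    rw [← h.vertex, sgn_mul]
    rcases Int.units_eq_one_or (a.lori p.1) with h2 | h2 <;> rw [h2] at h1 ⊢
    · have := h'.order _ _ hkv hky (by simpa using h1)
      simpa using this
    · have := h'.order _ _ hkv.symm hky.symm (by simpa using h1)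
      rw [← hkv] at this
      simp only [sgn_neg_one]
      linarith
  edge e p hp := h'.edge _ _ (h.edge e p hp)

theorem Induces.isRowPreserving {k : Total A.S ≃ₜ Total A.S} {a : A.graph.Aut} (h : Induces k a) :
    IsRowPreserving k where
  mem_interior := h.mem_interior
  row p _ p' _ hv hy := h.row p p' hv hy
  row_symm p _ p' _ hv hy := by
    have hv' : (k.symm p).1 = (k.symm p').1 := by
      apply (Equiv.injective a.ν)
      rw [← h.vertex, ← h.vertex, k.apply_symm_apply, k.apply_symm_apply, hv]
    by_contra hne
    rcases lt_or_gt_of_ne hne with h1 | h1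
    · have := h.height _ _ hv' h1
      rw [k.apply_symm_apply, k.apply_symm_apply, hy, sub_self, mul_zero] at this
      exact this.false
    · have := h.height _ _ hv'.symm h1
      rw [k.apply_symm_apply, k.apply_symm_apply, hy, sub_self, mul_zero] at this
      exact this.false

variable (hA : A.IsAffine)
include hA

/-- Row preserving homeomorphisms of the strips that preserve the fibres of `q` induce automorphisms
of the graph. -/
theorem exists_induces {k : Total A.S ≃ₜ Total A.S} (hk : IsRowPreserving k)
    (hq : ∀ p p', A.q p = A.q p' ↔ A.q (k p) = A.q (k p')) : ∃ a, Induces k a := by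
  have vtx : ∀ {k : Total A.S ≃ₜ Total A.S} {p p' : Total A.S}, p.1 = p'.1 → (k p).1 = (k p').1 :=
    IsRowPreserving.vertex
  choose τ hτ using hk.exists_height_sign'
  choose ε hε using hk.exists_order_sign'
  choose η hη using hk.exists_edge hA.1
  choose η' hη' using hk.symm.exists_edge hA.1
  set ν : Equiv.Perm A.Λ :=
    { toFun := fun l => (k (Total.base A.S l)).1
      invFun := fun l => (k.symm (Total.base A.S l)).1
      left_inv := fun l => by
        have h : (k.symm (Total.base A.S (k (Total.base A.S l)).1)).1 =
          (k.symm (k (Total.base A.S l))).1 := vtx rfl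
        exact h.trans (congrArg Sigma.fst (k.symm_apply_apply _))
      right_inv := fun l => by
        have h : (k (Total.base A.S (k.symm (Total.base A.S l)).1)).1 =
          (k (k.symm (Total.base A.S l))).1 := vtx rfl
        exact h.trans (congrArg Sigma.fst (k.apply_symm_apply _)) } with hν
  have hνv : ∀ p : Total A.S, (k p).1 = ν p.1 := fun p => vtx rfl
  have hηη' : ∀ e, η' (η e) = e := fun e => by
    obtain ⟨p, hp⟩ := e.toSet_nonempty
    have := hη' _ _ (hη e p hp)
    rw [k.symm_apply_apply] at this
    exact HalfEdge.eq_of_mem_toSet this hp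
  have hη'η : ∀ e, η (η' e) = e := fun e => by
    obtain ⟨p, hp⟩ := e.toSet_nonempty
    have := hη _ _ (hη' e p hp)
    rw [k.apply_symm_apply] at this
    exact HalfEdge.eq_of_mem_toSet this hp
  have hηinj : Function.Injective η := Function.LeftInverse.injective hηη'
  have hηv : ∀ e, (η e).vertex = ν e.vertex := fun e => by
    obtain ⟨p, hp⟩ := e.toSet_nonempty
    rw [← (HalfEdge.mem_toSet.1 (hη e p hp)).1, hνv, (HalfEdge.mem_toSet.1 hp).1]
  -- a side lies above or below the middle line
  have hηs : ∀ e, (η e).side = τ e.vertex * e.side := fun e => by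
    obtain ⟨p, hp⟩ := e.toSet_nonempty
    obtain ⟨h1, h2, -⟩ := HalfEdge.mem_toSet.1 hp
    obtain ⟨h1', h2', -⟩ := HalfEdge.mem_toSet.1 (hη e p hp)
    have hb : (k (Total.base A.S e.vertex)).y ∈
        Ioo (A.S (η e).vertex).lo (A.S (η e).vertex).hi := by
      rw [hηv]
      exact (hk.mem_interior _).2 (Total.base_mem _)
    have h3 := sgn_mul_level_sub_pos _ (η e).side hb
    rw [← h2'] at h3
    refine eq_of_sgn_mul_pos h3 ?_
    have h4 := sgn_mul_level_sub_pos (A.S e.vertex) e.side (Total.mid_mem e.vertex)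
    rw [← h2] at h4
    rw [sgn_mul]
    rcases Int.units_eq_one_or e.side with hs | hs <;> rw [hs] at h4 ⊢
    · simp only [sgn_one, one_mul, mul_one, sub_pos] at h4 ⊢
      exact hτ _ (Total.base A.S e.vertex) p rfl h1 h4
    · simp only [sgn_neg_one, neg_one_mul, neg_sub, sub_pos] at h4
      have := hτ _ p (Total.base A.S e.vertex) h1 rfl h4
      simp only [sgn_neg_one]
      linarith
  -- the order of two boundary intervals can be tested on a point of each of them
  have hbefore : ∀ e f : HalfEdge A.S, e.vertex = f.vertex → e.side = f.side → e.Before f →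
      (ε e.vertex = 1 → (η e).Before (η f)) ∧ (ε e.vertex = -1 → (η f).Before (η e)) := by
    intro e f hv hs hef
    obtain ⟨p, hp⟩ := e.toSet_nonempty
    obtain ⟨p', hp'⟩ := f.toSet_nonempty
    have hpm := HalfEdge.mem_toSet.1 hp
    have hpm' := HalfEdge.mem_toSet.1 hp'
    have hkp := HalfEdge.mem_toSet.1 (hη e p hp)
    have hkp' := HalfEdge.mem_toSet.1 (hη f p' hp')
    have h1 := hε _ p p' hpm.1 (hpm'.1.trans hv.symm) (by rw [hpm.2.1, hpm'.2.1, hv, hs])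
      (hef _ hpm.2.2 _ hpm'.2.2)
    have hne : η e ≠ η f := fun h => e.not_before_self (by
      have := hηinj h; subst this; exact hef)
    have htot := HalfEdge.before_total (e := η e) (f := η f) (by rw [hηv, hηv, hv])
      (by rw [hηs, hηs, hv, hs]) hne
    constructor
    · intro h2
      rw [h2, sgn_one, one_mul, sub_pos] at h1
      exact htot.resolve_right fun h => (h _ hkp'.2.2 _ hkp.2.2).asymm h1
    · intro h2
      rw [h2, sgn_neg_one, neg_one_mul, neg_sub, sub_pos] at h1
      exact htot.resolve_left fun h => (h _ hkp.2.2 _ hkp'.2.2).asymm h1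
  -- glued intervals carry pairs of points with the same image in `Z`, and so do their images
  have hξ1 : ∀ e, A.ξ e ≠ e → A.ξ (η e) = η (A.ξ e) := by
    intro e he
    obtain ⟨u, hu⟩ : ∃ u : HalfEdge.UnitIoo, True := ⟨⟨1 / 2, by norm_num, by norm_num⟩, trivial⟩
    have h1 := (q_pt_eq_iff hA (e := e) (u := u)).2 (Or.inr ⟨he, rfl⟩)
    obtain ⟨v, hv⟩ := (η e).exists_pt_eq hA.1 (hη e _ (e.pt_mem hA.1 u))
    have hm := hη (A.ξ e) _ ((A.ξ e).pt_mem hA.1 (flip (A.σ e) u))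
    rw [hq, ← hv, q_pt_eq_iff hA] at h1
    rcases h1 with h1 | ⟨-, h1⟩
    · rw [h1] at hm
      exact (he (hηinj (HalfEdge.eq_of_mem_toSet hm (HalfEdge.pt_mem hA.1 _ v)))).elim
    · rw [h1] at hm
      exact HalfEdge.eq_of_mem_toSet (HalfEdge.pt_mem hA.1 _ _) hm
  have hξ : ∀ e, A.ξ (η e) = η (A.ξ e) := by
    intro e
    by_cases he : A.ξ e = e
    · rw [he]
      by_contra hne
      obtain ⟨p, hp⟩ := e.toSet_nonempty
      obtain ⟨u, rfl⟩ := e.exists_pt_eq hA.1 hp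
      obtain ⟨v, hv⟩ := (η e).exists_pt_eq hA.1 (hη e _ hp)
      have h1 := (q_pt_eq_iff hA (e := η e) (u := v)).2 (Or.inr ⟨hne, rfl⟩)
      set r := (A.ξ (η e)).pt hA.1 (flip (A.σ (η e)) v) with hr
      rw [hv, ← k.apply_symm_apply r, ← hq, q_pt_eq_iff hA] at h1
      rcases h1 with h1 | h1
      · have h2 : r = (η e).pt hA.1 v := by rw [hv, ← h1, k.apply_symm_apply]
        have h3 : r ∈ (η e).toSet := h2 ▸ HalfEdge.pt_mem hA.1 _ _
        exact hne (HalfEdge.eq_of_mem_toSet (HalfEdge.pt_mem hA.1 _ _) h3)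
      · exact h1.1 he
    · exact hξ1 e he
  have hglue : ∀ e, A.ξ e ≠ e →
      ε e.vertex * A.σ e = A.σ (η e) * ε (A.ξ e).vertex := by
    intro e he
    -- follow two points of `e` and the points of `ξ e` that are glued to them
    set u₁ : HalfEdge.UnitIoo := ⟨1 / 3, by norm_num, by norm_num⟩ with hu₁
    set u₂ : HalfEdge.UnitIoo := ⟨2 / 3, by norm_num, by norm_num⟩ with hu₂
    have key : ∀ u, ∃ v, k (e.pt hA.1 u) = (η e).pt hA.1 v ∧
        k ((A.ξ e).pt hA.1 (flip (A.σ e) u)) = (A.ξ (η e)).pt hA.1 (flip (A.σ (η e)) v) := by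
      intro u
      obtain ⟨v, hv⟩ := (η e).exists_pt_eq hA.1 (hη e _ (e.pt_mem hA.1 u))
      refine ⟨v, hv.symm, ?_⟩
      have h1 := (q_pt_eq_iff hA (e := e) (u := u)).2 (Or.inr ⟨he, rfl⟩)
      rw [hq, ← hv, q_pt_eq_iff hA] at h1
      refine (h1.resolve_left fun h => ?_).2
      have hm := hη (A.ξ e) _ ((A.ξ e).pt_mem hA.1 (flip (A.σ e) u))
      rw [h] at hm
      exact he (hηinj (HalfEdge.eq_of_mem_toSet hm (HalfEdge.pt_mem hA.1 _ v)))
    obtain ⟨v₁, h1, h1'⟩ := key u₁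
    obtain ⟨v₂, h2, h2'⟩ := key u₂
    have hlen : ∀ f : HalfEdge A.S, 0 < f.right - f.left := fun f =>
      sub_pos.2 (f.left_lt_right hA.1)
    -- the order of the two points on `e` and of their images
    have e1 : 0 < sgn (ε e.vertex) * ((v₂ : ℝ) - v₁) := by
      have h := hε e.vertex (e.pt hA.1 u₁) (e.pt hA.1 u₂) rfl rfl rfl (by
        have := hlen e
        simp only [HalfEdge.pt_x, hu₁, hu₂]; nlinarith)
      rw [h1, h2, HalfEdge.pt_x, HalfEdge.pt_x] at h
      have h' : 0 < ((η e).right - (η e).left) * (sgn (ε e.vertex) * ((v₂ : ℝ) - v₁)) := by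
        linarith
      exact (pos_iff_pos_of_mul_pos h').1 (hlen _)
    have e2 : 0 < sgn (ε (A.ξ e).vertex) * (sgn (A.σ e) * (sgn (A.σ (η e)) * ((v₂ : ℝ) - v₁))) := by
      have hord : ∀ w₁ w₂ : HalfEdge.UnitIoo, (w₁ : ℝ) < w₂ → ∀ w₁' w₂' : HalfEdge.UnitIoo,
          k ((A.ξ e).pt hA.1 w₁) = (A.ξ (η e)).pt hA.1 w₁' →
          k ((A.ξ e).pt hA.1 w₂) = (A.ξ (η e)).pt hA.1 w₂' →
          0 < sgn (ε (A.ξ e).vertex) * ((w₂' : ℝ) - w₁') := by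
        intro w₁ w₂ hlt w₁' w₂' hw₁ hw₂
        have h := hε (A.ξ e).vertex ((A.ξ e).pt hA.1 w₁) ((A.ξ e).pt hA.1 w₂) rfl rfl rfl (by
          have := hlen (A.ξ e)
          simp only [HalfEdge.pt_x]; nlinarith)
        rw [hw₁, hw₂, HalfEdge.pt_x, HalfEdge.pt_x] at h
        have h' : 0 < ((A.ξ (η e)).right - (A.ξ (η e)).left) *
            (sgn (ε (A.ξ e).vertex) * ((w₂' : ℝ) - w₁')) := by
          linarith
        exact (pos_iff_pos_of_mul_pos h').1 (hlen _)
      have hsub : sgn (A.σ (η e)) * ((v₂ : ℝ) - v₁) =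
          (flip (A.σ (η e)) v₂ : ℝ) - (flip (A.σ (η e)) v₁ : ℝ) := by
        rw [coe_flip, coe_flip, sgn]; ring
      rw [hsub]
      rcases Int.units_eq_one_or (A.σ e) with hσ | hσ <;> rw [hσ] at h1' h2' ⊢
      · have := hord _ _ (show (flip 1 u₁ : ℝ) < flip 1 u₂ by
          simp only [flip_one, hu₁, hu₂]; norm_num) _ _ h1' h2'
        simpa using this
      · have := hord _ _ (show (flip (-1) u₂ : ℝ) < flip (-1) u₁ by
          simp only [flip_neg_one, hu₁, hu₂]; norm_num) _ _ h2' h1'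
        simp only [sgn_neg_one]
        linarith
    rw [← mul_assoc, ← sgn_mul, ← mul_assoc, ← sgn_mul] at e2
    rw [eq_of_sgn_mul_pos e1 e2]
    rcases Int.units_eq_one_or (A.σ e) with h | h <;> rw [h] <;> simp [mul_comm]
  refine ⟨{ ν := ν, η := ⟨η, η', hηη', hη'η⟩, lori := ε, tori := τ, image_d := ?_,
            increasing := ?_, decreasing := ?_, comm_ξ := hξ, gluing := hglue }, ?_⟩
  · intro l s
    ext f
    constructor
    · rintro ⟨e, ⟨rfl, rfl⟩, rfl⟩
      exact ⟨hηv e, hηs e⟩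
    · rintro ⟨h1, h2⟩
      refine ⟨η' f, ?_, hη'η f⟩
      have h3 : f.vertex = ν (η' f).vertex :=
        (congrArg HalfEdge.vertex (hη'η f)).symm.trans (hηv (η' f))
      have h4 : f.side = τ (η' f).vertex * (η' f).side :=
        (congrArg HalfEdge.side (hη'η f)).symm.trans (hηs (η' f))
      have h5 : (η' f).vertex = l := ν.injective (h3.symm.trans h1)
      refine ⟨h5, ?_⟩
      rw [h5] at h4
      exact mul_left_cancel (h4.symm.trans h2)
  · rintro l s hl e ⟨rfl, rfl⟩ f ⟨hf, hf'⟩ hef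
    exact (hbefore e f hf.symm hf'.symm hef).1 hl
  · rintro l s hl e ⟨rfl, rfl⟩ f ⟨hf, hf'⟩ hef
    exact (hbefore e f hf.symm hf'.symm hef).2 hl
  · exact
    { vertex := hνv
      mem_interior := hk.mem_interior
      row := fun p p' => hk.row'
      height := fun p p' hv hy => hτ p.1 p p' rfl hv.symm hy
      order := fun p p' hv hy hx => hε p.1 p p' rfl hv.symm hy hx
      edge := hη }

end StripedAtlas

/-! ### Foliated homeomorphisms and the special leaves -/

section Special

variable {Z : Type u} [TopologicalSpace Z] {Δ : Set (Set Z)} {h : Z ≃ₜ Z}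

theorem IsFoliated.symm {Z' : Type v} [TopologicalSpace Z'] {Δ' : Set (Set Z')} {h : Z ≃ₜ Z'}
    (hh : IsFoliated Δ Δ' h) : IsFoliated Δ' Δ h.symm := ⟨hh.2, hh.1⟩

theorem IsFoliated.mem_hcl (hh : IsFoliated Δ Δ h) {ω : Set Z} {z : Z} (hz : z ∈ hcl Δ ω) :
    h z ∈ hcl Δ (h '' ω) := by
  simp only [hcl, mem_iInter₂] at hz ⊢
  rintro U ⟨⟨T, hT, rfl⟩, hU⟩
  have h1 : h ⁻¹' ⋃₀ T = ⋃₀ ((fun ω => h.symm '' ω) '' T) := by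
    ext x
    simp only [mem_preimage, mem_sUnion, mem_image, exists_exists_and_eq_and,
      Homeomorph.image_symm]
  have h2 := hz (h ⁻¹' ⋃₀ T) ⟨⟨_, ?_, h1⟩, ?_⟩
  · rwa [← h.preimage_closure] at h2
  · rintro _ ⟨ω', hω', rfl⟩
    exact hh.2 _ (hT hω')
  · rw [mem_nhdsSet_iff_forall] at hU ⊢
    exact fun x hx => h.continuous.continuousAt.preimage_mem_nhds (hU _ (mem_image_of_mem _ hx))

theorem IsFoliated.image_hcl (hh : IsFoliated Δ Δ h) (ω : Set Z) :
    h '' hcl Δ ω = hcl Δ (h '' ω) := by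
  refine Subset.antisymm ?_ fun z hz => ?_
  · rintro _ ⟨z, hz, rfl⟩
    exact hh.mem_hcl hz
  · have := hh.symm.mem_hcl hz
    rw [← image_comp, Homeomorph.symm_comp_self, image_id] at this
    exact ⟨_, this, h.apply_symm_apply z⟩

theorem IsFoliated.mem_special (hh : IsFoliated Δ Δ h) {z : Z} (hz : z ∈ ⋃₀ specialLeaves Δ) :
    h z ∈ ⋃₀ specialLeaves Δ := by
  obtain ⟨ω, ⟨hω, hne⟩, hz⟩ := hz
  refine ⟨h '' ω, ⟨hh.1 _ hω, fun he => hne ?_⟩, mem_image_of_mem _ hz⟩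
  rw [← hh.image_hcl] at he
  exact h.injective.image_injective he

theorem mem_surfaceBoundary (h : Z ≃ₜ Z) {z : Z} (hz : z ∈ surfaceBoundary Z) :
    h z ∈ surfaceBoundary Z := by
  rintro ⟨U, hU, hzU, ⟨e⟩⟩
  exact hz ⟨h ⁻¹' U, hU.preimage h.continuous, hzU, ⟨(h.sets rfl).trans e⟩⟩

end Special

namespace StripedAtlas

variable {Z : Type u} [TopologicalSpace Z] {A : StripedAtlas.{u, v, w} Z}

/-- On a surface with a reduced atlas, foliated homeomorphisms preserve the union of the boundary
intervals. -/
theorem IsReduced.mem_boundaryImage_iff (hr : A.IsReduced) {h : Z ≃ₜ Z}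
    (hh : IsFoliated A.foliation A.foliation h) (z : Z) :
    h z ∈ A.boundaryImage ↔ z ∈ A.boundaryImage := by
  have key : ∀ h : Z ≃ₜ Z, IsFoliated A.foliation A.foliation h → ∀ z, z ∈ A.boundaryImage →
      h z ∈ A.boundaryImage := by
    intro h hh z hz
    rw [hr] at hz ⊢
    exact hz.imp hh.mem_special (mem_surfaceBoundary h)
  refine ⟨fun hz => ?_, key h hh z⟩
  have := key h.symm hh.symm _ hz
  rwa [h.symm_apply_apply] at this

variable (hA : A.IsAffine)
include hA

/-- Lifts of foliated homeomorphisms preserve rows. -/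
theorem row_of_lift {h : Z ≃ₜ Z} (hh : IsFoliated A.foliation A.foliation h)
    (hb : ∀ z, h z ∈ A.boundaryImage ↔ z ∈ A.boundaryImage) {k : Total A.S → Total A.S}
    (hk : ∀ p, A.q (k p) = h (A.q p)) {p p' : Total A.S} (hp : p ∈ Total.interior A.S)
    (hp' : p' ∈ Total.interior A.S) (hv : p.1 = p'.1) (hy : p.y = p'.y) :
    (k p).y = (k p').y := by
  have hL : {r : Total A.S | r.1 = p.1 ∧ r.y = p.y} ∈ A.stripLeaves :=
    Or.inl ⟨p.1, p.y, hp, rfl⟩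
  obtain ⟨L', hL', hLL⟩ := hh.1 _ (mem_image_of_mem _ hL)
  have hi := mem_interior_iff_of_lift hA hb hk
  have hmem : ∀ r ∈ Total.interior A.S, r.1 = p.1 → r.y = p.y → k r ∈ L' := by
    intro r hr h1 h2
    have h3 : h (A.q r) ∈ A.q '' L' := by
      dsimp only at hLL
      rw [hLL]
      exact mem_image_of_mem _ (mem_image_of_mem _ ⟨h1, h2⟩)
    obtain ⟨r', hr', h4⟩ := h3
    rw [← hk, eq_comm, q_eq_iff_of_mem_interior hA ((hi r).2 hr)] at h4
    exact h4 ▸ hr'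
  have m1 := hmem p hp rfl rfl
  have m2 := hmem p' hp' hv.symm hy.symm
  rcases hL' with ⟨l', t', -, rfl⟩ | ⟨e, rfl⟩
  · exact m1.2.trans m2.2.symm
  · exact (HalfEdge.notMem_interior m1 ((hi p).2 hp)).elim

theorem isRowPreserving_lift {h : Z ≃ₜ Z} (hh : IsFoliated A.foliation A.foliation h)
    (hb : ∀ z, h z ∈ A.boundaryImage ↔ z ∈ A.boundaryImage) :
    IsRowPreserving (lift hA h hb) where
  mem_interior := mem_interior_iff_of_lift hA hb (q_lift hA h hb)
  row _ hp _ hp' := row_of_lift hA hh hb (q_lift hA h hb) hp hp'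
  row_symm _ hp _ hp' := row_of_lift hA hh.symm
    (fun z => by rw [← hb, h.apply_symm_apply])
    (fun p => by rw [← h.symm_apply_apply (A.q ((lift hA h hb).symm p)), ← q_lift hA h hb,
      Homeomorph.apply_symm_apply]) hp hp'

omit hA in
theorem Induces.image_toSet {k : Total A.S ≃ₜ Total A.S} {a : A.graph.Aut} (h : Induces k a)
    (e : HalfEdge A.S) : k '' e.toSet = HalfEdge.toSet (a.η e) := by
  refine Subset.antisymm ?_ fun p hp => ?_
  · rintro _ ⟨p, hp, rfl⟩
    exact h.edge e p hp
  · refine ⟨k.symm p, ?_, k.apply_symm_apply p⟩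
    have h1 : k.symm p ∉ Total.interior A.S := by
      rw [← h.mem_interior, k.apply_symm_apply]
      exact HalfEdge.notMem_interior hp
    obtain ⟨f, hf⟩ := HalfEdge.exists_mem_toSet h1
    have h2 := h.edge f _ hf
    rw [k.apply_symm_apply] at h2
    have h3 : a.η f = a.η e := HalfEdge.eq_of_mem_toSet h2 hp
    rwa [a.η.injective h3] at hf

omit hA in
theorem Induces.image_mem_stripLeaves {k : Total A.S ≃ₜ Total A.S} {a : A.graph.Aut}
    (h : Induces k a) {L : Set (Total A.S)} (hL : L ∈ A.stripLeaves) : k '' L ∈ A.stripLeaves := by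
  rcases hL with ⟨l, t, ht, rfl⟩ | ⟨e, rfl⟩
  · left
    have hb : k (Total.mkInt l 0 t ht) ∈ Total.interior A.S := (h.mem_interior _).2 ht
    refine ⟨_, _, hb, ?_⟩
    ext p
    constructor
    · rintro ⟨p, ⟨h1, h2⟩, rfl⟩
      exact ⟨IsRowPreserving.vertex h1, h.row _ _ h1 h2⟩
    · rintro ⟨h1, h2⟩
      have h1' : p.1 = (k (Total.mkInt l 0 t ht)).1 := h1
      have h2' : p.y = (k (Total.mkInt l 0 t ht)).y := h2
      have hp : p ∈ Total.interior A.S := by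
        change p.y ∈ Ioo _ _
        rw [h1', h2']
        exact hb
      refine ⟨k.symm p, ⟨?_, ?_⟩, k.apply_symm_apply p⟩
      · have := IsRowPreserving.vertex (k := k.symm) h1'
        rw [k.symm_apply_apply] at this
        exact this
      · have := h.isRowPreserving.row_symm p hp _ hb h1' h2'
        rw [k.symm_apply_apply] at this
        exact this
  · right
    exact ⟨a.η e, (h.image_toSet e).symm⟩

theorem Induces.symm {k : Total A.S ≃ₜ Total A.S} {a : A.graph.Aut} (h : Induces k a)
    (hq : ∀ p p', A.q p = A.q p' ↔ A.q (k p) = A.q (k p')) : Induces k.symm a⁻¹ := by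
  obtain ⟨a', ha'⟩ := exists_induces hA h.isRowPreserving.symm fun p p' => by
    rw [hq (k.symm p), k.apply_symm_apply, k.apply_symm_apply]
  have h1 : Induces (A := A) (fun p => p) (a' * a) := by
    convert ha'.comp h using 2 with p
    exact (k.symm_apply_apply p).symm
  rwa [eq_inv_of_mul_eq_one_left (h1.unique Induces.id)] at ha'

theorem isFoliated_of_induces {k : Total A.S ≃ₜ Total A.S} {a : A.graph.Aut} (h : Induces k a)
    {g : Z ≃ₜ Z} (hg : ∀ p, g (A.q p) = A.q (k p)) : IsFoliated A.foliation A.foliation g := by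
  have hq : ∀ p p', A.q p = A.q p' ↔ A.q (k p) = A.q (k p') := fun p p' => by
    rw [← hg, ← hg, g.injective.eq_iff]
  constructor
  · rintro _ ⟨L, hL, rfl⟩
    refine ⟨k '' L, h.image_mem_stripLeaves hL, ?_⟩
    dsimp only
    rw [← image_comp, ← image_comp]
    exact image_congr fun p _ => (hg p).symm
  · rintro _ ⟨L, hL, rfl⟩
    refine ⟨k.symm '' L, (h.symm hA hq).image_mem_stripLeaves hL, ?_⟩
    dsimp only
    rw [← image_comp, ← image_comp]
    refine image_congr fun p _ => ?_
    rw [Function.comp_apply, Function.comp_apply, Homeomorph.eq_symm_apply, hg,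
      k.apply_symm_apply]

end StripedAtlas

/-! ### Straight-line homotopies on the strips -/

section Family

variable {Λ : Type v} {S : Λ → Strip}

/-- Monotonicity criterion for a continuous bijection between disjoint unions of strips to be a
homeomorphism. -/
theorem isHomeomorph_sigmaMap (ν : Equiv.Perm Λ) (F : ∀ l, (S l).carrier → (S (ν l)).carrier)
    (hc : Continuous (Sigma.map ν F : Total S → Total S))
    (hb : Function.Bijective (Sigma.map ν F : Total S → Total S)) (τ ε : Λ → ℤˣ)
    (row : ∀ p p' : Total S, p.1 = p'.1 → p.y = p'.y →
      Total.y (S := S) (Sigma.map ν F p) = Total.y (S := S) (Sigma.map ν F p'))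
    (height : ∀ p p' : Total S, p.1 = p'.1 → p.y < p'.y →
      0 < sgn (τ p.1) * (Total.y (S := S) (Sigma.map ν F p') - Total.y (S := S) (Sigma.map ν F p)))
    (order : ∀ p p' : Total S, p.1 = p'.1 → p.y = p'.y → p.x < p'.x →
      0 < sgn (ε p.1) *
        (Total.x (S := S) (Sigma.map ν F p') - Total.x (S := S) (Sigma.map ν F p))) :
    IsHomeomorph (Sigma.map ν F : Total S → Total S) := by
  refine ⟨hc, isOpenMap_sigma_map.2 fun l => ?_, hb⟩
  have hinj : Function.Injective (F l) := fun w w' h => by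
    have h1 : (Sigma.map ν F ⟨l, w⟩ : Total S) = Sigma.map ν F ⟨l, w'⟩ := by
      simp only [Sigma.map, h]
    exact eq_of_heq (Sigma.mk.inj (hb.1 h1)).2
  have hsurj : Function.Surjective (F l) := fun w' => by
    obtain ⟨⟨l', w⟩, h⟩ := hb.2 ⟨ν l, w'⟩
    have h1 : l' = l := ν.injective (congrArg Sigma.fst h)
    subst h1
    exact ⟨w, eq_of_heq (Sigma.mk.inj h).2⟩
  refine (isHomeomorph_of_strictMono ?_ ?_ (F l) (continuous_sigma_map.1 hc l) ⟨hinj, hsurj⟩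
    (sgn (τ l)) (sgn (ε l)) (fun p p' h => row ⟨l, p⟩ ⟨l, p'⟩ rfl h)
    (fun p p' h => height ⟨l, p⟩ ⟨l, p'⟩ rfl h)
    fun p p' h h' => order ⟨l, p⟩ ⟨l, p'⟩ rfl h h').isOpenMap
  · intro w hw
    obtain ⟨O, hO, h⟩ := (S l).relOpen
    filter_upwards [hO.mem_nhds (h.subset hw).1] with v hv hx
    obtain ⟨x, hx⟩ := hx
    exact h.symm.subset ⟨hv, mem_univ _, ((S l).subset_closed hx).2⟩
  · refine ⟨fun y₁ h₁ y₂ h₂ y hy => ?_⟩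
    rcases hy.1.eq_or_lt with rfl | hlt
    · exact h₁
    rcases hy.2.eq_or_lt with rfl | hlt'
    · exact h₂
    obtain ⟨x₁, h₁⟩ := h₁
    obtain ⟨x₂, h₂⟩ := h₂
    exact ⟨0, (S l).interior_subset ⟨mem_univ _, ((S l).subset_closed h₁).2.1.trans_lt hlt,
      hlt'.trans_le ((S l).subset_closed h₂).2.2⟩⟩

end Family

theorem convexComb_mem_Ioo {a b x y s : ℝ} (hx : x ∈ Ioo a b) (hy : y ∈ Ioo a b) (h0 : 0 ≤ s)
    (h1 : s ≤ 1) : (1 - s) * x + s * y ∈ Ioo a b := by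
  have := (convex_Ioo a b) hx hy (sub_nonneg.2 h1) h0 (by ring)
  simpa using this

theorem convexComb_lt {a b a' b' s : ℝ} (h0 : 0 ≤ s) (h1 : s ≤ 1) (h : a < b) (h' : a' < b') :
    (1 - s) * a + s * a' < (1 - s) * b + s * b' := by
  rcases h1.eq_or_lt with rfl | h1
  · simpa using h'
  · have := mul_lt_mul_of_pos_left h (sub_pos.2 h1)
    have := mul_le_mul_of_nonneg_left h'.le h0
    linarith

namespace StripedAtlas

variable {Z : Type u} [TopologicalSpace Z] {A : StripedAtlas.{u, v, w} Z}

theorem Induces.vertex_one {k : Total A.S → Total A.S} (h : Induces k 1) (p : Total A.S) :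
    (k p).1 = p.1 := h.vertex p

theorem Induces.height_one {k : Total A.S → Total A.S} (h : Induces k 1) {p p' : Total A.S}
    (hv : p.1 = p'.1) (hy : p.y < p'.y) : (k p).y < (k p').y := by
  have h1 : 0 < sgn 1 * ((k p').y - (k p).y) := h.height p p' hv hy
  simpa using h1

theorem Induces.order_one {k : Total A.S → Total A.S} (h : Induces k 1) {p p' : Total A.S}
    (hv : p.1 = p'.1) (hy : p.y = p'.y) (hx : p.x < p'.x) : (k p).x < (k p').x := by
  have h1 : 0 < sgn 1 * ((k p').x - (k p).x) := h.order p p' hv hy hx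
  simpa using h1

theorem Induces.edge_one {k : Total A.S → Total A.S} (h : Induces k 1) {e : HalfEdge A.S}
    {p : Total A.S} (hp : p ∈ e.toSet) : k p ∈ e.toSet := h.edge e p hp

variable (hA : A.IsAffine)
include hA

theorem convexComb_mem {k : Total A.S → Total A.S} (h : Induces k 1) (s : unitInterval)
    (p : Total A.S) : ((1 - (s : ℝ)) * (k p).x + s * p.x, (1 - (s : ℝ)) * (k p).y + s * p.y) ∈
      (A.S p.1).carrier := by
  by_cases hp : p ∈ Total.interior A.S
  · have hk : (k p).y ∈ Ioo (A.S p.1).lo (A.S p.1).hi := by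
      rw [← h.vertex_one p]; exact (h.mem_interior p).2 hp
    exact (A.S p.1).interior_subset ⟨mem_univ _, convexComb_mem_Ioo hk hp s.2.1 s.2.2⟩
  · obtain ⟨e, he⟩ := HalfEdge.exists_mem_toSet hp
    obtain ⟨h1, h2, h3⟩ := HalfEdge.mem_toSet.1 he
    obtain ⟨-, h2', h3'⟩ := HalfEdge.mem_toSet.1 (h.edge_one he)
    rw [h2, h2', ← add_mul, sub_add_cancel, one_mul, h1]
    apply e.interval_subset_sideSet
    rw [e.interval_eq hA.1] at h3 h3' ⊢
    exact convexComb_mem_Ioo h3' h3 s.2.1 s.2.2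

/-- The convex combination, on each strip, of a map that induces the identity of the graph with the
identity. -/
def convexComb {k : Total A.S → Total A.S} (h : Induces k 1) (s : unitInterval) :
    Total A.S → Total A.S :=
  Sigma.map (Equiv.refl A.Λ) fun l w => ⟨_, convexComb_mem hA h s ⟨l, w⟩⟩

section

variable {k : Total A.S → Total A.S} (h : Induces k 1) (s : unitInterval)

theorem convexComb_x (p : Total A.S) :
    (convexComb hA h s p).x = (1 - (s : ℝ)) * (k p).x + s * p.x := rfl

theorem convexComb_y (p : Total A.S) :
    (convexComb hA h s p).y = (1 - (s : ℝ)) * (k p).y + s * p.y := rfl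

theorem convexComb_pt {e : HalfEdge A.S} {u v : HalfEdge.UnitIoo}
    (huv : k (e.pt hA.1 u) = e.pt hA.1 v) : convexComb hA h s (e.pt hA.1 u) =
      e.pt hA.1 ⟨_, convexComb_mem_Ioo v.2 u.2 s.2.1 s.2.2⟩ := by
  refine Total.ext_iff'.2 ⟨rfl, ?_, ?_⟩
  · rw [convexComb_x, huv]
    simp only [HalfEdge.pt_x]
    ring
  · rw [convexComb_y, huv]
    simp only [HalfEdge.pt_y]
    ring

theorem convexComb_mem_interior (p : Total A.S) :
    convexComb hA h s p ∈ Total.interior A.S ↔ p ∈ Total.interior A.S := by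
  constructor
  · intro hc
    by_contra hp
    obtain ⟨e, he⟩ := HalfEdge.exists_mem_toSet hp
    obtain ⟨u, rfl⟩ := e.exists_pt_eq hA.1 he
    obtain ⟨v, hv⟩ := e.exists_pt_eq hA.1 (h.edge_one he)
    rw [convexComb_pt hA h s hv.symm] at hc
    exact HalfEdge.notMem_interior (HalfEdge.pt_mem _ _ _) hc
  · intro hp
    have hk : (k p).y ∈ Ioo (A.S p.1).lo (A.S p.1).hi := by
      rw [← h.vertex_one p]; exact (h.mem_interior p).2 hp
    exact convexComb_mem_Ioo hk hp s.2.1 s.2.2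

theorem induces_convexComb : Induces (convexComb hA h s) 1 where
  vertex p := rfl
  mem_interior := convexComb_mem_interior hA h s
  row p p' hv hy := by rw [convexComb_y, convexComb_y, h.row p p' hv hy, hy]
  height p p' hv hy := by
    change 0 < sgn 1 * _
    rw [convexComb_y, convexComb_y, sgn_one, one_mul, sub_pos]
    exact convexComb_lt s.2.1 s.2.2 (h.height_one hv hy) hy
  order p p' hv hy hx := by
    change 0 < sgn 1 * _
    rw [convexComb_x, convexComb_x, sgn_one, one_mul, sub_pos]
    exact convexComb_lt s.2.1 s.2.2 (h.order_one hv hy hx) hx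
  edge e p hp := by
    obtain ⟨u, rfl⟩ := e.exists_pt_eq hA.1 hp
    obtain ⟨v, hv⟩ := e.exists_pt_eq hA.1 (h.edge_one hp)
    rw [convexComb_pt hA h s hv.symm]
    exact HalfEdge.pt_mem _ _ _

theorem convexComb_injective : Function.Injective (convexComb hA h s) := by
  have hi := induces_convexComb hA h s
  intro p p' hpp
  have hv : p.1 = p'.1 :=
    (congrArg Sigma.fst hpp : (convexComb hA h s p).1 = (convexComb hA h s p').1)
  have hx := congrArg Total.x hpp
  have hy := congrArg Total.y hpp
  have hyy : p.y = p'.y := by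
    rcases lt_trichotomy p.y p'.y with h1 | h1 | h1
    · exact ((hi.height_one hv h1).ne hy).elim
    · exact h1
    · exact ((hi.height_one hv.symm h1).ne' hy).elim
  refine Total.ext_iff'.2 ⟨hv, ?_, hyy⟩
  rcases lt_trichotomy p.x p'.x with h1 | h1 | h1
  · exact ((hi.order_one hv hyy h1).ne hx).elim
  · exact h1
  · exact ((hi.order_one hv.symm hyy.symm h1).ne' hx).elim

/-- Convex combinations preserve the fibres of `q`, because the gluing maps are affine. -/
theorem q_convexComb_iff (hq : ∀ p p', A.q p = A.q p' ↔ A.q (k p) = A.q (k p'))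
    (p p' : Total A.S) :
    A.q p = A.q p' ↔ A.q (convexComb hA h s p) = A.q (convexComb hA h s p') := by
  have key : ∀ (e : HalfEdge A.S) (u : HalfEdge.UnitIoo), A.ξ e ≠ e →
      ∃ w, convexComb hA h s (e.pt hA.1 u) = e.pt hA.1 w ∧
        convexComb hA h s ((A.ξ e).pt hA.1 (flip (A.σ e) u)) =
          (A.ξ e).pt hA.1 (flip (A.σ e) w) := by
    intro e u he
    obtain ⟨v, hv⟩ := e.exists_pt_eq hA.1 (h.edge_one (e.pt_mem hA.1 u))
    have h1 := (q_pt_eq_iff hA (e := e) (u := u)).2 (Or.inr ⟨he, rfl⟩)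
    have hm := h.edge_one ((A.ξ e).pt_mem hA.1 (flip (A.σ e) u))
    rw [hq, ← hv, q_pt_eq_iff hA] at h1
    have h2 := (h1.resolve_left fun h2 => by
      rw [h2] at hm
      exact he (HalfEdge.eq_of_mem_toSet hm (HalfEdge.pt_mem _ _ _))).2
    refine ⟨_, convexComb_pt hA h s hv.symm, ?_⟩
    rw [convexComb_pt hA h s h2]
    congr 1
    apply Subtype.ext
    simp only [coe_flip]
    ring
  constructor
  · rw [q_eq_iff hA (p := p)]
    rintro (rfl | ⟨e, u, he, rfl, rfl⟩)
    · rfl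
    · obtain ⟨w, h1, h2⟩ := key e u he
      rw [h1, h2]
      exact (glue_iff hA he _ _).2 rfl
  · intro hc
    by_cases hp : p ∈ Total.interior A.S
    · rw [q_eq_iff_of_mem_interior hA ((convexComb_mem_interior hA h s p).2 hp)] at hc
      rw [convexComb_injective hA h s hc]
    · obtain ⟨e, he⟩ := HalfEdge.exists_mem_toSet hp
      obtain ⟨u, rfl⟩ := e.exists_pt_eq hA.1 he
      obtain ⟨v, hv⟩ := e.exists_pt_eq hA.1 (h.edge_one he)
      have hcp := convexComb_pt hA h s hv.symm
      have hc' := hc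
      rw [hcp, q_pt_eq_iff hA] at hc'
      rcases hc' with h1 | ⟨hξ, h1⟩
      · rw [← hcp] at h1
        rw [convexComb_injective hA h s h1]
      · obtain ⟨w, h2, h3⟩ := key e u hξ
        rw [hcp] at h2
        rw [HalfEdge.pt_injective hA.1 e h2, ← h3] at h1
        rw [convexComb_injective hA h s h1]
        exact (glue_iff hA hξ _ _).2 rfl

end

/-- On a line, on the heights of a strip and on a boundary interval, the convex combination is one of
an increasing surjection with the identity. -/
theorem convexComb_surjective {k : Total A.S ≃ₜ Total A.S} (h : Induces k 1) (s : unitInterval) :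
    Function.Surjective (convexComb hA h s) := by
  have hsv : ∀ p : Total A.S, (k.symm p).1 = p.1 := fun p => by
    rw [← h.vertex_one, k.apply_symm_apply]
  have hrp := h.isRowPreserving
  intro p
  by_cases hp : p ∈ Total.interior A.S
  · -- the height of the preimage
    have hc : Continuous fun t : Ioo (A.S p.1).lo (A.S p.1).hi =>
        (k (Total.mkInt p.1 0 t t.2)).y :=
      Total.continuous_y.comp (k.continuous.comp
        (Total.continuous_mkInt continuous_const continuous_subtype_val _))
    have hm : ∀ t t' : Ioo (A.S p.1).lo (A.S p.1).hi, (t : ℝ) ≤ t' →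
        (k (Total.mkInt p.1 0 t t.2)).y ≤ (k (Total.mkInt p.1 0 t' t'.2)).y := by
      intro t t' htt
      rcases htt.eq_or_lt with h1 | h1
      · rw [Subtype.ext h1]
      · exact (h.height_one (p := Total.mkInt p.1 0 t t.2) (p' := Total.mkInt p.1 0 t' t'.2)
          rfl h1).le
    have hs : ∀ y ∈ Ioo (A.S p.1).lo (A.S p.1).hi, ∃ t : Ioo (A.S p.1).lo (A.S p.1).hi,
        (k (Total.mkInt p.1 0 t t.2)).y = y := by
      intro y hy
      have hi : k.symm (Total.mkInt p.1 0 y hy) ∈ Total.interior A.S :=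
        (hrp.symm.mem_interior _).2 hy
      have hi' : (k.symm (Total.mkInt p.1 0 y hy)).y ∈ Ioo (A.S p.1).lo (A.S p.1).hi := by
        have h2 : (k.symm (Total.mkInt p.1 0 y hy)).1 = p.1 := hsv _
        have h3 := hi
        change (k.symm _).y ∈ Ioo (A.S (k.symm _).1).lo (A.S (k.symm _).1).hi at h3
        rwa [h2] at h3
      refine ⟨⟨_, hi'⟩, ?_⟩
      have h4 := h.row (Total.mkInt p.1 0 _ hi') (k.symm (Total.mkInt p.1 0 y hy))
        (hsv (Total.mkInt p.1 0 y hy)).symm rfl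
      exact h4.trans (congrArg Total.y (k.apply_symm_apply _))
    obtain ⟨t, ht⟩ := exists_convexComb_eq ordConnected_Ioo hc hm hs s.2.1 s.2.2 hp
    -- the first coordinate of the preimage
    have hcx : Continuous fun a : (univ : Set ℝ) => (k (Total.mkInt p.1 a t t.2)).x :=
      Total.continuous_x.comp (k.continuous.comp
        (Total.continuous_mkInt continuous_subtype_val continuous_const _))
    have hmx : ∀ a b : (univ : Set ℝ), (a : ℝ) ≤ b →
        (k (Total.mkInt p.1 a t t.2)).x ≤ (k (Total.mkInt p.1 b t t.2)).x := by
      intro a b hab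
      rcases hab.eq_or_lt with h1 | h1
      · rw [h1]
      · exact (h.order_one (p := Total.mkInt p.1 a t t.2) (p' := Total.mkInt p.1 b t t.2)
          rfl rfl h1).le
    have hsx : ∀ x ∈ (univ : Set ℝ), ∃ a : (univ : Set ℝ),
        (k (Total.mkInt p.1 a t t.2)).x = x := by
      intro x _
      set r := k (Total.mkInt p.1 0 t t.2) with hr
      have hri : r ∈ Total.interior A.S := (h.mem_interior _).2 t.2
      set r' := Total.mkInt r.1 x r.y hri with hr'
      have h1 : (k.symm r').y = t := by
        rw [hrp.row_symm r' hri r hri rfl rfl, hr, k.symm_apply_apply]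
        rfl
      have h2 : (k.symm r').1 = p.1 := by rw [hsv]; exact h.vertex_one _
      refine ⟨⟨(k.symm r').x, mem_univ _⟩, ?_⟩
      have h3 : Total.mkInt p.1 (k.symm r').x t t.2 = k.symm r' :=
        Total.ext_iff'.2 ⟨h2.symm, rfl, h1.symm⟩
      rw [h3, k.apply_symm_apply]
      rfl
    obtain ⟨a, ha⟩ := exists_convexComb_eq ordConnected_univ hcx hmx hsx s.2.1 s.2.2 (mem_univ p.x)
    refine ⟨Total.mkInt p.1 a t t.2, Total.ext_iff'.2 ⟨rfl, ha, ?_⟩⟩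
    rw [convexComb_y, h.row (Total.mkInt p.1 a t t.2) (Total.mkInt p.1 0 t t.2) rfl rfl]
    exact ht
  · obtain ⟨e, he⟩ := HalfEdge.exists_mem_toSet hp
    obtain ⟨w, rfl⟩ := e.exists_pt_eq hA.1 he
    choose f hf using fun u => e.exists_pt_eq hA.1 (h.edge_one (e.pt_mem hA.1 u))
    have hlen := sub_pos.2 (e.left_lt_right hA.1)
    have hfx : ∀ u, (f u : ℝ) = ((k (e.pt hA.1 u)).x - e.left) / (e.right - e.left) := by
      intro u
      rw [← hf u, HalfEdge.pt_x, add_sub_cancel_left, mul_div_cancel_left₀ _ hlen.ne']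
    have hc : Continuous fun u => (f u : ℝ) := by
      simp only [hfx]
      exact ((Total.continuous_x.comp (k.continuous.comp (e.continuous_pt hA.1))).sub
        continuous_const).div_const _
    have hm : ∀ u u' : HalfEdge.UnitIoo, (u : ℝ) ≤ u' → (f u : ℝ) ≤ f u' := by
      intro u u' huu
      rcases huu.eq_or_lt with h1 | h1
      · rw [Subtype.ext h1]
      · rw [hfx, hfx]
        have h2 : (e.pt hA.1 u).x < (e.pt hA.1 u').x := by
          simp only [HalfEdge.pt_x]; nlinarith
        have := h.order_one (p := e.pt hA.1 u) (p' := e.pt hA.1 u') rfl rfl h2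
        gcongr
    have hs : ∀ y ∈ Ioo (0 : ℝ) 1, ∃ u, (f u : ℝ) = y := by
      intro y hy
      have h1 : e.pt hA.1 ⟨y, hy⟩ ∈ k '' e.toSet := by
        rw [h.image_toSet]; exact HalfEdge.pt_mem _ _ _
      obtain ⟨r, hr, h2⟩ := h1
      obtain ⟨u, rfl⟩ := e.exists_pt_eq hA.1 hr
      refine ⟨u, ?_⟩
      rw [← hf] at h2
      rw [HalfEdge.pt_injective hA.1 e h2]
    obtain ⟨u, hu⟩ := exists_convexComb_eq ordConnected_Ioo hc hm hs s.2.1 s.2.2 w.2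
    refine ⟨e.pt hA.1 u, ?_⟩
    rw [convexComb_pt hA h s (hf u).symm]
    congr 1
    exact Subtype.ext hu

theorem isHomeomorph_convexComb {k : Total A.S ≃ₜ Total A.S} (h : Induces k 1)
    (s : unitInterval) : IsHomeomorph (convexComb hA h s) := by
  have hi := induces_convexComb hA h s
  refine isHomeomorph_sigmaMap (Equiv.refl A.Λ) _ ?_
    ⟨convexComb_injective hA h s, convexComb_surjective hA h s⟩ (fun _ => 1) (fun _ => 1)
    hi.row hi.height hi.order
  refine continuous_iff_continuousAt.2 fun p => Total.tendsto_nhds_iff.2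
    ⟨Total.eventually_vertex_eq p, ?_, ?_⟩
  · exact (((Total.continuous_x.comp k.continuous).const_mul _).add
      (Total.continuous_x.const_mul _)).tendsto p
  · exact (((Total.continuous_y.comp k.continuous).const_mul _).add
      (Total.continuous_y.const_mul _)).tendsto p

end StripedAtlas

/-! ### The action of foliated homeomorphisms on the graph of a reduced atlas -/

theorem continuous_homeoGroup_iff {Z : Type u} [TopologicalSpace Z] {Δ : Set (Set Z)} {X : Type*}
    [TopologicalSpace X] {f : X → homeoGroup Δ} (hf : Continuous fun x : X × Z => (f x.1).1 x.2) :
    Continuous f :=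
  (homeoGroup_isInducing Δ).continuous_iff.2 (ContinuousMap.continuous_of_continuous_uncurry _ hf)

/-- The action of `H(Δ)` is continuous after composition with a continuous map defined on a locally
compact space. -/
theorem continuous_homeoGroup_apply {Z : Type u} [TopologicalSpace Z] {Δ : Set (Set Z)}
    {T : Type*} [TopologicalSpace T] [LocallyCompactSpace T] {q : T → Z} (hq : Continuous q) :
    Continuous fun x : homeoGroup Δ × T => x.1.1 (q x.2) := by
  have h1 : Continuous fun h : homeoGroup Δ =>
      (⟨h.1, h.1.continuous⟩ : C(Z, Z)).comp (⟨q, hq⟩ : C(T, Z)) :=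
    (ContinuousMap.continuous_precomp _).comp (homeoGroup_isInducing Δ).continuous
  exact (h1.comp continuous_fst).eval continuous_snd

namespace StripedAtlas

variable {Z : Type u} [TopologicalSpace Z] {A : StripedAtlas.{u, v, w} Z}
variable (hA : A.IsAffine) (hr : A.IsReduced)

/-- The lift to the strips of a foliated homeomorphism. -/
def foliatedLift (h : homeoGroup A.foliation) : Total A.S ≃ₜ Total A.S :=
  lift hA h.1 (hr.mem_boundaryImage_iff h.2)

theorem q_foliatedLift (h : homeoGroup A.foliation) (p : Total A.S) :
    A.q (foliatedLift hA hr h p) = h.1 (A.q p) := q_lift hA _ _ p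

theorem q_foliatedLift_iff (h : homeoGroup A.foliation) (p p' : Total A.S) :
    A.q p = A.q p' ↔ A.q (foliatedLift hA hr h p) = A.q (foliatedLift hA hr h p') := by
  rw [q_foliatedLift, q_foliatedLift, h.1.injective.eq_iff]

theorem eq_foliatedLift {h : homeoGroup A.foliation} {k : Total A.S ≃ₜ Total A.S}
    (hk : ∀ p, A.q (k p) = h.1 (A.q p)) : k = foliatedLift hA hr h := eq_lift hA _ hk

theorem exists_induces_foliatedLift (h : homeoGroup A.foliation) :
    ∃ a, Induces (foliatedLift hA hr h) a :=
  exists_induces hA (isRowPreserving_lift hA h.2 _) (q_foliatedLift_iff hA hr h)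

/-- The automorphism of the graph that a foliated homeomorphism induces. -/
def graphAction : homeoGroup A.foliation →* A.graph.Aut where
  toFun h := (exists_induces_foliatedLift hA hr h).choose
  map_one' := by
    refine (exists_induces_foliatedLift hA hr 1).choose_spec.unique ?_
    rw [← eq_foliatedLift hA hr (k := Homeomorph.refl _) fun p => rfl]
    exact Induces.id
  map_mul' h h' := by
    refine (exists_induces_foliatedLift hA hr _).choose_spec.unique ?_
    have h1 := (exists_induces_foliatedLift hA hr h).choose_spec.comp
      (exists_induces_foliatedLift hA hr h').choose_spec
    rw [← eq_foliatedLift hA hr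
      (k := (foliatedLift hA hr h').trans (foliatedLift hA hr h)) fun p => ?_]
    · exact h1
    · exact (q_foliatedLift hA hr h _).trans (congrArg h.1 (q_foliatedLift hA hr h' p))

theorem induces_graphAction (h : homeoGroup A.foliation) :
    Induces (foliatedLift hA hr h) (graphAction hA hr h) :=
  (exists_induces_foliatedLift hA hr h).choose_spec

theorem graphAction_eq {h : homeoGroup A.foliation} {k : Total A.S ≃ₜ Total A.S}
    (hk : ∀ p, A.q (k p) = h.1 (A.q p)) {a : A.graph.Aut} (ha : Induces k a) :
    graphAction hA hr h = a := by
  rw [eq_foliatedLift hA hr hk] at ha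
  exact (induces_graphAction hA hr h).unique ha

theorem continuous_foliatedLift :
    Continuous fun x : homeoGroup A.foliation × Total A.S => foliatedLift hA hr x.1 x.2 := by
  refine continuous_of_continuous_q hA ?_ (fun h => (foliatedLift hA hr h).continuous)
    fun h => (induces_graphAction hA hr h).mem_interior
  simp only [q_foliatedLift]
  exact continuous_homeoGroup_apply A.isQuotientMap.continuous

/-- The action on the graph is constant on connected families of homeomorphisms: the strip and the
boundary interval that contain the image of a point, and the signs of the differences of coordinates,
are locally constant. -/
theorem graphAction_eq_of_preconnected {X : Type*} [TopologicalSpace X] [PreconnectedSpace X]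
    {f : X → homeoGroup A.foliation} (hf : Continuous f) (a b : X) :
    graphAction hA hr (f a) = graphAction hA hr (f b) := by
  have hk : ∀ p : Total A.S, Continuous fun c => foliatedLift hA hr (f c) p := fun p =>
    (continuous_foliatedLift hA hr).comp (hf.prodMk continuous_const)
  have hi := fun c => induces_graphAction hA hr (f c)
  have sign : ∀ {F : X → ℝ} (hF : Continuous F) (s : X → ℤˣ), (∀ c, 0 < sgn (s c) * F c) →
      s a = s b := by
    intro F hF s hs
    obtain ⟨ε, hε⟩ := exists_sign hF fun c hc => (hs c).ne' (by rw [hc, mul_zero])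
    rw [eq_of_sgn_mul_pos (hs a) (hε a), eq_of_sgn_mul_pos (hs b) (hε b)]
  apply StripedGraph.Aut.ext
  · ext l
    have h1 := Total.vertex_eq_of_preconnected (hk (Total.base A.S l)) a b
    rw [(hi a).vertex, (hi b).vertex] at h1
    exact h1.symm
  · ext e
    obtain ⟨p, hp⟩ := HalfEdge.toSet_nonempty (S := A.S) e
    refine HalfEdge.eq_of_mem_toSet (HalfEdge.mem_toSet_of_preconnected hA.1 (hk p) (fun c hc => ?_)
      ((hi a).edge e p hp) b) ((hi b).edge e p hp)
    exact HalfEdge.notMem_interior hp (((hi c).mem_interior p).1 hc)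
  · ext1 l
    obtain ⟨p, h1, h2, h3⟩ := Total.exists_right_of_base (S := A.S) l
    exact sign ((Total.continuous_x.comp (hk p)).sub (Total.continuous_x.comp (hk _)))
      (fun c => (graphAction hA hr (f c)).lori l) fun c => (hi c).order _ p h1.symm h2 h3
  · ext1 l
    obtain ⟨p, h1, h2⟩ := Total.exists_above_base (S := A.S) l
    exact sign ((Total.continuous_y.comp (hk p)).sub (Total.continuous_y.comp (hk _)))
      (fun c => (graphAction hA hr (f c)).tori l) fun c => (hi c).height _ p h1.symm h2

/-! ### The straight-line contraction of the kernel -/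

theorem exists_straightLine (h : (graphAction hA hr).ker) (s : unitInterval) :
    ∃ g : (graphAction hA hr).ker, ∀ p, g.1.1 (A.q p) =
      A.q (convexComb hA (h.2 ▸ induces_graphAction hA hr h.1) s p) := by
  have hi : Induces (foliatedLift hA hr h.1) 1 := h.2 ▸ induces_graphAction hA hr h.1
  set k := (isHomeomorph_convexComb hA hi s).homeomorph with hk
  have hki : Induces k 1 := induces_convexComb hA hi s
  obtain ⟨g, hg⟩ := exists_descent k (q_convexComb_iff hA hi s (q_foliatedLift_iff hA hr h.1))
  refine ⟨⟨⟨g, isFoliated_of_induces hA hki hg⟩, ?_⟩, hg⟩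
  exact graphAction_eq hA hr (fun p => (hg p).symm) hki

/-- The homeomorphism at time `s` of the straight-line deformation of `h` to the identity. -/
def straightLine (h : (graphAction hA hr).ker) (s : unitInterval) : (graphAction hA hr).ker :=
  (exists_straightLine hA hr h s).choose

theorem straightLine_apply (h : (graphAction hA hr).ker) (s : unitInterval) (p : Total A.S) :
    (straightLine hA hr h s).1.1 (A.q p) =
      A.q (convexComb hA (h.2 ▸ induces_graphAction hA hr h.1) s p) :=
  (exists_straightLine hA hr h s).choose_spec p

theorem straightLine_zero (h : (graphAction hA hr).ker) : straightLine hA hr h 0 = h := by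
  apply Subtype.ext
  apply Subtype.ext
  apply Homeomorph.ext
  intro z
  obtain ⟨p, rfl⟩ := A.isQuotientMap.surjective z
  rw [straightLine_apply, ← q_foliatedLift hA hr]
  congr 1
  refine Total.ext_iff'.2 ⟨?_, ?_, ?_⟩
  · exact (Induces.vertex_one (h.2 ▸ induces_graphAction hA hr h.1) p).symm
  · simp [convexComb_x]
  · simp [convexComb_y]

theorem straightLine_one (h : (graphAction hA hr).ker) : straightLine hA hr h 1 = 1 := by
  apply Subtype.ext
  apply Subtype.ext
  apply Homeomorph.ext
  intro z
  obtain ⟨p, rfl⟩ := A.isQuotientMap.surjective z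
  rw [straightLine_apply]
  change A.q _ = A.q p
  congr 1
  refine Total.ext_iff'.2 ⟨rfl, ?_, ?_⟩
  · simp [convexComb_x]
  · simp [convexComb_y]

/-- By the universal property of `H(Δ)` and of the quotient map `q`, it suffices that the convex
combinations of the lifts depend continuously on all parameters. -/
theorem continuous_straightLine :
    Continuous fun x : (graphAction hA hr).ker × unitInterval => straightLine hA hr x.1 x.2 := by
  refine continuous_induced_rng.2 ?_
  change Continuous fun x : (graphAction hA hr).ker × unitInterval =>
    (straightLine hA hr x.1 x.2).1
  refine continuous_homeoGroup_iff ?_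
  rw [(isQuotientMap_prodMap_q hA _).continuous_iff]
  change Continuous fun x : ((graphAction hA hr).ker × unitInterval) × Total A.S =>
    (straightLine hA hr x.1.1 x.1.2).1.1 (A.q x.2)
  simp only [straightLine_apply]
  have hk : Continuous fun x : ((graphAction hA hr).ker × unitInterval) × Total A.S =>
      foliatedLift hA hr x.1.1 x.2 :=
    (continuous_foliatedLift hA hr).comp
      ((continuous_subtype_val.comp (continuous_fst.comp continuous_fst)).prodMk continuous_snd)
  have hs : Continuous fun x : ((graphAction hA hr).ker × unitInterval) × Total A.S =>
      (x.1.2 : ℝ) := continuous_subtype_val.comp (continuous_snd.comp continuous_fst)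
  have hx := ((continuous_const (y := (1 : ℝ))).sub hs).mul (Total.continuous_x.comp hk) |>.add
    (hs.mul (Total.continuous_x.comp continuous_snd))
  have hy := ((continuous_const (y := (1 : ℝ))).sub hs).mul (Total.continuous_y.comp hk) |>.add
    (hs.mul (Total.continuous_y.comp continuous_snd))
  refine A.isQuotientMap.continuous.comp (continuous_iff_continuousAt.2 fun x => ?_)
  refine Total.tendsto_nhds_iff.2 ⟨?_, hx.tendsto x, hy.tendsto x⟩
  exact (continuous_snd.tendsto x).eventually (Total.eventually_vertex_eq x.2)

theorem contractibleSpace_ker : ContractibleSpace (graphAction hA hr).ker := by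
  rw [contractible_iff_id_nullhomotopic]
  exact ⟨1, ⟨{
    toFun := fun x => straightLine hA hr x.2 x.1
    continuous_toFun := (continuous_straightLine hA hr).comp continuous_swap
    map_zero_left := straightLine_zero hA hr
    map_one_left := straightLine_one hA hr }⟩⟩

include hA hr in
/-- A homeomorphism that is isotopic to the identity acts trivially on the graph, and one that acts
trivially is joined to the identity by the straight-line deformation. -/
theorem identityComponent_eq_ker : identityComponent A.foliation = (graphAction hA hr).ker := by
  ext h
  constructor
  · rintro ⟨γ⟩
    have h1 := graphAction_eq_of_preconnected hA hr γ.continuous 1 0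
    rw [γ.source, γ.target, map_one] at h1
    exact h1
  · intro hh
    have h1 : Continuous fun s => (straightLine hA hr ⟨h, hh⟩ s).1 :=
      continuous_subtype_val.comp
        ((continuous_straightLine hA hr).comp (continuous_const.prodMk continuous_id))
    have h2 : Joined h 1 := ⟨⟨⟨_, h1⟩, congrArg Subtype.val (straightLine_zero hA hr ⟨h, hh⟩),
      congrArg Subtype.val (straightLine_one hA hr ⟨h, hh⟩)⟩⟩
    exact h2.symm

include hA hr in
theorem contractibleSpace_identityComponent : ContractibleSpace (identityComponent A.foliation) := by
  rw [identityComponent_eq_ker hA hr]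
  exact contractibleSpace_ker hA hr

include hA hr in
theorem nonempty_homeotopyGroup_mulEquiv (hs : Function.Surjective (graphAction hA hr)) :
    Nonempty (HomeotopyGroup A.foliation ≃* A.graph.Aut) :=
  ⟨(QuotientGroup.quotientMulEquivOfEq (identityComponent_eq_ker hA hr)).trans
    (QuotientGroup.quotientKerEquivOfSurjective _ hs)⟩

end StripedAtlas

/-! ### Realization of automorphisms of the graph -/

/-- The affine homeomorphism between the intervals of heights of two strips, with the direction
given by the sign. -/
def heightMap (T T' : Strip) (τ : ℤˣ) (y : ℝ) : ℝ :=
  (T'.lo + T'.hi) / 2 + sgn τ * (T'.hi - T'.lo) * ((y - T.lo) / (T.hi - T.lo) - 1 / 2)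

section Height

variable (T T' : Strip) (τ : ℤˣ)

theorem continuous_heightMap : Continuous (heightMap T T' τ) := by
  unfold heightMap
  fun_prop

theorem heightMap_heightMap (y : ℝ) : heightMap T T' τ (heightMap T' T τ y) = y := by
  have h1 := (sub_pos.2 T.lo_lt_hi).ne'
  have h2 := (sub_pos.2 T'.lo_lt_hi).ne'
  have h3 := sgn_mul_self τ
  have h4 : (heightMap T' T τ y - T.lo) / (T.hi - T.lo) - 1 / 2 =
      sgn τ * ((y - T'.lo) / (T'.hi - T'.lo) - 1 / 2) := by
    unfold heightMap
    rw [sub_eq_iff_eq_add, div_eq_iff h1]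
    ring
  unfold heightMap at h4 ⊢
  rw [h4]
  calc _ = (T'.lo + T'.hi) / 2 + (sgn τ * sgn τ) * ((T'.hi - T'.lo) *
        ((y - T'.lo) / (T'.hi - T'.lo)) - (T'.hi - T'.lo) / 2) := by ring
    _ = y := by rw [h3, mul_div_cancel₀ _ h2]; ring

theorem heightMap_level (s : ℤˣ) : heightMap T T' τ (T.level s) = T'.level (τ * s) := by
  have h1 := (sub_pos.2 T.lo_lt_hi).ne'
  unfold heightMap
  rcases Int.units_eq_one_or s with rfl | rfl <;> rcases Int.units_eq_one_or τ with rfl | rfl <;>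
    simp [Strip.level, div_self h1] <;> ring

theorem sgn_mul_heightMap_sub_pos {y y' : ℝ} (h : y < y') :
    0 < sgn τ * (heightMap T T' τ y' - heightMap T T' τ y) := by
  have h1 := sub_pos.2 T.lo_lt_hi
  have h2 := sub_pos.2 T'.lo_lt_hi
  have h3 := sgn_mul_self τ
  have h4 : sgn τ * (heightMap T T' τ y' - heightMap T T' τ y) =
      (sgn τ * sgn τ) * ((T'.hi - T'.lo) * ((y' - y) / (T.hi - T.lo))) := by
    unfold heightMap; ring
  rw [h4, h3, one_mul]
  exact mul_pos h2 (div_pos (sub_pos.2 h) h1)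

theorem heightMap_injective : Function.Injective (heightMap T T' τ) :=
  Function.LeftInverse.injective (heightMap_heightMap T' T τ)

theorem heightMap_mem_Ioo {y : ℝ} (h : y ∈ Ioo T.lo T.hi) :
    heightMap T T' τ y ∈ Ioo T'.lo T'.hi := by
  have h1 := sgn_mul_heightMap_sub_pos T T' τ h.1
  have h2 := sgn_mul_heightMap_sub_pos T T' τ h.2
  have e1 := heightMap_level T T' τ 1
  have e2 := heightMap_level T T' τ (-1)
  rcases Int.units_eq_one_or τ with rfl | rfl <;> simp [Strip.level] at h1 h2 e1 e2 <;>
    constructor <;> linarith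

end Height

section Family

variable {Λ : Type v} {S : Λ → Strip} (hS : ∀ l, (S l).IsModel) {ν : Equiv.Perm Λ}
  {η : Equiv.Perm (HalfEdge S)} {ε τ : Λ → ℤˣ} (hv : ∀ e, (η e).vertex = ν e.vertex)
  (hs : ∀ e, (η e).side = τ e.vertex * e.side)
  (hinc : ∀ e f : HalfEdge S, e.vertex = f.vertex → e.side = f.side → ε e.vertex = 1 →
    e.Before f → (η e).Before (η f))
  (hdec : ∀ e f : HalfEdge S, e.vertex = f.vertex → e.side = f.side → ε e.vertex = -1 →
    e.Before f → (η f).Before (η e))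

include hinc hdec in
/-- The affine maps between corresponding boundary intervals of one side combine to a continuous
monotone function, up to the sign. -/
theorem exists_side_map (l : Λ) (s : ℤˣ) : ∃ φ : ℝ → ℝ,
    ContinuousOn φ ((S l).sideSet s) ∧ MonotoneOn φ ((S l).sideSet s) ∧
      ∀ (e : HalfEdge S) (u : HalfEdge.UnitIoo), e.vertex = l → e.side = s →
        φ (e.pt hS u).x =
          sgn (ε l) * ((η e).pt hS (flip (ε l) u)).x := by
  classical
  have hex : ∀ x ∈ (S l).sideSet s, ∃ (e : HalfEdge S) (u : HalfEdge.UnitIoo),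
      e.vertex = l ∧ e.side = s ∧ (e.pt hS u).x = x := by
    intro x hx
    set e : HalfEdge S := ⟨l, s, connectedComponentIn ((S l).sideSet s) x, x, hx, rfl⟩
    obtain ⟨u, hu⟩ := e.exists_pt_eq hS (p := e.point ⟨x, mem_connectedComponentIn hx⟩)
      (mem_range_self _)
    exact ⟨e, u, rfl, rfl, by rw [hu]; rfl⟩
  have huniq : ∀ (e e' : HalfEdge S) (u u' : HalfEdge.UnitIoo), e.vertex = l → e.side = s →
      e'.vertex = l → e'.side = s → (e.pt hS u).x = (e'.pt hS u').x → e = e' ∧ u = u' := by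
    intro e e' u u' h1 h2 h3 h4 hx
    have h5 : e.pt hS u = e'.pt hS u' :=
      Total.ext_iff'.2 ⟨h1.trans h3.symm, hx, by simp only [HalfEdge.pt_y, h1, h2, h3, h4]⟩
    have h6 : e = e' := HalfEdge.eq_of_mem_toSet (e.pt_mem hS u) (h5 ▸ e'.pt_mem hS u')
    subst h6
    exact ⟨rfl, e.pt_injective hS h5⟩
  rcases isEmpty_or_nonempty (HalfEdge S) with hempty | hne
  · have h0 : ∀ x, x ∉ (S l).sideSet s := fun x hx => hempty.elim (hex x hx).choose
    exact ⟨0, fun x hx => (h0 x hx).elim, fun x hx => (h0 x hx).elim, fun e => hempty.elim e⟩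
  have hneU : Nonempty HalfEdge.UnitIoo := ⟨⟨1 / 2, by norm_num, by norm_num⟩⟩
  choose! E U hE hEs hU using hex
  set φ : ℝ → ℝ := fun x => sgn (ε l) *
    ((η (E x)).pt hS (flip (ε l) (U x))).x with hφ
  have hside : ∀ (e : HalfEdge S) u, e.vertex = l → e.side = s →
      (e.pt hS u).x ∈ (S l).sideSet s := by
    rintro e u rfl rfl
    exact e.interval_subset_sideSet (HalfEdge.mem_toSet.1 (e.pt_mem hS u)).2.2
  have key : ∀ (e : HalfEdge S) (u : HalfEdge.UnitIoo), e.vertex = l → e.side = s →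
      φ (e.pt hS u).x =
        sgn (ε l) * ((η e).pt hS (flip (ε l) u)).x := by
    intro e u h1 h2
    have hm := hside e u h1 h2
    obtain ⟨h3, h4⟩ := huniq _ _ _ _ (hE _ hm) (hEs _ hm) h1 h2 (hU _ hm)
    simp only [hφ, h3, h4]
  -- on one interval the function is affine and increasing
  have haff : ∀ (e : HalfEdge S) (u : HalfEdge.UnitIoo),
      sgn (ε l) * ((η e).pt hS (flip (ε l) u)).x =
        sgn (ε l) * (((η e).left + (η e).right) / 2) +
          ((η e).right - (η e).left) * (u - 1 / 2) := by
    intro e u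
    rw [HalfEdge.pt_x, coe_flip]
    change sgn (ε l) * (_ + _ * (1 / 2 + sgn (ε l) * _)) = _
    linear_combination ((η e).right - (η e).left) *
      ((u : ℝ) - 1 / 2) * sgn_mul_self (ε l)
  refine ⟨φ, fun x hx => ContinuousAt.continuousWithinAt ?_, ?_, key⟩
  · set e := E x with he
    have hlt := sub_pos.2 (e.left_lt_right hS)
    have hxe : x ∈ e.interval := by
      have h := (HalfEdge.mem_toSet.1 (e.pt_mem hS (U x))).2.2
      rwa [hU x hx] at h
    have hcont : ContinuousAt (fun x' => sgn (ε l) *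
        (((η e).left + (η e).right) / 2) +
          ((η e).right - (η e).left) *
            ((x' - e.left) / (e.right - e.left) - 1 / 2)) x := by fun_prop
    refine hcont.congr ?_
    filter_upwards [e.isOpen_interval.mem_nhds hxe] with x' hx'
    obtain ⟨u, hu⟩ := e.exists_pt_eq hS (p := e.point ⟨x', hx'⟩) (mem_range_self _)
    have hux : (e.pt hS u).x = x' := by rw [hu]; rfl
    have h1 := key e u (hE x hx) (hEs x hx)
    rw [hux, haff] at h1
    rw [h1, ← hux, HalfEdge.pt_x, add_sub_cancel_left, mul_div_cancel_left₀ _ hlt.ne']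
  · intro x hx x' hx' hxx
    obtain ⟨h1, h2, h3⟩ := (⟨hE x hx, hEs x hx, hU x hx⟩ : _ ∧ _ ∧ _)
    obtain ⟨h1', h2', h3'⟩ := (⟨hE x' hx', hEs x' hx', hU x' hx'⟩ : _ ∧ _ ∧ _)
    rw [← h3, ← h3', key _ _ h1 h2, key _ _ h1' h2']
    rw [← h3, ← h3'] at hxx
    generalize E x = e at *
    generalize E x' = e' at *
    generalize U x = u at *
    generalize U x' = u' at *
    by_cases hee : e = e'
    · subst hee
      rw [haff, haff]
      have hlt := sub_pos.2 (e.left_lt_right hS)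
      have hlt' := sub_pos.2 ((η e).left_lt_right hS)
      rw [HalfEdge.pt_x, HalfEdge.pt_x] at hxx
      have huu : (u : ℝ) ≤ u' := le_of_mul_le_mul_left (by linarith) hlt
      gcongr
    · have hb : e.Before e' := (HalfEdge.before_total (h1.trans h1'.symm) (h2.trans h2'.symm)
          hee).resolve_right fun hb => (hb _ (HalfEdge.mem_toSet.1 (e'.pt_mem hS u')).2.2 _
            (HalfEdge.mem_toSet.1 (e.pt_mem hS u)).2.2).not_ge hxx
      have hm : ∀ (f : HalfEdge S) v, (f.pt hS v).x ∈ f.interval := fun f v =>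
        (HalfEdge.mem_toSet.1 (f.pt_mem hS v)).2.2
      rcases Int.units_eq_one_or (ε l) with hl | hl
      · have h5 : (η e).Before (η e') :=
          hinc e e' (h1.trans h1'.symm) (h2.trans h2'.symm) (h1 ▸ hl) hb
        rw [hl, sgn_one, one_mul, one_mul]
        exact (h5 _ (hm _ _) _ (hm _ _)).le
      · have h5 : (η e').Before (η e) :=
          hdec e e' (h1.trans h1'.symm) (h2.trans h2'.symm) (h1 ▸ hl) hb
        rw [hl, sgn_neg_one, neg_one_mul, neg_one_mul, neg_le_neg_iff]
        exact (h5 _ (hm _ _) _ (hm _ _)).le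

include hv hs hinc hdec in
/-- A map of one strip to another that acts on the boundary intervals as prescribed by an
automorphism of the graph. -/
theorem exists_strip_map (l : Λ) : ∃ (F : (S l).carrier → (S (ν l)).carrier)
    (f : ℝ → ℝ → ℝ), Continuous F ∧
      (∀ w, (F w).1.2 = heightMap (S l) (S (ν l)) (τ l) w.1.2) ∧
      (∀ w, (F w).1.1 = sgn (ε l) * f w.1.2 w.1.1) ∧
      (∀ y ∈ Ioo (S l).lo (S l).hi, StrictMono (f y) ∧ Function.Surjective (f y)) ∧
      (∀ s, MonotoneOn (f ((S l).level s)) ((S l).sideSet s)) ∧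
      ∀ (e : HalfEdge S) (u : HalfEdge.UnitIoo), e.vertex = l → ∀ w : (S l).carrier,
        w.1 = ((e.pt hS u).x, (e.pt hS u).y) → (F w).1.1 =
          ((η e).pt hS (flip (ε l) u)).x := by
  choose φ hφc hφm hφ using exists_side_map hS hinc hdec l
  obtain ⟨F₀, h0, h1, h2, h3⟩ := exists_two_sided_interpolation ((S l).isOpen_sideSet (-1))
    ((S l).isOpen_sideSet 1) (hφc (-1)) (hφm (-1)) (hφc 1) (hφm 1)
  have hlt := sub_pos.2 (S l).lo_lt_hi
  -- heights are normalized to the unit interval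
  set n : ℝ → ℝ := fun y => (y - (S l).lo) / ((S l).hi - (S l).lo) with hn
  have hnc : Continuous n := by simp only [hn]; fun_prop
  have hnI : ∀ y ∈ Ioo (S l).lo (S l).hi, n y ∈ Ioo (0 : ℝ) 1 := fun y hy =>
    ⟨div_pos (sub_pos.2 hy.1) hlt, (div_lt_one hlt).2 (by linarith [hy.2])⟩
  have hF : ∀ s, ∀ x ∈ (S l).sideSet s, F₀ (n ((S l).level s)) x = φ s x := by
    intro s x hx
    rcases Int.units_eq_one_or s with rfl | rfl
    · have : n ((S l).level 1) = 1 := by simp [hn, Strip.level, div_self hlt.ne']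
      rw [this, h1 x hx]
    · have : n ((S l).level (-1)) = 0 := by simp [hn, Strip.level]
      rw [this, h0 x hx]
  have hcases : ∀ w : (S l).carrier, w.1.2 ∈ Ioo (S l).lo (S l).hi ∨
      ∃ (e : HalfEdge S) (u : HalfEdge.UnitIoo), e.vertex = l ∧
        w.1 = ((e.pt hS u).x, (e.pt hS u).y) := by
    intro w
    by_cases hw : (⟨l, w⟩ : Total S) ∈ Total.interior S
    · exact Or.inl hw
    · obtain ⟨e, he⟩ := HalfEdge.exists_mem_toSet hw
      obtain ⟨u, hu⟩ := e.exists_pt_eq hS he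
      refine Or.inr ⟨e, u, (HalfEdge.mem_toSet.1 he).1.symm, ?_⟩
      rw [hu]
      rfl
  have hsideF : ∀ (e : HalfEdge S) u, e.vertex = l →
      F₀ (n (e.pt hS u).y) (e.pt hS u).x =
        sgn (ε l) * ((η e).pt hS (flip (ε l) u)).x := by
    rintro e u rfl
    rw [HalfEdge.pt_y, hF e.side _ (e.interval_subset_sideSet
      (HalfEdge.mem_toSet.1 (e.pt_mem hS u)).2.2)]
    exact hφ e.side e u rfl rfl
  have hmem : ∀ w : (S l).carrier, (sgn (ε l) * F₀ (n w.1.2) w.1.1,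
      heightMap (S l) (S (ν l)) (τ l) w.1.2) ∈ (S (ν l)).carrier := by
    intro w
    rcases hcases w with hw | ⟨e, u, rfl, hw⟩
    · exact (S (ν l)).interior_subset ⟨mem_univ _, heightMap_mem_Ioo _ _ _ hw⟩
    · rw [hw]
      dsimp only
      rw [hsideF e u rfl, ← mul_assoc, sgn_mul_self, one_mul, HalfEdge.pt_y, heightMap_level]
      have h5 := ((η e).pt hS (flip (ε e.vertex) u)).2.2
      have h6 : ((η e).pt hS (flip (ε e.vertex) u)).2.1 =
          (((η e).pt hS (flip (ε e.vertex) u)).x,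
            (S (η e).vertex).level (η e).side) := rfl
      rw [h6] at h5
      rw [HalfEdge.pt_fst, hv, hs] at h5
      exact h5
  refine ⟨fun w => ⟨_, hmem w⟩, fun y => F₀ (n y), ?_, fun w => rfl, fun w => rfl,
    fun y hy => h2 _ (hnI y hy), fun s x hx x' hx' hxx => ?_, ?_⟩
  · refine Continuous.subtype_mk (Continuous.prodMk (continuous_const.mul ?_)
      ((continuous_heightMap _ _ _).comp (continuous_snd.comp continuous_subtype_val))) _
    rw [continuous_iff_continuousAt]
    intro w
    have hc : ContinuousAt (fun p : ℝ × ℝ => F₀ p.1 p.2) (n w.1.2, w.1.1) := by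
      refine h3 _ _ ?_
      rcases hcases w with hw | ⟨e, u, he, hw⟩
      · exact Or.inl (hnI _ hw)
      · have hx : w.1.1 ∈ (S l).sideSet e.side := by
          subst he
          rw [hw]
          exact e.interval_subset_sideSet (HalfEdge.mem_toSet.1 (e.pt_mem hS u)).2.2
        have hy : w.1.2 = (S l).level e.side := by rw [hw, ← he]; rfl
        right
        rcases Int.units_eq_one_or e.side with h6 | h6 <;> rw [h6] at hx hy <;> rw [hy]
        · exact Or.inr ⟨by simp [hn, Strip.level, div_self hlt.ne'], hx⟩
        · exact Or.inl ⟨by simp [hn, Strip.level], hx⟩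
    exact ContinuousAt.comp (f := fun w : (S l).carrier => (n w.1.2, w.1.1)) hc
      ((hnc.comp (continuous_snd.comp continuous_subtype_val)).prodMk
        (continuous_fst.comp continuous_subtype_val)).continuousAt
  · dsimp only
    rw [hF s x hx, hF s x' hx']
    exact hφm s hx hx' hxx
  · intro e u he w hw
    dsimp only
    rw [hw]
    dsimp only
    rw [hsideF e u he, ← mul_assoc, sgn_mul_self, one_mul]

include hv hs hinc hdec in
/-- A permutation of the boundary intervals that respects strips, sides and orders is realized by a
homeomorphism of the strips. -/
theorem exists_homeomorph_of_perm : ∃ k : Total S ≃ₜ Total S,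
    (∀ p, (k p).1 = ν p.1) ∧ (∀ p, k p ∈ Total.interior S ↔ p ∈ Total.interior S) ∧
    (∀ p p' : Total S, p.1 = p'.1 → p.y = p'.y → (k p).y = (k p').y) ∧
    (∀ p p' : Total S, p.1 = p'.1 → p.y < p'.y → 0 < sgn (τ p.1) * ((k p').y - (k p).y)) ∧
    (∀ p p' : Total S, p.1 = p'.1 → p.y = p'.y → p.x < p'.x →
      0 < sgn (ε p.1) * ((k p').x - (k p).x)) ∧
    ∀ (e : HalfEdge S) (u : HalfEdge.UnitIoo), k (e.pt hS u) =
      (η e).pt hS (flip (ε e.vertex) u) := by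
  choose F f hF hy hx hf hm he using exists_strip_map hS hv hs hinc hdec
  set k : Total S → Total S := Sigma.map ν F with hk
  have kv : ∀ p, (k p).1 = ν p.1 := fun p => rfl
  have ky : ∀ p : Total S, (k p).y = heightMap (S p.1) (S (ν p.1)) (τ p.1) p.y :=
    fun p => hy p.1 p.2
  have kx : ∀ p : Total S, (k p).x = sgn (ε p.1) * f p.1 p.y p.x := fun p => hx p.1 p.2
  have ke : ∀ (e : HalfEdge S) (u : HalfEdge.UnitIoo), k (e.pt hS u) =
      (η e).pt hS (flip (ε e.vertex) u) := by
    intro e u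
    refine Total.ext_iff'.2 ⟨(hv e).symm, he e.vertex e u rfl (e.pt hS u).2 rfl, ?_⟩
    rw [ky, HalfEdge.pt_y, HalfEdge.pt_y, hv, hs]
    exact heightMap_level _ _ _ _
  have kc : Continuous k := continuous_sigma_map.2 hF
  have hedge : ∀ e : HalfEdge S, ∀ p ∈ e.toSet, k p ∈ (η e).toSet := by
    intro e p hp
    obtain ⟨u, rfl⟩ := e.exists_pt_eq hS hp
    rw [ke]
    exact HalfEdge.pt_mem _ _ _
  have hint : ∀ p, k p ∈ Total.interior S ↔ p ∈ Total.interior S := by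
    intro p
    refine ⟨fun hp => ?_, fun hp => ?_⟩
    · by_contra hn
      obtain ⟨e, hp'⟩ := HalfEdge.exists_mem_toSet hn
      exact HalfEdge.notMem_interior (hedge e p hp') hp
    · change (k p).y ∈ Ioo (S (ν p.1)).lo (S (ν p.1)).hi
      rw [ky]
      exact heightMap_mem_Ioo _ _ _ hp
  have hinj : Function.Injective k := by
    intro p p' hpp
    by_cases hp : p ∈ Total.interior S
    · have hpv : p.1 = p'.1 := ν.injective
        (congrArg Sigma.fst hpp : (k p).1 = (k p').1)
      have hyy : p.y = p'.y := by
        have h := congrArg Total.y hpp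
        rw [ky, ky, ← hpv] at h
        exact heightMap_injective _ _ _ h
      refine Total.ext_iff'.2 ⟨hpv, ?_, hyy⟩
      have h := congrArg Total.x hpp
      rw [kx, kx, ← hpv, ← hyy] at h
      refine (hf _ _ hp).1.injective (mul_left_cancel₀ (a := sgn (ε p.1)) (fun h0 => ?_) h)
      have := sgn_mul_self (ε p.1)
      rw [h0] at this
      simp at this
    · have hp' : p' ∉ Total.interior S := by rwa [← hint, ← hpp, hint]
      obtain ⟨e, h1⟩ := HalfEdge.exists_mem_toSet hp
      obtain ⟨e', h1'⟩ := HalfEdge.exists_mem_toSet hp'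
      have h2 := hedge e p h1
      rw [hpp] at h2
      have h3 : e = e' := η.injective (HalfEdge.eq_of_mem_toSet h2 (hedge e' p' h1'))
      subst h3
      obtain ⟨u, rfl⟩ := e.exists_pt_eq hS h1
      obtain ⟨u', rfl⟩ := e.exists_pt_eq hS h1'
      rw [ke, ke] at hpp
      rw [flip_injective _ (HalfEdge.pt_injective hS _ hpp)]
  have hsurj : Function.Surjective k := by
    intro p
    by_cases hp : p ∈ Total.interior S
    · obtain ⟨l, w⟩ := p
      obtain ⟨l, rfl⟩ := ν.surjective l
      set y := heightMap (S (ν l)) (S l) (τ l) w.1.2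
      have hyI : y ∈ Ioo (S l).lo (S l).hi := heightMap_mem_Ioo _ _ _ hp
      obtain ⟨x, hxx⟩ := (hf l y hyI).2 (sgn (ε l) * w.1.1)
      refine ⟨Total.mkInt l x y hyI, Total.ext_iff'.2 ⟨rfl, ?_, ?_⟩⟩
      · rw [kx]
        change sgn (ε l) * f l y x = w.1.1
        rw [hxx, ← mul_assoc, sgn_mul_self, one_mul]
      · rw [ky]
        exact heightMap_heightMap _ _ _ _
    · obtain ⟨e, he⟩ := HalfEdge.exists_mem_toSet hp
      obtain ⟨e, rfl⟩ := η.surjective e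
      obtain ⟨u, rfl⟩ := HalfEdge.exists_pt_eq hS _ he
      exact ⟨e.pt hS (flip (ε e.vertex) u), by
        rw [ke, flip_self]⟩
  have hrow : ∀ p p' : Total S, p.1 = p'.1 → p.y = p'.y → (k p).y = (k p').y := by
    intro p p' hpv hyy
    rw [ky, ky, hpv, hyy]
  have hheight : ∀ p p' : Total S, p.1 = p'.1 → p.y < p'.y →
      0 < sgn (τ p.1) * ((k p').y - (k p).y) := by
    intro p p' hpv hyy
    rw [ky, ky, ← hpv]
    exact sgn_mul_heightMap_sub_pos _ _ _ hyy
  have horder : ∀ p p' : Total S, p.1 = p'.1 → p.y = p'.y → p.x < p'.x →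
      0 < sgn (ε p.1) * ((k p').x - (k p).x) := by
    intro p p' hpv hyy hxx
    have hle : f p.1 p.y p.x ≤ f p.1 p.y p'.x := by
      by_cases hp : p ∈ Total.interior S
      · exact (hf _ _ hp).1.monotone hxx.le
      · obtain ⟨e, he⟩ := HalfEdge.exists_mem_toSet hp
        obtain ⟨h1, h2, h3⟩ := HalfEdge.mem_toSet.1 he
        rw [← h1] at h2
        have hside : ∀ {p' : Total S}, p.1 = p'.1 → p.y = p'.y →
            p'.x ∈ (S p.1).sideSet e.side := by
          intro p' hpv hyy
          change (p'.x, _) ∈ (S p.1).carrier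
          rw [← h2, hyy, hpv]
          exact p'.2.2
        rw [h2]
        exact hm _ _ (hside rfl rfl) (hside hpv hyy) hxx.le
    have hne : (k p').x ≠ (k p).x := fun h => hxx.ne' (congrArg Total.x (hinj
      (Total.ext_iff'.2 ⟨(congrArg ν hpv).symm, h, (hrow p p' hpv hyy).symm⟩)))
    rw [kx, kx, ← hpv, ← hyy] at hne ⊢
    rw [← mul_sub, ← mul_assoc, sgn_mul_self, one_mul, sub_pos]
    exact hle.lt_of_ne fun h => hne (by rw [h])
  refine ⟨(isHomeomorph_sigmaMap ν F kc ⟨hinj, hsurj⟩ τ ε hrow hheight horder).homeomorph,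
    kv, hint, hrow, hheight, horder, ke⟩

end Family

namespace StripedAtlas

variable {Z : Type u} [TopologicalSpace Z] {A : StripedAtlas.{u, v, w} Z} (hA : A.IsAffine)

include hA in
/-- Every automorphism of the graph is induced by a homeomorphism of the strips. -/
theorem exists_homeomorph_induces (a : A.graph.Aut) : ∃ k : Total A.S ≃ₜ Total A.S, Induces k a ∧
    ∀ (e : HalfEdge A.S) (u : HalfEdge.UnitIoo), k (e.pt hA.1 u) =
      HalfEdge.pt (S := A.S) hA.1 (a.η e) (flip (a.lori e.vertex) u) := by
  obtain ⟨k, h1, h2, h3, h4, h5, h6⟩ := exists_homeomorph_of_perm (S := A.S) hA.1 (ν := a.ν)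
    (η := a.η) (ε := a.lori) (τ := a.tori) a.vertex_η a.side_η
    (fun e f hv hs hl h => a.increasing _ _ hl e ⟨rfl, rfl⟩ f ⟨hv.symm, hs.symm⟩ h)
    (fun e f hv hs hl h => a.decreasing _ _ hl e ⟨rfl, rfl⟩ f ⟨hv.symm, hs.symm⟩ h)
  refine ⟨k, ⟨h1, h2, h3, h4, h5, fun e p hp => ?_⟩, h6⟩
  obtain ⟨u, rfl⟩ := e.exists_pt_eq hA.1 hp
  rw [h6]
  exact HalfEdge.pt_mem _ _ _

/-- The homeomorphism of the strips that realizes an automorphism of the graph descends to `Z`: it is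
affine on the boundary intervals, and the condition on `σ` makes it compatible with the gluing maps. -/
theorem graphAction_surjective (hr : A.IsReduced) : Function.Surjective (graphAction hA hr) := by
  intro a
  obtain ⟨k, hk, ke⟩ := exists_homeomorph_induces hA a
  have hξ : ∀ e : HalfEdge A.S, (a.η (A.ξ e) : HalfEdge A.S) = A.ξ (a.η e) := fun e =>
    (a.comm_ξ e).symm
  have key : ∀ (e : HalfEdge A.S) (u : HalfEdge.UnitIoo), A.ξ e ≠ e →
      k ((A.ξ e).pt hA.1 (flip (A.σ e) u)) = HalfEdge.pt (S := A.S) hA.1 (A.ξ (a.η e))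
        (flip (A.σ (a.η e)) (flip (a.lori e.vertex) u)) := by
    intro e u he
    have hg : a.lori e.vertex * A.σ e = A.σ (a.η e) * a.lori (A.ξ e).vertex := a.gluing e he
    rw [ke, hξ, flip_flip, flip_flip]
    congr 2
    calc a.lori (A.ξ e).vertex * A.σ e
        = a.lori e.vertex * (a.lori e.vertex * A.σ e) * a.lori (A.ξ e).vertex := by
          rw [← mul_assoc, Int.units_mul_self, one_mul, mul_comm]
      _ = A.σ (a.η e) * a.lori e.vertex := by
          rw [hg, mul_assoc, mul_assoc, Int.units_mul_self, mul_one, mul_comm]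
  obtain ⟨g, hg⟩ := exists_descent k fun p p' => by
    constructor
    · rw [q_eq_iff hA (p := p)]
      rintro (rfl | ⟨e, u, he, rfl, rfl⟩)
      · rfl
      · rw [key e u he, ke]
        refine (glue_iff hA (e := a.η e) (fun h => he (a.η.injective ?_)) _ _).2 rfl
        exact (hξ e).trans h
    · intro hc
      by_cases hp : p ∈ Total.interior A.S
      · rw [q_eq_iff_of_mem_interior hA ((hk.mem_interior p).2 hp)] at hc
        rw [k.injective hc]
      · obtain ⟨e, he⟩ := HalfEdge.exists_mem_toSet hp
        obtain ⟨u, rfl⟩ := e.exists_pt_eq hA.1 he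
        have hc' := (q_pt_eq_iff hA (e := a.η e)).1 ((congrArg A.q (ke e u)).symm.trans hc)
        rw [← ke] at hc'
        rcases hc' with h1 | ⟨hne, h1⟩
        · rw [k.injective h1]
        · have hne' : A.ξ e ≠ e := fun h => hne (by rw [← hξ, h])
          rw [← key e u hne'] at h1
          rw [k.injective h1]
          exact (glue_iff hA hne' _ _).2 rfl
  exact ⟨⟨g, isFoliated_of_induces hA hk hg⟩, graphAction_eq hA hr (fun p => (hg p).symm) hk⟩

end StripedAtlas

/-! ### The universal covering of the open cylinder and of the open Möbius band -/

/-- The foliated band obtained from `ℝ × [0, 1]` by gluing `(x, 0)` with `(ε x, 1)`: the cylinder for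
`ε = 1`, and the Möbius band for `ε = -1`. -/
abbrev SignBand (ε : ℤˣ) : Type := Band fun x => sgn ε * x

/-- The action of an integer on the plane as a deck transformation of the universal covering of a
band. -/
def deck (ε : ℤˣ) (n : ℤ) (w : ℝ × ℝ) : ℝ × ℝ := (sgn (ε ^ n) * w.1, w.2 + n)

section Deck

variable (ε : ℤˣ)

@[simp] theorem deck_zero (w : ℝ × ℝ) : deck ε 0 w = w := by simp [deck]

theorem deck_add (m n : ℤ) (w : ℝ × ℝ) : deck ε (m + n) w = deck ε m (deck ε n w) := by
  simp only [deck, zpow_add, sgn_mul, Int.cast_add, Prod.mk.injEq]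
  constructor <;> ring

theorem deck_neg_deck (n : ℤ) (w : ℝ × ℝ) : deck ε (-n) (deck ε n w) = w := by
  rw [← deck_add, neg_add_cancel, deck_zero]

theorem continuous_deck (n : ℤ) : Continuous (deck ε n) := by
  unfold deck
  fun_prop

/-- The universal covering of a band. -/
def bandCover (w : ℝ × ℝ) : SignBand ε :=
  Quot.mk _ (sgn (ε ^ ⌊w.2⌋) * w.1, ⟨Int.fract w.2, Int.fract_nonneg _, (Int.fract_lt_one _).le⟩)

theorem bandCover_eq_mk (n : ℤ) (w : ℝ × ℝ) (h : w.2 - n ∈ Icc (0 : ℝ) 1) :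
    bandCover ε w = Quot.mk _ (sgn (ε ^ n) * w.1, ⟨w.2 - n, h⟩) := by
  rcases h.2.lt_or_eq with h1 | h1
  · have hf : ⌊w.2⌋ = n := Int.floor_eq_iff.2 ⟨by linarith [h.1], by linarith⟩
    unfold bandCover
    congr 3
    · rw [hf]
    · rw [Int.fract, hf]
  · have hw : w.2 = (n + 1 : ℤ) := by push_cast; linarith
    have hf : ⌊w.2⌋ = n + 1 := by rw [hw, Int.floor_intCast]
    refine Quot.sound ⟨Subtype.ext ?_, Subtype.ext h1, ?_⟩
    · change Int.fract w.2 = 0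
      rw [hw, Int.fract_intCast]
    · dsimp only
      rw [hf, zpow_add_one, sgn_mul]
      linear_combination -(sgn (ε ^ n) * w.1) * sgn_mul_self ε

theorem bandCover_of_mem (x : ℝ) (t : unitInterval) :
    bandCover ε (x, t) = Quot.mk _ (x, t) := by
  have h := bandCover_eq_mk ε 0 (x, t) (by simp)
  simpa using h

theorem bandCover_deck (n : ℤ) (w : ℝ × ℝ) : bandCover ε (deck ε n w) = bandCover ε w := by
  have h1 : sgn (ε ^ ⌊w.2 + n⌋) * (sgn (ε ^ n) * w.1) = sgn (ε ^ ⌊w.2⌋) * w.1 := by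
    rw [Int.floor_add_intCast, zpow_add, sgn_mul, mul_assoc, ← mul_assoc (sgn (ε ^ n)),
      sgn_mul_self, one_mul]
  exact congrArg (Quot.mk _) (Prod.ext h1 (Subtype.ext (Int.fract_add_intCast w.2 n)))

theorem surjective_bandCover : Function.Surjective (bandCover ε) := by
  rintro ⟨x, t⟩
  exact ⟨(x, t), bandCover_of_mem ε x t⟩

theorem bandCover_eq_iff {w w' : ℝ × ℝ} :
    bandCover ε w = bandCover ε w' ↔ ∃ n : ℤ, deck ε n w' = w := by
  constructor
  · intro h
    -- a point of the band determines the orbit of its preimages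
    set orb : ℝ × ℝ → Set (ℝ × ℝ) := fun w => range fun n : ℤ => deck ε n w with horb
    have horbd : ∀ n w, orb (deck ε n w) = orb w := by
      intro n w
      ext v
      constructor
      · rintro ⟨m, rfl⟩
        exact ⟨m + n, deck_add ε m n w⟩
      · rintro ⟨m, rfl⟩
        exact ⟨m - n, by dsimp only; rw [← deck_add, sub_add_cancel]⟩
    set Φ : SignBand ε → Set (ℝ × ℝ) := Quot.lift (fun p => orb (p.1, p.2)) (by
      rintro ⟨x, t⟩ ⟨x', t'⟩ ⟨h1, h2, h3⟩
      dsimp only at h1 h2 h3 ⊢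
      subst h1 h2 h3
      rw [← horbd 1 (x, _)]
      simp [deck]) with hΦ
    have hΦw : ∀ w, Φ (bandCover ε w) = orb w := by
      intro w
      change orb (sgn (ε ^ ⌊w.2⌋) * w.1, Int.fract w.2) = orb w
      rw [← horbd (-⌊w.2⌋) w]
      congr 2
      · simp only [zpow_neg]
        rw [Int.units_inv_eq_self]
      · rw [Int.fract, sub_eq_add_neg, Int.cast_neg]
    have h1 : orb w = orb w' := by rw [← hΦw, ← hΦw, h]
    have h2 : w ∈ orb w := ⟨0, deck_zero ε w⟩
    rw [h1] at h2
    exact h2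
  · rintro ⟨n, rfl⟩
    exact bandCover_deck ε n w'

theorem continuous_bandCover : Continuous (bandCover ε) := by
  refine LocallyFinite.continuous (f := fun n : ℤ => {w : ℝ × ℝ | w.2 ∈ Icc (n : ℝ) (n + 1)})
    ?_ ?_ ?_ ?_
  · have h : LocallyFinite fun n : ℤ => Icc (n : ℝ) (n + 1) := by
      intro x
      refine ⟨Ioo (x - 1) (x + 1), Ioo_mem_nhds (by linarith) (by linarith), ?_⟩
      refine (Set.finite_Icc (⌊x⌋ - 2) (⌊x⌋ + 2)).subset ?_
      rintro n ⟨y, ⟨h1, h2⟩, h3, h4⟩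
      have h5 := Int.floor_le x
      have h6 := Int.lt_floor_add_one x
      constructor
      · have : (⌊x⌋ : ℝ) < (n : ℝ) + 2 := by linarith
        have : ⌊x⌋ < n + 2 := by exact_mod_cast this
        omega
      · have : (n : ℝ) < (⌊x⌋ : ℝ) + 2 := by linarith
        have : n < ⌊x⌋ + 2 := by exact_mod_cast this
        omega
    exact h.preimage_continuous continuous_snd
  · refine eq_univ_of_forall fun w => mem_iUnion.2 ⟨⌊w.2⌋, Int.floor_le _, ?_⟩
    exact (Int.lt_floor_add_one w.2).le
  · exact fun n => isClosed_Icc.preimage continuous_snd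
  · intro n
    rw [continuousOn_iff_continuous_domRestrict]
    have h : ∀ w : {w : ℝ × ℝ | w.2 ∈ Icc (n : ℝ) (n + 1)}, w.1.2 - n ∈ Icc (0 : ℝ) 1 := fun w =>
      ⟨sub_nonneg.2 w.2.1, by linarith [w.2.2]⟩
    have h1 : domRestrict {w : ℝ × ℝ | w.2 ∈ Icc (n : ℝ) (n + 1)} (bandCover ε) = fun w =>
        Quot.mk _ (sgn (ε ^ n) * w.1.1, (⟨w.1.2 - n, h w⟩ : unitInterval)) :=
      funext fun w => bandCover_eq_mk ε n w (h w)
    rw [h1]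
    refine continuous_quot_mk.comp (Continuous.prodMk (by fun_prop) (Continuous.subtype_mk ?_ _))
    fun_prop

theorem isQuotientMap_bandCover : IsQuotientMap (bandCover ε) := by
  have h1 : Continuous fun p : ℝ × unitInterval => ((p.1, (p.2 : ℝ)) : ℝ × ℝ) := by fun_prop
  refine IsQuotientMap.of_comp h1 (continuous_bandCover ε) ?_
  have h2 : bandCover ε ∘ (fun p : ℝ × unitInterval => ((p.1, (p.2 : ℝ)) : ℝ × ℝ)) = Quot.mk _ :=
    funext fun p => bandCover_of_mem ε p.1 p.2
  rw [h2]
  exact isQuotientMap_quot_mk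

/-- The action of the deck transformations on the plane. -/
@[reducible] def deckAction : AddAction ℤ (ℝ × ℝ) where
  vadd := deck ε
  zero_vadd := deck_zero ε
  add_vadd := deck_add ε

theorem isCoveringMap_bandCover : IsCoveringMap (bandCover ε) := by
  let _ := deckAction ε
  have h : IsAddQuotientCoveringMap (bandCover ε) ℤ :=
    { toIsQuotientMap := isQuotientMap_bandCover ε
      continuous_const_vadd := continuous_deck ε
      apply_eq_iff_mem_orbit := bandCover_eq_iff ε
      disjoint := by
        intro w
        refine ⟨univ ×ˢ Ioo (w.2 - 1 / 2) (w.2 + 1 / 2),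
          prod_mem_nhds univ_mem (Ioo_mem_nhds (by linarith) (by linarith)), fun n => ?_⟩
        rintro ⟨_, ⟨v, ⟨-, h1, h2⟩, rfl⟩, -, h3, h4⟩
        change w.2 - 1 / 2 < v.2 + n at h3
        change v.2 + n < w.2 + 1 / 2 at h4
        have h5 : (-1 : ℝ) < n := by linarith
        have h6 : (n : ℝ) < 1 := by linarith
        have h5' : -1 < n := by exact_mod_cast h5
        have h6' : n < 1 := by exact_mod_cast h6
        omega }
  exact h.isCoveringMap

theorem bandFoliation_eq : bandFoliation (fun x => sgn ε * x) =
    range fun t : ℝ => bandCover ε '' {w | w.2 = t} := by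
  have key : ∀ (n : ℤ) (t : ℝ),
      bandCover ε '' {w | w.2 = t + n} = bandCover ε '' {w | w.2 = t} := by
    intro n t
    ext z
    constructor
    · rintro ⟨w, hw, rfl⟩
      refine ⟨deck ε (-n) w, ?_, bandCover_deck ε _ w⟩
      change w.2 + ((-n : ℤ) : ℝ) = t
      rw [show w.2 = t + n from hw]
      push_cast
      ring
    · rintro ⟨w, hw, rfl⟩
      refine ⟨deck ε n w, ?_, bandCover_deck ε _ w⟩
      change w.2 + n = t + n
      rw [show w.2 = t from hw]
  have h : ∀ t : unitInterval, range (fun x : ℝ => (Quot.mk _ (x, t) : SignBand ε)) =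
      bandCover ε '' {w | w.2 = t} := by
    intro t
    ext z
    constructor
    · rintro ⟨x, rfl⟩
      exact ⟨(x, t), rfl, bandCover_of_mem ε x t⟩
    · rintro ⟨w, hw, rfl⟩
      refine ⟨w.1, ?_⟩
      dsimp only
      rw [← bandCover_of_mem, ← show w.2 = t from hw]
  ext L
  constructor
  · rintro ⟨t, rfl⟩
    exact ⟨t, (h t).symm⟩
  · rintro ⟨t, rfl⟩
    refine ⟨⟨Int.fract t, Int.fract_nonneg _, (Int.fract_lt_one _).le⟩, ?_⟩
    refine (h _).trans ?_
    rw [← key ⌊t⌋]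
    exact congrArg (fun s => bandCover ε '' {w | w.2 = s}) (Int.fract_add_floor t)

end Deck

/-! ### Lifts of foliated homeomorphisms of a band to the plane -/

section Lifts

variable (ε : ℤˣ)

/-- The group of foliated homeomorphisms of a band. -/
abbrev BandGroup : Type := homeoGroup (bandFoliation fun x => sgn ε * x)

/-- The pairs of a foliated homeomorphism and of a point over the image of the base point; they
correspond to the lifts of foliated homeomorphisms to the plane. -/
abbrev LiftSpace : Type := {x : BandGroup ε × (ℝ × ℝ) // bandCover ε x.2 = x.1.1 (bandCover ε 0)}

theorem continuous_bandGroup_apply :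
    Continuous fun x : BandGroup ε × (ℝ × ℝ) => x.1.1 (bandCover ε x.2) :=
  continuous_homeoGroup_apply (continuous_bandCover ε)

/-- The lifts depend continuously on the homeomorphism and on the image of the origin: they are
obtained by lifting the homotopy `(s, w) ↦ h (p (s w))`. -/
theorem exists_bandLift : ∃ L : LiftSpace ε × (ℝ × ℝ) → ℝ × ℝ, Continuous L ∧
    (∀ x w, bandCover ε (L (x, w)) = x.1.1.1 (bandCover ε w)) ∧ ∀ x, L (x, 0) = x.1.2 := by
  have cov := isCoveringMap_bandCover ε
  have hHc : Continuous fun y : unitInterval × (LiftSpace ε × (ℝ × ℝ)) =>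
      y.2.1.1.1.1 (bandCover ε ((y.1 : ℝ) • y.2.2)) := by
    have h1 : Continuous fun y : unitInterval × (LiftSpace ε × (ℝ × ℝ)) =>
        (y.2.1.1.1, (y.1 : ℝ) • y.2.2) :=
      (continuous_fst.comp (continuous_subtype_val.comp
        (continuous_fst.comp continuous_snd))).prodMk
        ((continuous_subtype_val.comp continuous_fst).smul (continuous_snd.comp continuous_snd))
    exact (continuous_bandGroup_apply ε).comp h1
  set H : C(unitInterval × (LiftSpace ε × (ℝ × ℝ)), SignBand ε) := ⟨_, hHc⟩ with hH
  set f : C(LiftSpace ε × (ℝ × ℝ), ℝ × ℝ) := ⟨fun y => y.1.1.2,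
    continuous_snd.comp (continuous_subtype_val.comp continuous_fst)⟩ with hf
  have h0 : ∀ y, H (0, y) = bandCover ε (f y) := by
    rintro ⟨x, w⟩
    change x.1.1.1 (bandCover ε (((0 : unitInterval) : ℝ) • w)) = bandCover ε x.1.2
    rw [x.2, Icc.coe_zero, zero_smul]
  refine ⟨fun y => cov.liftHomotopy H f h0 (1, y),
    (cov.liftHomotopy H f h0).continuous.comp (by fun_prop), fun x w => ?_, fun x => ?_⟩
  · have h1 := congrFun (cov.liftHomotopy_lifts H f h0) (1, (x, w))
    have h2 : H (1, (x, w)) = x.1.1.1 (bandCover ε w) := by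
      change x.1.1.1 (bandCover ε (((1 : unitInterval) : ℝ) • w)) = _
      rw [Icc.coe_one, one_smul]
    exact h1.trans h2
  · have h1 : Continuous fun s => cov.liftHomotopy H f h0 (s, (x, 0)) :=
      (cov.liftHomotopy H f h0).continuous.comp (by fun_prop)
    have h2 : ∀ s, bandCover ε (cov.liftHomotopy H f h0 (s, (x, 0))) =
        x.1.1.1 (bandCover ε 0) := by
      intro s
      refine (congrFun (cov.liftHomotopy_lifts H f h0) (s, (x, 0))).trans ?_
      change x.1.1.1 (bandCover ε ((s : ℝ) • (0 : ℝ × ℝ))) = _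
      rw [smul_zero]
    exact (cov.const_of_comp h1 (fun s s' => (h2 s).trans (h2 s').symm) 1 0).trans
      (cov.liftHomotopy_zero H f h0 (x, 0))

/-- The lift to the plane of a foliated homeomorphism of a band with given value at the origin. -/
def bandLift (x : LiftSpace ε) (w : ℝ × ℝ) : ℝ × ℝ := (exists_bandLift ε).choose (x, w)

theorem continuous_bandLift : Continuous fun y : LiftSpace ε × (ℝ × ℝ) => bandLift ε y.1 y.2 :=
  (exists_bandLift ε).choose_spec.1

variable {ε}

theorem bandCover_bandLift (x : LiftSpace ε) (w : ℝ × ℝ) :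
    bandCover ε (bandLift ε x w) = x.1.1.1 (bandCover ε w) :=
  (exists_bandLift ε).choose_spec.2.1 x w

theorem bandLift_zero (x : LiftSpace ε) : bandLift ε x 0 = x.1.2 :=
  (exists_bandLift ε).choose_spec.2.2 x

theorem continuous_bandLift_right (x : LiftSpace ε) : Continuous (bandLift ε x) :=
  (continuous_bandLift ε).comp (Continuous.prodMk_right x)

/-- Two lifts of the same map differ by a deck transformation. -/
theorem exists_deck_eq {L L' : ℝ × ℝ → ℝ × ℝ} (hL : Continuous L) (hL' : Continuous L')
    (h : ∀ w, bandCover ε (L w) = bandCover ε (L' w)) : ∃ n, ∀ w, L w = deck ε n (L' w) := by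
  obtain ⟨n, hn⟩ := (bandCover_eq_iff ε).1 (h 0)
  refine ⟨n, congrFun ((isCoveringMap_bandCover ε).eq_of_comp_eq hL
    ((continuous_deck ε n).comp hL') (funext fun w => ?_) 0 hn.symm)⟩
  exact (h w).trans (bandCover_deck ε n _).symm

theorem bandLift_unique {x : LiftSpace ε} {L : ℝ × ℝ → ℝ × ℝ} (hL : Continuous L)
    (h : ∀ w, bandCover ε (L w) = x.1.1.1 (bandCover ε w)) (h0 : L 0 = x.1.2) :
    L = bandLift ε x :=
  (isCoveringMap_bandCover ε).eq_of_comp_eq hL (continuous_bandLift_right x)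
    (funext fun w => (h w).trans (bandCover_bandLift x w).symm) 0 (h0.trans (bandLift_zero x).symm)

theorem deck_snd (n : ℤ) (w : ℝ × ℝ) : (deck ε n w).2 = w.2 + n := rfl

theorem deck_right_injective {m n : ℤ} {w : ℝ × ℝ} (h : deck ε m w = deck ε n w) : m = n := by
  have h1 := congrArg Prod.snd h
  rw [deck_snd, deck_snd, add_right_inj] at h1
  exact_mod_cast h1

/-- The lift as a homeomorphism of the plane. -/
theorem exists_homeomorph_eq_bandLift (x : LiftSpace ε) :
    ∃ K : (ℝ × ℝ) ≃ₜ (ℝ × ℝ), ∀ w, K w = bandLift ε x w := by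
  obtain ⟨b, hb⟩ := surjective_bandCover ε ((x.1.1⁻¹ : BandGroup ε).1 (bandCover ε 0))
  set y : LiftSpace ε := ⟨(x.1.1⁻¹, b), hb⟩ with hy
  have hL := continuous_bandLift_right x
  have hL' := continuous_bandLift_right y
  have hinv : ∀ z, (x.1.1⁻¹ : BandGroup ε).1 (x.1.1.1 z) = z := fun z =>
    x.1.1.1.symm_apply_apply z
  have hinv' : ∀ z, x.1.1.1 ((x.1.1⁻¹ : BandGroup ε).1 z) = z := fun z =>
    x.1.1.1.apply_symm_apply z
  obtain ⟨n, hn⟩ := exists_deck_eq (ε := ε) (hL'.comp hL) continuous_id fun w => by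
    rw [Function.comp_apply, bandCover_bandLift, bandCover_bandLift]
    exact hinv _
  simp only [Function.comp_apply, id_eq] at hn
  set M : ℝ × ℝ → ℝ × ℝ := fun w => deck ε (-n) (bandLift ε y w) with hM
  have hMc : Continuous M := (continuous_deck ε _).comp hL'
  have hML : ∀ w, M (bandLift ε x w) = w := fun w => by
    simp only [hM, hn, deck_neg_deck]
  obtain ⟨m, hm⟩ := exists_deck_eq (ε := ε) (hL.comp hMc) continuous_id fun w => by
    rw [Function.comp_apply, bandCover_bandLift, hM]
    dsimp only
    rw [bandCover_deck, bandCover_bandLift]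
    exact hinv' _
  simp only [Function.comp_apply, id_eq] at hm
  have hm0 : m = 0 := by
    have h1 := hm (bandLift ε x 0)
    rw [hML] at h1
    exact (deck_right_injective ((deck_zero ε _).trans h1)).symm
  refine ⟨⟨⟨bandLift ε x, M, hML, fun w => ?_⟩, hL, hMc⟩, fun w => rfl⟩
  rw [hm, hm0, deck_zero]

/-- `K` is a lift of the foliated homeomorphism `h` to the plane. -/
def IsBandLift (K : (ℝ × ℝ) ≃ₜ (ℝ × ℝ)) (h : BandGroup ε) : Prop :=
  ∀ w, bandCover ε (K w) = h.1 (bandCover ε w)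

namespace IsBandLift

variable {K K' : (ℝ × ℝ) ≃ₜ (ℝ × ℝ)} {h h' : BandGroup ε}

theorem symm (hK : IsBandLift K h) : IsBandLift K.symm h⁻¹ := fun w => by
  have h1 := hK (K.symm w)
  rw [K.apply_symm_apply] at h1
  rw [h1]
  exact (h.1.symm_apply_apply _).symm

theorem mul (hK : IsBandLift K h) (hK' : IsBandLift K' h') : IsBandLift (K'.trans K) (h * h') :=
  fun w => (hK (K' w)).trans (congrArg h.1 (hK' w))

/-- A line is mapped to a lift of a leaf, a union of lines whose heights differ by integers, and by
connectedness to one of these lines. -/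
theorem row (hK : IsBandLift K h) {w w' : ℝ × ℝ} (hw : w.2 = w'.2) : (K w).2 = (K w').2 := by
  have hleaf := h.2.1 (bandCover ε '' {v | v.2 = w.2}) (by rw [bandFoliation_eq]; exact ⟨_, rfl⟩)
  obtain ⟨t, ht⟩ := (bandFoliation_eq ε).subset hleaf
  have hint : ∀ x : ℝ, ∃ n : ℤ, (K (x, w.2)).2 = t + n := by
    intro x
    have h1 : bandCover ε (K (x, w.2)) ∈ bandCover ε '' {v | v.2 = t} := by
      rw [hK, show bandCover ε '' {v | v.2 = t} = _ from ht]
      exact mem_image_of_mem _ ⟨(x, w.2), rfl, rfl⟩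
    obtain ⟨v, hv, h2⟩ := h1
    obtain ⟨n, hn⟩ := (bandCover_eq_iff ε).1 h2.symm
    exact ⟨n, by rw [← hn, deck_snd, show v.2 = t from hv]⟩
  choose n hn using hint
  have hc : Continuous n := by
    rw [Int.isClosedEmbedding_coe_real.isInducing.continuous_iff]
    have h3 : ((↑) : ℤ → ℝ) ∘ n = fun x => (K (x, w.2)).2 - t := by
      funext x
      rw [hn, add_sub_cancel_left]
      rfl
    rw [h3]
    exact (continuous_snd.comp (K.continuous.comp (by fun_prop))).sub continuous_const
  have h4 : n w.1 = n w'.1 := PreconnectedSpace.constant inferInstance hc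
  have h5 := hn w.1
  have h6 := hn w'.1
  rw [show (w'.1, w.2) = w' by rw [hw]] at h6
  rw [show (w.1, w.2) = w from rfl] at h5
  rw [h5, h6, h4]

theorem exists_height_sign (hK : IsBandLift K h) :
    ∃ τ, ∀ w w' : ℝ × ℝ, w.2 < w'.2 → 0 < sgn τ * ((K w').2 - (K w).2) := by
  set g : ℝ → ℝ := fun t => (K (0, t)).2 with hg
  have hgc : Continuous g := continuous_snd.comp (K.continuous.comp (by fun_prop))
  have hgi : Function.Injective g := fun t t' h => by
    have h1 := hK.symm.row h
    rwa [K.symm_apply_apply, K.symm_apply_apply] at h1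
  have hKg : ∀ w, (K w).2 = g w.2 := fun w => hK.row rfl
  rcases hgc.strictMono_of_inj hgi with h1 | h1
  · exact ⟨1, fun w w' hw => by rw [hKg, hKg, sgn_one, one_mul, sub_pos]; exact h1 hw⟩
  · refine ⟨-1, fun w w' hw => ?_⟩
    rw [hKg, hKg, sgn_neg_one, neg_one_mul, neg_sub, sub_pos]
    exact h1 hw

theorem exists_order_sign (hK : IsBandLift K h) :
    ∃ δ, ∀ w w' : ℝ × ℝ, w.2 = w'.2 → w.1 < w'.1 → 0 < sgn δ * ((K w').1 - (K w).1) := by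
  have hinj : ∀ x x' t : ℝ, (K (x, t)).1 = (K (x', t)).1 → x = x' := fun x x' t h1 =>
    congrArg Prod.fst (K.injective (Prod.ext h1 (hK.row rfl)))
  have hF : Continuous fun t : ℝ => (K (1, t)).1 - (K (0, t)).1 :=
    (continuous_fst.comp (K.continuous.comp (by fun_prop))).sub
      (continuous_fst.comp (K.continuous.comp (by fun_prop)))
  obtain ⟨δ, hδ⟩ := exists_sign hF fun t ht => zero_ne_one (hinj 0 1 t (sub_eq_zero.1 ht).symm)
  refine ⟨δ, ?_⟩
  rintro ⟨x, t⟩ ⟨x', t'⟩ (rfl : t = t') (hx : x < x')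
  have hc : Continuous fun x : ℝ => (K (x, t)).1 :=
    continuous_fst.comp (K.continuous.comp (by fun_prop))
  have h2 := hδ t
  rcases hc.strictMono_of_inj fun a b hab => hinj a b t hab with h1 | h1
  · have h3 := h1 zero_lt_one
    have h4 := h1 hx
    have : δ = 1 := eq_of_sgn_mul_pos h2 (by rw [sgn_one, one_mul]; exact sub_pos.2 h3)
    rw [this, sgn_one, one_mul]
    exact sub_pos.2 h4
  · have h3 := h1 zero_lt_one
    have h4 := h1 hx
    have : δ = -1 := eq_of_sgn_mul_pos h2 (by
      rw [sgn_neg_one, neg_one_mul, neg_sub]; exact sub_pos.2 h3)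
    rw [this, sgn_neg_one, neg_one_mul, neg_sub]
    exact sub_pos.2 h4

/-- A lift conjugates the generator of the deck transformations to itself or to its inverse. -/
theorem exists_deck_comm (hK : IsBandLift K h) :
    ∃ n : ℤ, (n = 1 ∨ n = -1) ∧ ∀ w, K (deck ε 1 w) = deck ε n (K w) := by
  have key : ∀ {K : (ℝ × ℝ) ≃ₜ (ℝ × ℝ)} {h : BandGroup ε}, IsBandLift K h →
      ∃ n, ∀ w, K (deck ε 1 w) = deck ε n (K w) := fun {K h} hK =>
    exists_deck_eq (K.continuous.comp (continuous_deck ε 1)) K.continuous fun w => by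
      rw [hK, hK, bandCover_deck]
  obtain ⟨n, hn⟩ := key hK
  obtain ⟨m, hm⟩ := key hK.symm
  have hadd : ∀ j : ℕ, ∀ w, K (deck ε j w) = deck ε (n * j) (K w) ∧
      K (deck ε (-j) w) = deck ε (-(n * j)) (K w) := by
    intro j
    induction j with
    | zero => intro w; simp
    | succ j ih =>
      intro w
      constructor
      · rw [Nat.cast_succ, add_comm, deck_add, hn, (ih w).1, ← deck_add]
        congr 1
        ring
      · have h1 := hn (deck ε (-((j : ℤ) + 1)) w)
        rw [← deck_add, show (1 : ℤ) + -((j : ℤ) + 1) = -j by ring, (ih w).2] at h1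
        rw [Nat.cast_succ, ← deck_neg_deck ε n (K _), ← h1, ← deck_add]
        congr 1
        ring
  have hall : ∀ j : ℤ, ∀ w, K (deck ε j w) = deck ε (n * j) (K w) := by
    intro j w
    obtain ⟨i, rfl | rfl⟩ := j.eq_nat_or_neg
    · exact (hadd i w).1
    · rw [mul_neg]; exact (hadd i w).2
  have h1 := hall m (K.symm 0)
  rw [← hm, K.apply_symm_apply, K.apply_symm_apply] at h1
  exact ⟨n, Int.eq_one_or_neg_one_of_mul_eq_one (deck_right_injective h1).symm, hn⟩

end IsBandLift

/-- Maps of the plane that commute with the deck transformations, permute the horizontal lines and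
are increasing in both coordinates. -/
structure IsPositive (ε : ℤˣ) (L : ℝ × ℝ → ℝ × ℝ) : Prop where
  row : ∀ w w' : ℝ × ℝ, w.2 = w'.2 → (L w).2 = (L w').2
  height : ∀ w w' : ℝ × ℝ, w.2 < w'.2 → (L w).2 < (L w').2
  order : ∀ w w' : ℝ × ℝ, w.2 = w'.2 → w.1 < w'.1 → (L w).1 < (L w').1
  deck_one : ∀ w, L (deck ε 1 w) = deck ε 1 (L w)

/-- To see that a lift is increasing, it suffices to compare three of its values. -/
theorem IsBandLift.isPositive_iff {K : (ℝ × ℝ) ≃ₜ (ℝ × ℝ)} {h : BandGroup ε} (hK : IsBandLift K h) :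
    IsPositive ε K ↔ 0 < (K (1, 0)).1 - (K 0).1 ∧ 0 < (K (0, 1)).2 - (K 0).2 := by
  constructor
  · intro hp
    exact ⟨sub_pos.2 (hp.order 0 (1, 0) rfl zero_lt_one),
      sub_pos.2 (hp.height 0 (0, 1) zero_lt_one)⟩
  · rintro ⟨h1, h2⟩
    obtain ⟨τ, hτ⟩ := hK.exists_height_sign
    obtain ⟨δ, hδ⟩ := hK.exists_order_sign
    have e1 : τ = 1 := eq_of_sgn_mul_pos (hτ 0 (0, 1) zero_lt_one) (by rwa [sgn_one, one_mul])
    have e2 : δ = 1 := eq_of_sgn_mul_pos (hδ 0 (1, 0) rfl zero_lt_one)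
      (by rwa [sgn_one, one_mul])
    subst e1 e2
    simp only [sgn_one, one_mul, sub_pos] at hτ hδ
    refine ⟨fun w w' => hK.row, hτ, hδ, ?_⟩
    obtain ⟨n, rfl | rfl, hn⟩ := hK.exists_deck_comm
    · exact hn
    · have h3 := hτ 0 (deck ε 1 0) (by simp [deck])
      rw [hn, deck_snd] at h3
      norm_num at h3

end Lifts

/-! ### The identity component of a band -/

section Positive

variable {ε : ℤˣ}

theorem continuous_bandGroup_of_lift {X : Type*} [TopologicalSpace X] {f : X → BandGroup ε}
    {L : X → ℝ × ℝ → ℝ × ℝ} (hL : Continuous fun y : X × (ℝ × ℝ) => L y.1 y.2)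
    (h : ∀ x w, (f x).1 (bandCover ε w) = bandCover ε (L x w)) : Continuous f := by
  refine continuous_homeoGroup_iff ?_
  have hq : IsQuotientMap (Prod.map id (bandCover ε) : X × (ℝ × ℝ) → X × SignBand ε) :=
    (IsOpenMap.id.prodMap (isCoveringMap_bandCover ε).isOpenMap).isQuotientMap
      (continuous_id.prodMap (continuous_bandCover ε))
      (Function.surjective_id.prodMap (surjective_bandCover ε))
  rw [hq.continuous_iff]
  exact ((continuous_bandCover ε).comp hL).congr fun y => (h y.1 y.2).symm

theorem bandGroup_ext {h h' : BandGroup ε}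
    (hh : ∀ w, h.1 (bandCover ε w) = h'.1 (bandCover ε w)) : h = h' := by
  apply Subtype.ext
  apply Homeomorph.ext
  intro z
  obtain ⟨w, rfl⟩ := surjective_bandCover ε z
  exact hh w

namespace IsPositive

variable {L : ℝ × ℝ → ℝ × ℝ}

theorem injective (hL : IsPositive ε L) : Function.Injective L := by
  intro w w' h
  have hy : w.2 = w'.2 := by
    rcases lt_trichotomy w.2 w'.2 with h1 | h1 | h1
    · exact ((hL.height _ _ h1).ne (congrArg Prod.snd h)).elim
    · exact h1
    · exact ((hL.height _ _ h1).ne' (congrArg Prod.snd h)).elim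
  refine Prod.ext ?_ hy
  rcases lt_trichotomy w.1 w'.1 with h1 | h1 | h1
  · exact ((hL.order _ _ hy h1).ne (congrArg Prod.fst h)).elim
  · exact h1
  · exact ((hL.order _ _ hy.symm h1).ne' (congrArg Prod.fst h)).elim

theorem isHomeomorph (hL : IsPositive ε L) (hc : Continuous L) (hs : Function.Surjective L) :
    IsHomeomorph L := by
  have h1 := isHomeomorph_of_strictMono (W := univ) (W' := univ)
    (fun w _ => Eventually.of_forall fun v _ => mem_univ v)
    (by simpa using ordConnected_univ)
    (fun w => ⟨L w.1, mem_univ _⟩) ((hc.comp continuous_subtype_val).subtype_mk _)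
    ⟨fun w w' h => Subtype.ext (hL.injective (congrArg Subtype.val h)), fun w => by
      obtain ⟨v, hv⟩ := hs w.1
      exact ⟨⟨v, mem_univ _⟩, Subtype.ext hv⟩⟩ 1 1
    (fun w w' h => hL.row _ _ h)
    (fun w w' h => by rw [one_mul, sub_pos]; exact hL.height _ _ h)
    (fun w w' h h' => by rw [one_mul, sub_pos]; exact hL.order _ _ h h')
  exact ((Homeomorph.Set.univ (ℝ × ℝ)).isHomeomorph.comp h1).comp
    (Homeomorph.Set.univ (ℝ × ℝ)).symm.isHomeomorph

theorem id : IsPositive ε (fun w => w) where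
  row _ _ h := h
  height _ _ h := h
  order _ _ _ h := h
  deck_one _ := rfl

theorem deck_comm (hL : IsPositive ε L) (n : ℤ) (w : ℝ × ℝ) :
    L (deck ε n w) = deck ε n (L w) := by
  induction n using Int.induction_on generalizing w with
  | zero => simp
  | succ i ih => rw [add_comm, deck_add, hL.deck_one, ih, ← deck_add]
  | pred i ih =>
    have h1 := hL.deck_one (deck ε (-i - 1) w)
    rw [← deck_add, add_sub_cancel, ih] at h1
    rw [← deck_neg_deck ε 1 (L _), ← h1, ← deck_add]
    congr 1
    ring

variable {K : (ℝ × ℝ) ≃ₜ (ℝ × ℝ)}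

theorem symm_row (hK : IsPositive ε K) {w w' : ℝ × ℝ} (h : w.2 = w'.2) :
    (K.symm w).2 = (K.symm w').2 := by
  rcases lt_trichotomy (K.symm w).2 (K.symm w').2 with h1 | h1 | h1
  · have h2 := hK.height _ _ h1
    rw [K.apply_symm_apply, K.apply_symm_apply] at h2
    exact (h2.ne h).elim
  · exact h1
  · have h2 := hK.height _ _ h1
    rw [K.apply_symm_apply, K.apply_symm_apply] at h2
    exact (h2.ne' h).elim

end IsPositive

/-- A homeomorphism of the plane that permutes the horizontal lines and the fibres of the universal
covering descends to the band. -/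
theorem exists_isBandLift {K : (ℝ × ℝ) ≃ₜ (ℝ × ℝ)}
    (hrow : ∀ w w' : ℝ × ℝ, w.2 = w'.2 → (K w).2 = (K w').2)
    (hrow' : ∀ w w' : ℝ × ℝ, w.2 = w'.2 → (K.symm w).2 = (K.symm w').2)
    (hfib : ∀ n w, ∃ m, K (deck ε n w) = deck ε m (K w))
    (hfib' : ∀ n w, ∃ m, deck ε n (K w) = K (deck ε m w)) :
    ∃ h : BandGroup ε, IsBandLift K h := by
  obtain ⟨g, hg⟩ := exists_homeomorph_of_isQuotientMap (isQuotientMap_bandCover ε) K fun w w' => by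
    rw [bandCover_eq_iff, bandCover_eq_iff]
    constructor
    · rintro ⟨n, rfl⟩
      obtain ⟨m, hm⟩ := hfib n w'
      exact ⟨m, hm.symm⟩
    · rintro ⟨n, hn⟩
      obtain ⟨m, hm⟩ := hfib' n w'
      exact ⟨m, K.injective (hm.symm.trans hn)⟩
  have key : ∀ {K : (ℝ × ℝ) ≃ₜ (ℝ × ℝ)}, (∀ w w' : ℝ × ℝ, w.2 = w'.2 → (K w).2 = (K w').2) →
      (∀ w w' : ℝ × ℝ, w.2 = w'.2 → (K.symm w).2 = (K.symm w').2) → ∀ {g : SignBand ε → SignBand ε},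
      (∀ w, g (bandCover ε w) = bandCover ε (K w)) → ∀ ω ∈ bandFoliation fun x => sgn ε * x,
      g '' ω ∈ bandFoliation fun x => sgn ε * x := by
    intro K hrow hrow' g hg ω hω
    obtain ⟨t, rfl⟩ := (bandFoliation_eq ε).subset hω
    rw [bandFoliation_eq]
    refine ⟨(K (0, t)).2, ?_⟩
    ext z
    constructor
    · rintro ⟨v, hv, rfl⟩
      refine ⟨_, ⟨K.symm v, ?_, rfl⟩, by rw [hg, K.apply_symm_apply]⟩
      have h1 := hrow' v (K (0, t)) hv
      rw [K.symm_apply_apply] at h1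
      exact h1
    · rintro ⟨_, ⟨v, hv, rfl⟩, rfl⟩
      rw [hg]
      exact ⟨_, hrow _ _ hv, rfl⟩
  refine ⟨⟨g, key hrow hrow' hg, key (K := K.symm) hrow' (fun w w' h => hrow w w' h) fun w => ?_⟩,
    fun w => (hg w).symm⟩
  rw [Homeomorph.symm_apply_eq, hg, K.apply_symm_apply]

theorem IsPositive.exists_isBandLift {K : (ℝ × ℝ) ≃ₜ (ℝ × ℝ)} (hK : IsPositive ε K) :
    ∃ h : BandGroup ε, IsBandLift K h :=
  Striped.exists_isBandLift hK.row (fun _ _ => hK.symm_row) (fun n w => ⟨n, hK.deck_comm n w⟩)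
    fun n w => ⟨n, (hK.deck_comm n w).symm⟩

/-- The straight-line deformation of an increasing lift to a translation in the vertical
direction. -/
def bandComb (L : ℝ × ℝ → ℝ × ℝ) (s : ℝ) (w : ℝ × ℝ) : ℝ × ℝ :=
  ((1 - s) * (L w).1 + s * w.1, (1 - s) * (L w).2 + s * (w.2 + (L 0).2))

theorem bandComb_zero (L : ℝ × ℝ → ℝ × ℝ) (w : ℝ × ℝ) : bandComb L 0 w = L w := by
  simp [bandComb]

theorem bandComb_one (L : ℝ × ℝ → ℝ × ℝ) (w : ℝ × ℝ) :
    bandComb L 1 w = (w.1, w.2 + (L 0).2) := by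
  simp [bandComb]

theorem IsPositive.bandComb {L : ℝ × ℝ → ℝ × ℝ} (hL : IsPositive ε L) {s : ℝ} (h0 : 0 ≤ s)
    (h1 : s ≤ 1) : IsPositive ε (bandComb L s) where
  row w w' h := by simp only [Striped.bandComb, hL.row w w' h, h]
  height w w' h := convexComb_lt h0 h1 (hL.height w w' h) (by linarith)
  order w w' h h' := convexComb_lt h0 h1 (hL.order w w' h h') h'
  deck_one w := by
    simp only [Striped.bandComb, hL.deck_one w]
    simp only [deck]
    refine Prod.ext ?_ ?_ <;> dsimp only <;> ring

theorem IsPositive.surjective_bandComb {K : (ℝ × ℝ) ≃ₜ (ℝ × ℝ)} (hK : IsPositive ε K) {s : ℝ}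
    (h0 : 0 ≤ s) (h1 : s ≤ 1) : Function.Surjective (Striped.bandComb K s) := by
  intro v
  set c := (K 0).2 with hc
  have hKc := K.continuous
  obtain ⟨t, ht⟩ := exists_convexComb_eq (J := univ) ordConnected_univ
    (f := fun t => (K (0, t)).2 - c)
    ((continuous_snd.comp (hKc.comp (by fun_prop))).sub continuous_const)
    (fun a b hab => by
      rcases hab.eq_or_lt with h | h
      · rw [h]
      · exact (sub_lt_sub_right (hK.height (0, a) (0, b) h) _).le)
    (fun y _ => ⟨⟨(K.symm (0, y + c)).2, mem_univ _⟩, by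
      dsimp only
      rw [hK.row (0, (K.symm (0, y + c)).2) (K.symm (0, y + c)) rfl, K.apply_symm_apply]
      exact add_sub_cancel_right y c⟩) h0 h1 (mem_univ (v.2 - c))
  obtain ⟨x, hx⟩ := exists_convexComb_eq (J := univ) ordConnected_univ
    (f := fun x => (K (x, t)).1) (continuous_fst.comp (hKc.comp (by fun_prop)))
    (fun a b hab => by
      rcases hab.eq_or_lt with h | h
      · rw [h]
      · exact (hK.order (a, t) (b, t) rfl h).le)
    (fun y _ => ⟨⟨(K.symm (y, (K (0, t)).2)).1, mem_univ _⟩, by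
      have h2 := hK.symm_row (w := (y, (K (0, t)).2)) (w' := K (0, t)) rfl
      rw [K.symm_apply_apply] at h2
      have h3 : ((K.symm (y, (K (0, t)).2)).1, (t : ℝ)) = K.symm (y, (K (0, t)).2) :=
        Prod.ext rfl h2.symm
      dsimp only
      rw [h3, K.apply_symm_apply]⟩) h0 h1 (mem_univ v.1)
  refine ⟨(x, t), Prod.ext hx ?_⟩
  change (1 - s) * (K (↑x, ↑t)).2 + s * (t + c) = v.2
  rw [hK.row (x, t) (0, (t : ℝ)) rfl]
  linear_combination ht

/-- The lifts that are increasing in both coordinates. -/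
abbrev PosLift (ε : ℤˣ) : Type := {x : LiftSpace ε // IsPositive ε (bandLift ε x)}

theorem PosLift.isBandLift (x : LiftSpace ε) :
    ∃ K : (ℝ × ℝ) ≃ₜ (ℝ × ℝ), ⇑K = bandLift ε x ∧ IsBandLift K x.1.1 := by
  obtain ⟨K, hK⟩ := exists_homeomorph_eq_bandLift x
  exact ⟨K, funext hK, fun w => by rw [hK]; exact bandCover_bandLift x w⟩

theorem isPositive_bandLift_iff (x : LiftSpace ε) : IsPositive ε (bandLift ε x) ↔
    0 < (bandLift ε x (1, 0)).1 - (bandLift ε x 0).1 ∧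
      0 < (bandLift ε x (0, 1)).2 - (bandLift ε x 0).2 := by
  obtain ⟨K, hK, hKx⟩ := PosLift.isBandLift x
  rw [← hK]
  exact hKx.isPositive_iff

theorem continuous_bandLift_left (w : ℝ × ℝ) : Continuous fun x : LiftSpace ε => bandLift ε x w :=
  (continuous_bandLift ε).comp (Continuous.prodMk_left w)

theorem isOpen_posLift : IsOpen {x : LiftSpace ε | IsPositive ε (bandLift ε x)} := by
  simp only [isPositive_bandLift_iff]
  have h := fun w => continuous_bandLift_left (ε := ε) w
  exact (isOpen_lt continuous_const
    ((continuous_fst.comp (h _)).sub (continuous_fst.comp (h _)))).inter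
    (isOpen_lt continuous_const ((continuous_snd.comp (h _)).sub (continuous_snd.comp (h _))))

/-- The signs of a connected family of lifts are constant. -/
theorem isPositive_bandLift_of_preconnected {X : Type*} [TopologicalSpace X] [PreconnectedSpace X]
    {c : X → LiftSpace ε} (hc : Continuous c) {a : X} (ha : IsPositive ε (bandLift ε (c a)))
    (b : X) : IsPositive ε (bandLift ε (c b)) := by
  have h := fun w => (continuous_bandLift_left (ε := ε) w).comp hc
  have ha' := (isPositive_bandLift_iff _).1 ha
  obtain ⟨δ, hδ⟩ := exists_sign (F := fun t => (bandLift ε (c t) (1, 0)).1 - (bandLift ε (c t) 0).1)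
    ((continuous_fst.comp (h _)).sub (continuous_fst.comp (h _))) fun t => by
      obtain ⟨K, hK, hKx⟩ := PosLift.isBandLift (c t)
      obtain ⟨δ, hδ⟩ := hKx.exists_order_sign
      rw [← hK]
      intro h0
      have h1 := hδ 0 (1, 0) rfl zero_lt_one
      rw [h0, mul_zero] at h1
      exact lt_irrefl _ h1
  obtain ⟨τ, hτ⟩ := exists_sign (F := fun t => (bandLift ε (c t) (0, 1)).2 - (bandLift ε (c t) 0).2)
    ((continuous_snd.comp (h _)).sub (continuous_snd.comp (h _))) fun t => by
      obtain ⟨K, hK, hKx⟩ := PosLift.isBandLift (c t)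
      obtain ⟨δ, hδ⟩ := hKx.exists_height_sign
      rw [← hK]
      intro h0
      have h1 := hδ 0 (0, 1) zero_lt_one
      rw [h0, mul_zero] at h1
      exact lt_irrefl _ h1
  have e1 : δ = 1 := eq_of_sgn_mul_pos (hδ a) (by rw [sgn_one, one_mul]; exact ha'.1)
  have e2 : τ = 1 := eq_of_sgn_mul_pos (hτ a) (by rw [sgn_one, one_mul]; exact ha'.2)
  subst e1 e2
  exact (isPositive_bandLift_iff _).2 ⟨by simpa using hδ b, by simpa using hτ b⟩

theorem exists_posLift {K : (ℝ × ℝ) ≃ₜ (ℝ × ℝ)} (hK : IsPositive ε K) :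
    ∃ y : PosLift ε, bandLift ε y.1 = K := by
  obtain ⟨h, hh⟩ := hK.exists_isBandLift
  have h1 : (K : ℝ × ℝ → ℝ × ℝ) = bandLift ε ⟨(h, K 0), hh 0⟩ :=
    bandLift_unique (x := ⟨(h, K 0), hh 0⟩) K.continuous hh rfl
  exact ⟨⟨⟨(h, K 0), hh 0⟩, h1 ▸ hK⟩, h1.symm⟩

/-- The straight-line deformation of an increasing lift consists of increasing lifts. -/
theorem exists_bandDeform (x : PosLift ε) (s : unitInterval) :
    ∃ y : PosLift ε, bandLift ε y.1 = bandComb (bandLift ε x.1) s := by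
  obtain ⟨K, hK, -⟩ := PosLift.isBandLift x.1
  have hp : IsPositive ε K := hK ▸ x.2
  have hc : Continuous (bandComb K s) := by
    have := K.continuous
    unfold bandComb
    fun_prop
  set M := ((hp.bandComb s.2.1 s.2.2).isHomeomorph hc
    (hp.surjective_bandComb s.2.1 s.2.2)).homeomorph with hM
  have hMp : IsPositive ε M := hp.bandComb s.2.1 s.2.2
  obtain ⟨y, hy⟩ := exists_posLift hMp
  exact ⟨y, by rw [hy, ← hK]; rfl⟩

theorem exists_bandRotation (ε : ℤˣ) (c : ℝ) :
    ∃ y : PosLift ε, ∀ w, bandLift ε y.1 w = (w.1, w.2 + c) := by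
  set M : (ℝ × ℝ) ≃ₜ (ℝ × ℝ) := (Homeomorph.refl ℝ).prodCongr (Homeomorph.addRight c) with hM
  have hMw : ∀ w, M w = (w.1, w.2 + c) := fun w => rfl
  have hMp : IsPositive ε M :=
    { row := fun w w' h => by rw [hMw, hMw, h]
      height := fun w w' h => by rw [hMw, hMw]; exact add_lt_add_left h c
      order := fun w w' _ h => h
      deck_one := fun w => by rw [hMw, hMw]; simp only [deck]; refine Prod.ext rfl ?_; ring }
  obtain ⟨y, hy⟩ := exists_posLift hMp
  exact ⟨y, fun w => by rw [hy, hMw]⟩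

/-- The increasing lift at time `s` of the deformation of `x` to a vertical translation. -/
def bandDeform (x : PosLift ε) (s : unitInterval) : PosLift ε := (exists_bandDeform x s).choose

theorem bandLift_bandDeform (x : PosLift ε) (s : unitInterval) :
    bandLift ε (bandDeform x s).1 = bandComb (bandLift ε x.1) s :=
  (exists_bandDeform x s).choose_spec

/-- The vertical translation by `c`, as an increasing lift. -/
def bandRotation (ε : ℤˣ) (c : ℝ) : PosLift ε := (exists_bandRotation ε c).choose

theorem bandLift_bandRotation (c : ℝ) (w : ℝ × ℝ) :
    bandLift ε (bandRotation ε c).1 w = (w.1, w.2 + c) := (exists_bandRotation ε c).choose_spec w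

theorem posLift_ext {x y : PosLift ε} (h : ∀ w, bandLift ε x.1 w = bandLift ε y.1 w) : x = y := by
  apply Subtype.ext
  apply Subtype.ext
  refine Prod.ext (bandGroup_ext fun w => ?_) ?_
  · rw [← bandCover_bandLift, ← bandCover_bandLift, h]
  · rw [← bandLift_zero, ← bandLift_zero, h]

theorem continuous_posLift {X : Type*} [TopologicalSpace X] {f : X → PosLift ε}
    (hf : Continuous fun y : X × (ℝ × ℝ) => bandLift ε (f y.1).1 y.2) : Continuous f := by
  have h1 : Continuous fun x => (f x).1.1.1 := continuous_bandGroup_of_lift hf fun x w =>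
    (bandCover_bandLift (f x).1 w).symm
  have h2 : Continuous fun x => (f x).1.1.2 := by
    simp only [← bandLift_zero]
    exact hf.comp (Continuous.prodMk_left 0)
  exact continuous_induced_rng.2 (continuous_induced_rng.2 (h1.prodMk h2))

theorem continuous_bandLift_posLift {X : Type*} [TopologicalSpace X] {f : X → PosLift ε}
    {g : X → ℝ × ℝ} (hf : Continuous f) (hg : Continuous g) :
    Continuous fun x => bandLift ε (f x).1 (g x) :=
  (continuous_bandLift ε).comp ((continuous_subtype_val.comp hf).prodMk hg)

theorem continuous_bandDeform :
    Continuous fun y : PosLift ε × unitInterval => bandDeform y.1 y.2 := by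
  refine continuous_posLift ?_
  simp only [bandLift_bandDeform, bandComb]
  have h1 : Continuous fun y : (PosLift ε × unitInterval) × (ℝ × ℝ) => bandLift ε y.1.1.1 y.2 :=
    continuous_bandLift_posLift (continuous_fst.comp continuous_fst) continuous_snd
  have h2 : Continuous fun y : (PosLift ε × unitInterval) × (ℝ × ℝ) => bandLift ε y.1.1.1 0 :=
    continuous_bandLift_posLift (continuous_fst.comp continuous_fst) continuous_const
  fun_prop

theorem continuous_bandRotation (ε : ℤˣ) : Continuous (bandRotation ε) := by
  refine continuous_posLift ?_
  simp only [bandLift_bandRotation]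
  fun_prop

theorem bandDeform_zero (x : PosLift ε) : bandDeform x 0 = x := posLift_ext fun w => by
  rw [bandLift_bandDeform, Icc.coe_zero, bandComb_zero]

theorem bandDeform_one (x : PosLift ε) : bandDeform x 1 = bandRotation ε x.1.1.2.2 :=
  posLift_ext fun w => by
    rw [bandLift_bandDeform, Icc.coe_one, bandComb_one, bandLift_bandRotation, bandLift_zero]

/-- The projection of the lifts to the group of foliated homeomorphisms. -/
def PosLift.base (x : PosLift ε) : BandGroup ε := x.1.1.1

theorem PosLift.continuous_base : Continuous (PosLift.base (ε := ε)) :=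
  continuous_fst.comp (continuous_subtype_val.comp continuous_subtype_val)

theorem base_bandRotation_zero : (bandRotation ε 0).base = 1 := bandGroup_ext fun w => by
  rw [PosLift.base, ← bandCover_bandLift, bandLift_bandRotation, add_zero]
  rfl

/-- The identity component consists of the homeomorphisms that have an increasing lift. -/
theorem mem_identityComponent_iff {h : BandGroup ε} :
    h ∈ identityComponent (bandFoliation fun x => sgn ε * x) ↔ ∃ x : PosLift ε, x.base = h := by
  constructor
  · rintro ⟨γ⟩
    have cov := isCoveringMap_bandCover ε
    have hc : Continuous fun t => (γ t).1 (bandCover ε 0) :=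
      (continuous_bandGroup_apply ε).comp (γ.continuous.prodMk continuous_const)
    obtain ⟨Γ, hΓ, hΓ0⟩ := cov.exists_path_lifts ⟨_, hc⟩ 0 (by
      change (γ 0).1 _ = _
      rw [γ.source]
      rfl)
    -- a path of homeomorphisms that starts at the identity lifts to a path of lifts
    set c : unitInterval → LiftSpace ε := fun t => ⟨(γ t, Γ t), congrFun hΓ t⟩ with hcdef
    have hcc : Continuous c := (γ.continuous.prodMk Γ.continuous).subtype_mk _
    have h0 : bandLift ε (c 0) = fun w => w := by
      refine (bandLift_unique (x := c 0) continuous_id (fun w => ?_) hΓ0.symm).symm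
      change bandCover ε w = (γ 0).1 _
      rw [γ.source]
      rfl
    have h1 := isPositive_bandLift_of_preconnected hcc (a := 0)
      (by rw [h0]; exact IsPositive.id) 1
    exact ⟨⟨c 1, h1⟩, γ.target⟩
  · rintro ⟨x, rfl⟩
    -- an increasing lift is joined to a translation, which is joined to the identity
    have h1 : Joined x (bandRotation ε x.1.1.2.2) :=
      ⟨⟨⟨fun s => bandDeform x s, (continuous_bandDeform).comp (Continuous.prodMk_right x)⟩,
        bandDeform_zero x, bandDeform_one x⟩⟩
    have h2 : Joined (bandRotation ε 0) (bandRotation ε x.1.1.2.2) :=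
      (PathConnectedSpace.joined (0 : ℝ) x.1.1.2.2).map (continuous_bandRotation ε)
    have h3 := (h2.trans h1.symm).map PosLift.continuous_base
    rw [base_bandRotation_zero] at h3
    exact h3

end Positive

/-! ### The homotopy type of the identity component of a band -/

/-- The smallest positive integer `n` for which the `n`-th power of the generator of the deck
transformations is a vertical translation. -/
def bandPeriod (ε : ℤˣ) : ℤ := if ε = 1 then 1 else 2

theorem bandPeriod_pos (ε : ℤˣ) : 0 < bandPeriod ε := by
  unfold bandPeriod
  split_ifs <;> norm_num

theorem zpow_eq_one_iff_bandPeriod_dvd {ε : ℤˣ} {n : ℤ} : ε ^ n = 1 ↔ bandPeriod ε ∣ n := by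
  rcases Int.units_eq_one_or ε with rfl | rfl
  · simp [bandPeriod]
  · rw [bandPeriod, if_neg (by decide), ← even_iff_two_dvd]
    rcases Int.even_or_odd n with h | h
    · simp [h, h.neg_one_zpow]
    · simp [h.neg_one_zpow, h]

theorem _root_.Topology.IsQuotientMap.lift_apply_apply {X Y Z : Type*} [TopologicalSpace X]
    [TopologicalSpace Y] [TopologicalSpace Z] {f : C(X, Y)} (hf : IsQuotientMap f) (g : C(X, Z))
    (h : Function.FactorsThrough g f) (x : X) : hf.lift g h (f x) = g x :=
  DFunLike.congr_fun (hf.lift_comp g h) x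

section Circle

variable {ε : ℤˣ}

theorem deck_eq_of_zpow_eq_one {n : ℤ} (h : ε ^ n = 1) (w : ℝ × ℝ) :
    deck ε n w = (w.1, w.2 + n) := by
  simp [deck, h]

/-- Increasing lifts of the same homeomorphism differ by a deck transformation that is a vertical
translation. -/
theorem PosLift.exists_deck_eq {x y : PosLift ε} (h : x.base = y.base) :
    ∃ n, ε ^ n = 1 ∧ ∀ w, bandLift ε x.1 w = deck ε n (bandLift ε y.1 w) := by
  obtain ⟨n, hn⟩ := Striped.exists_deck_eq (continuous_bandLift_right x.1)
    (continuous_bandLift_right y.1) fun w => by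
      rw [bandCover_bandLift, bandCover_bandLift]
      exact congrArg (fun g : BandGroup ε => g.1 (bandCover ε w)) h
  refine ⟨n, ?_, hn⟩
  have h1 := x.2.order 0 (1, 0) rfl zero_lt_one
  have h2 := y.2.order 0 (1, 0) rfl zero_lt_one
  rw [hn, hn] at h1
  change sgn (ε ^ n) * _ < sgn (ε ^ n) * _ at h1
  rcases Int.units_eq_one_or (ε ^ n) with h3 | h3
  · exact h3
  · rw [h3, sgn_neg_one] at h1
    linarith

theorem PosLift.base_eq_of_deck {x y : PosLift ε} {n : ℤ}
    (h : ∀ w, bandLift ε x.1 w = deck ε n (bandLift ε y.1 w)) : x.base = y.base :=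
  bandGroup_ext fun w => by
    rw [PosLift.base, PosLift.base, ← bandCover_bandLift, ← bandCover_bandLift, h, bandCover_deck]

/-- The projection of the increasing lifts onto the identity component. -/
def PosLift.proj (x : PosLift ε) : identityComponent (bandFoliation fun x => sgn ε * x) :=
  ⟨x.base, mem_identityComponent_iff.2 ⟨x, rfl⟩⟩

theorem PosLift.continuous_proj : Continuous (PosLift.proj (ε := ε)) :=
  continuous_induced_rng.2 PosLift.continuous_base

theorem PosLift.surjective_proj : Function.Surjective (PosLift.proj (ε := ε)) := by
  rintro ⟨h, hh⟩
  obtain ⟨x, hx⟩ := mem_identityComponent_iff.1 hh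
  exact ⟨x, Subtype.ext hx⟩

/-- Homeomorphisms near `h` have lifts near a given lift of `h`, because the universal covering is an
open map. -/
theorem PosLift.isOpenMap_base : IsOpenMap (PosLift.base (ε := ε)) := by
  have h1 : IsOpenMap fun x : LiftSpace ε => x.1.1 := by
    rw [isOpenMap_iff_nhds_le]
    rintro ⟨⟨h, a⟩, hx⟩ U hU
    rw [mem_map, nhds_subtype_eq_comap, mem_comap] at hU
    obtain ⟨V, hV, hVU⟩ := hU
    obtain ⟨V₁, hV₁, V₂, hV₂, hVV⟩ := mem_nhds_prod_iff.1 hV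
    have hc : Continuous fun g : BandGroup ε => g.1 (bandCover ε 0) :=
      (continuous_bandGroup_apply ε).comp (Continuous.prodMk_left 0)
    have h2 : bandCover ε '' V₂ ∈ 𝓝 (h.1 (bandCover ε 0)) := by
      rw [← show bandCover ε a = h.1 (bandCover ε 0) from hx]
      exact (isCoveringMap_bandCover ε).isOpenMap.image_mem_nhds hV₂
    filter_upwards [hV₁, hc.continuousAt.preimage_mem_nhds h2] with g hg hg2
    obtain ⟨b, hb, hb2⟩ := hg2
    exact hVU (a := ⟨(g, b), hb2⟩) (hVV ⟨hg, hb⟩)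
  exact h1.comp isOpen_posLift.isOpenMap_subtype_val

theorem PosLift.isOpenMap_proj : IsOpenMap (PosLift.proj (ε := ε)) := by
  intro U hU
  refine isOpen_induced_iff.2 ⟨PosLift.base '' U, PosLift.isOpenMap_base U hU, ?_⟩
  ext h
  constructor
  · rintro ⟨x, hx, hxh⟩
    exact ⟨x, hx, Subtype.ext hxh⟩
  · rintro ⟨x, hx, rfl⟩
    exact ⟨x, hx, rfl⟩

theorem PosLift.isQuotientMap_proj : IsQuotientMap (PosLift.proj (ε := ε)) :=
  PosLift.isOpenMap_proj.isQuotientMap PosLift.continuous_proj PosLift.surjective_proj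

theorem coe_eq_of_base_eq {x y : PosLift ε} (h : x.base = y.base) :
    (x.1.1.2.2 : AddCircle (bandPeriod ε : ℝ)) = (y.1.1.2.2 : AddCircle (bandPeriod ε : ℝ)) := by
  obtain ⟨n, hn, hw⟩ := PosLift.exists_deck_eq h
  obtain ⟨m, rfl⟩ := zpow_eq_one_iff_bandPeriod_dvd.1 hn
  have h1 := hw 0
  rw [bandLift_zero, bandLift_zero, deck_eq_of_zpow_eq_one hn] at h1
  rw [h1, AddCircle.coe_add, add_eq_left]
  refine (AddCircle.coe_eq_zero_iff _).2 ⟨m, ?_⟩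
  push_cast
  rw [zsmul_eq_mul, mul_comm]

/-- The vertical displacement of a homeomorphism in the identity component. -/
def bandAngle (ε : ℤˣ) : C(identityComponent (bandFoliation fun x => sgn ε * x),
    AddCircle (bandPeriod ε : ℝ)) :=
  IsQuotientMap.lift (f := (⟨PosLift.proj, PosLift.continuous_proj⟩ : C(PosLift ε, _)))
    PosLift.isQuotientMap_proj
    ⟨fun x => (x.1.1.2.2 : AddCircle (bandPeriod ε : ℝ)), (AddCircle.continuous_mk' _).comp
      (continuous_snd.comp (continuous_snd.comp
        (continuous_subtype_val.comp continuous_subtype_val)))⟩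
    fun _ _ h => coe_eq_of_base_eq (congrArg Subtype.val h)

theorem bandAngle_proj (x : PosLift ε) : bandAngle ε x.proj = (x.1.1.2.2 : AddCircle _) :=
  IsQuotientMap.lift_apply_apply (f := (⟨PosLift.proj, PosLift.continuous_proj⟩ : C(PosLift ε, _)))
    _ _ _ x

theorem base_bandRotation_eq {c c' : ℝ}
    (h : (c : AddCircle (bandPeriod ε : ℝ)) = (c' : AddCircle (bandPeriod ε : ℝ))) :
    (bandRotation ε c).base = (bandRotation ε c').base := by
  rw [← sub_eq_zero, ← AddCircle.coe_sub] at h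
  obtain ⟨m, hm⟩ := (AddCircle.coe_eq_zero_iff _).1 h
  refine PosLift.base_eq_of_deck (n := bandPeriod ε * m) fun w => ?_
  rw [deck_eq_of_zpow_eq_one (zpow_eq_one_iff_bandPeriod_dvd.2 (dvd_mul_right _ _)),
    bandLift_bandRotation, bandLift_bandRotation]
  refine Prod.ext rfl ?_
  dsimp only
  rw [zsmul_eq_mul] at hm
  push_cast
  linear_combination -hm

/-- The homeomorphisms of a band induced by vertical translations. -/
def bandRotationMap (ε : ℤˣ) : C(AddCircle (bandPeriod ε : ℝ),
    identityComponent (bandFoliation fun x => sgn ε * x)) :=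
  IsQuotientMap.lift
    (f := (⟨fun c : ℝ => (c : AddCircle (bandPeriod ε : ℝ)), AddCircle.continuous_mk' _⟩ :
      C(ℝ, AddCircle (bandPeriod ε : ℝ))))
    isQuotientMap_quotient_mk'
    ⟨fun c => (bandRotation ε c).proj, PosLift.continuous_proj.comp (continuous_bandRotation ε)⟩
    fun _ _ h => Subtype.ext (base_bandRotation_eq h)

theorem bandRotationMap_coe (c : ℝ) :
    bandRotationMap ε (c : AddCircle (bandPeriod ε : ℝ)) = (bandRotation ε c).proj :=
  IsQuotientMap.lift_apply_apply
    (f := (⟨fun c : ℝ => (c : AddCircle (bandPeriod ε : ℝ)), AddCircle.continuous_mk' _⟩ :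
      C(ℝ, AddCircle (bandPeriod ε : ℝ)))) _ _ _ c

/-- The deformation of the lifts descends to the identity component, since it commutes with vertical
translations. -/
theorem proj_bandDeform_eq {x y : PosLift ε} (h : x.base = y.base) (s : unitInterval) :
    (bandDeform x s).proj = (bandDeform y s).proj := by
  obtain ⟨n, hn, hw⟩ := PosLift.exists_deck_eq h
  refine Subtype.ext (PosLift.base_eq_of_deck (n := n) fun w => ?_)
  rw [bandLift_bandDeform, bandLift_bandDeform, deck_eq_of_zpow_eq_one hn]
  simp only [bandComb, hw, deck_eq_of_zpow_eq_one hn]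
  refine Prod.ext rfl ?_
  dsimp only
  ring

theorem homotopic_bandRotationMap_comp_bandAngle (ε : ℤˣ) :
    ((bandRotationMap ε).comp (bandAngle ε)).Homotopic (ContinuousMap.id _) := by
  refine ContinuousMap.Homotopic.symm ?_
  have hq : IsQuotientMap (Prod.map id PosLift.proj :
      unitInterval × PosLift ε → unitInterval × _) :=
    (IsOpenMap.id.prodMap PosLift.isOpenMap_proj).isQuotientMap
      (continuous_id.prodMap PosLift.continuous_proj)
      (Function.surjective_id.prodMap PosLift.surjective_proj)
  set D := IsQuotientMap.lift
    (f := (⟨Prod.map id PosLift.proj, continuous_id.prodMap PosLift.continuous_proj⟩ :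
      C(unitInterval × PosLift ε, unitInterval × _))) hq
    ⟨fun y => (bandDeform y.2 y.1).proj,
      PosLift.continuous_proj.comp (continuous_bandDeform.comp continuous_swap)⟩
    (by
      rintro ⟨s, x⟩ ⟨s', x'⟩ h
      obtain rfl : s = s' := congrArg Prod.fst h
      exact proj_bandDeform_eq (congrArg (fun z => z.2.1) h) s) with hD
  have hDx : ∀ s x, D (s, PosLift.proj x) = (bandDeform x s).proj := fun s x =>
    IsQuotientMap.lift_apply_apply
      (f := (⟨Prod.map id PosLift.proj, continuous_id.prodMap PosLift.continuous_proj⟩ :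
        C(unitInterval × PosLift ε, unitInterval × _))) _ _ _ (s, x)
  refine ⟨⟨D, fun h => ?_, fun h => ?_⟩⟩
  · obtain ⟨x, rfl⟩ := PosLift.surjective_proj h
    exact (hDx 0 x).trans (by rw [bandDeform_zero]; rfl)
  · obtain ⟨x, rfl⟩ := PosLift.surjective_proj h
    refine (hDx 1 x).trans ?_
    rw [bandDeform_one, ContinuousMap.comp_apply, bandAngle_proj, bandRotationMap_coe]

theorem bandAngle_comp_bandRotationMap (ε : ℤˣ) :
    (bandAngle ε).comp (bandRotationMap ε) = ContinuousMap.id _ := by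
  ext c
  induction c using QuotientAddGroup.induction_on with
  | H c =>
    rw [ContinuousMap.comp_apply, bandRotationMap_coe, bandAngle_proj, ← bandLift_zero,
      bandLift_bandRotation]
    simp

/-- The identity component of the group of foliated homeomorphisms of a band is homotopy equivalent
to the circle: it deforms to the rotations. -/
theorem nonempty_homotopyEquiv_circle (ε : ℤˣ) : Nonempty (ContinuousMap.HomotopyEquiv
    (identityComponent (bandFoliation fun x => sgn ε * x)) Circle) := by
  have hp : (bandPeriod ε : ℝ) ≠ 0 := by exact_mod_cast (bandPeriod_pos ε).ne'
  refine ⟨ContinuousMap.HomotopyEquiv.trans ⟨bandAngle ε, bandRotationMap ε,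
    homotopic_bandRotationMap_comp_bandAngle ε, ?_⟩
    (AddCircle.homeomorphCircle hp).toHomotopyEquiv⟩
  rw [bandAngle_comp_bandRotationMap]

end Circle

/-! ### The homeotopy group of the open cylinder -/

section Cylinder

theorem deck_one_left (n : ℤ) (w : ℝ × ℝ) : deck 1 n w = (w.1, w.2 + n) :=
  deck_eq_of_zpow_eq_one (one_zpow n) w

/-- The signs by which a homeomorphism of the plane changes the order on the horizontal lines, and
the order of these lines. -/
def HasSigns (K : (ℝ × ℝ) ≃ₜ (ℝ × ℝ)) (δ : ℤˣ × ℤˣ) : Prop :=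
  (∀ w w' : ℝ × ℝ, w.2 = w'.2 → w.1 < w'.1 → 0 < sgn δ.1 * ((K w').1 - (K w).1)) ∧
    ∀ w w' : ℝ × ℝ, w.2 < w'.2 → 0 < sgn δ.2 * ((K w').2 - (K w).2)

theorem HasSigns.unique {K : (ℝ × ℝ) ≃ₜ (ℝ × ℝ)} {δ δ' : ℤˣ × ℤˣ} (h : HasSigns K δ)
    (h' : HasSigns K δ') : δ = δ' :=
  Prod.ext (eq_of_sgn_mul_pos (h.1 0 (1, 0) rfl zero_lt_one) (h'.1 0 (1, 0) rfl zero_lt_one))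
    (eq_of_sgn_mul_pos (h.2 0 (0, 1) zero_lt_one) (h'.2 0 (0, 1) zero_lt_one))

/-- The signs do not depend on the lift, because the deck transformations of the cylinder are vertical
translations. -/
theorem exists_signs (h : BandGroup 1) :
    ∃ δ, ∀ K : (ℝ × ℝ) ≃ₜ (ℝ × ℝ), IsBandLift K h → HasSigns K δ := by
  obtain ⟨a, ha⟩ := surjective_bandCover 1 (h.1 (bandCover 1 0))
  obtain ⟨K, hK, hKh⟩ := PosLift.isBandLift (ε := 1) ⟨(h, a), ha⟩
  obtain ⟨δ, hδ⟩ := hKh.exists_order_sign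
  obtain ⟨τ, hτ⟩ := hKh.exists_height_sign
  refine ⟨(δ, τ), fun K' hK' => ?_⟩
  obtain ⟨n, hn⟩ := exists_deck_eq (ε := 1) K'.continuous K.continuous fun w =>
    (hK' w).trans (hKh w).symm
  constructor
  · intro w w' h1 h2
    rw [hn, hn, deck_one_left, deck_one_left]
    exact hδ w w' h1 h2
  · intro w w' h1
    rw [hn, hn, deck_one_left, deck_one_left, add_sub_add_right_eq_sub]
    exact hτ w w' h1

theorem exists_lift_of_bandGroup {ε : ℤˣ} (h : BandGroup ε) :
    ∃ K : (ℝ × ℝ) ≃ₜ (ℝ × ℝ), IsBandLift K h := by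
  obtain ⟨a, ha⟩ := surjective_bandCover ε (h.1 (bandCover ε 0))
  obtain ⟨K, -, hK⟩ := PosLift.isBandLift (ε := ε) ⟨(h, a), ha⟩
  exact ⟨K, hK⟩

theorem HasSigns.trans {K K' : (ℝ × ℝ) ≃ₜ (ℝ × ℝ)} {h : BandGroup 1} (hK : IsBandLift K h)
    {δ δ' : ℤˣ × ℤˣ} (hs : HasSigns K' δ') (hs' : HasSigns K δ) :
    HasSigns (K.trans K') (δ' * δ) := by
  constructor
  · intro w w' h1 h2
    have h3 := hs'.1 w w' h1 h2
    change 0 < sgn (δ'.1 * δ.1) * ((K' (K w')).1 - (K' (K w)).1)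
    rcases Int.units_eq_one_or δ.1 with h4 | h4 <;> rw [h4] at h3 ⊢
    · rw [sgn_one, one_mul, sub_pos] at h3
      rw [mul_one]
      exact hs.1 _ _ (hK.row h1) h3
    · rw [sgn_neg_one, neg_one_mul, neg_sub, sub_pos] at h3
      have h5 := hs.1 _ _ (hK.row h1.symm) h3
      rw [sgn_mul, sgn_neg_one]
      linarith
  · intro w w' h1
    have h3 := hs'.2 w w' h1
    change 0 < sgn (δ'.2 * δ.2) * ((K' (K w')).2 - (K' (K w)).2)
    rcases Int.units_eq_one_or δ.2 with h4 | h4 <;> rw [h4] at h3 ⊢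
    · rw [sgn_one, one_mul, sub_pos] at h3
      rw [mul_one]
      exact hs.2 _ _ h3
    · rw [sgn_neg_one, neg_one_mul, neg_sub, sub_pos] at h3
      have h5 := hs.2 _ _ h3
      rw [sgn_mul, sgn_neg_one]
      linarith

/-- The signs of the lifts of a foliated homeomorphism of the open cylinder. -/
def cylinderSigns : BandGroup 1 →* ℤˣ × ℤˣ :=
  MonoidHom.mk' (fun h => (exists_signs h).choose) fun h h' => by
    obtain ⟨K, hK⟩ := exists_lift_of_bandGroup h
    obtain ⟨K', hK'⟩ := exists_lift_of_bandGroup h'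
    exact ((exists_signs (h * h')).choose_spec _ (hK.mul hK')).unique
      (((exists_signs h).choose_spec K hK).trans hK' ((exists_signs h').choose_spec K' hK'))

theorem hasSigns_cylinderSigns {h : BandGroup 1} {K : (ℝ × ℝ) ≃ₜ (ℝ × ℝ)} (hK : IsBandLift K h) :
    HasSigns K (cylinderSigns h) := (exists_signs h).choose_spec K hK

theorem ker_cylinderSigns :
    cylinderSigns.ker = identityComponent (bandFoliation fun x => sgn 1 * x) := by
  ext h
  rw [mem_identityComponent_iff]
  constructor
  · intro hh
    obtain ⟨K, hK⟩ := exists_lift_of_bandGroup h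
    have hs := hasSigns_cylinderSigns hK
    rw [MonoidHom.mem_ker.1 hh] at hs
    have h1 := hs.1 0 (1, 0) rfl zero_lt_one
    have h2 := hs.2 0 (0, 1) zero_lt_one
    rw [Prod.fst_one, sgn_one, one_mul] at h1
    rw [Prod.snd_one, sgn_one, one_mul] at h2
    have hp := hK.isPositive_iff.2 ⟨h1, h2⟩
    have h3 : (K : ℝ × ℝ → ℝ × ℝ) = bandLift 1 ⟨(h, K 0), hK 0⟩ :=
      bandLift_unique (x := ⟨(h, K 0), hK 0⟩) K.continuous hK rfl
    exact ⟨⟨⟨(h, K 0), hK 0⟩, h3 ▸ hp⟩, rfl⟩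
  · rintro ⟨x, rfl⟩
    obtain ⟨K, hK, hKx⟩ := PosLift.isBandLift x.1
    have hp : IsPositive 1 K := hK ▸ x.2
    refine MonoidHom.mem_ker.2 ((hasSigns_cylinderSigns hKx).unique ⟨?_, ?_⟩)
    · intro w w' h1 h2
      rw [Prod.fst_one, sgn_one, one_mul, sub_pos]
      exact hp.order w w' h1 h2
    · intro w w' h1
      rw [Prod.snd_one, sgn_one, one_mul, sub_pos]
      exact hp.height w w' h1

/-- The multiplication by a sign as a homeomorphism of the line. -/
def signHomeo (δ : ℤˣ) : ℝ ≃ₜ ℝ where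
  toFun x := sgn δ * x
  invFun x := sgn δ * x
  left_inv x := by dsimp only; rw [← mul_assoc, sgn_mul_self, one_mul]
  right_inv x := by dsimp only; rw [← mul_assoc, sgn_mul_self, one_mul]
  continuous_toFun := by fun_prop
  continuous_invFun := by fun_prop

theorem surjective_cylinderSigns : Function.Surjective cylinderSigns := by
  rintro ⟨δ, τ⟩
  set K : (ℝ × ℝ) ≃ₜ (ℝ × ℝ) := (signHomeo δ).prodCongr (signHomeo τ) with hK
  have hKw : ∀ w, K w = (sgn δ * w.1, sgn τ * w.2) := fun w => rfl
  have hKs : ∀ w, K.symm w = (sgn δ * w.1, sgn τ * w.2) := fun w => rfl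
  have hτ : ∀ n : ℤ, (((τ : ℤ) * n : ℤ) : ℝ) = sgn τ * n := fun n => by simp [sgn]
  obtain ⟨h, hh⟩ := exists_isBandLift (ε := 1) (K := K)
    (fun w w' e => by rw [hKw, hKw, e]) (fun w w' e => by rw [hKs, hKs, e])
    (fun n w => ⟨τ * n, by
      rw [deck_one_left, deck_one_left, hKw, hKw, hτ]
      refine Prod.ext rfl ?_
      dsimp only
      ring⟩)
    (fun n w => ⟨τ * n, by
      rw [deck_one_left, deck_one_left, hKw, hKw, hτ]
      refine Prod.ext rfl ?_
      dsimp only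
      linear_combination (-(n : ℝ)) * sgn_mul_self τ⟩)
  refine ⟨h, (hasSigns_cylinderSigns hh).unique ⟨?_, ?_⟩⟩
  · intro w w' h1 h2
    rw [hKw, hKw, ← mul_sub, ← mul_assoc, sgn_mul_self, one_mul, sub_pos]
    exact h2
  · intro w w' h1
    rw [hKw, hKw, ← mul_sub, ← mul_assoc, sgn_mul_self, one_mul, sub_pos]
    exact h1

/-- The homeotopy group of the open cylinder is detected by the signs of the lifts. -/
theorem nonempty_homeotopyGroup_cylinder :
    Nonempty (HomeotopyGroup (bandFoliation fun x => sgn 1 * x) ≃* ℤˣ × ℤˣ) :=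
  ⟨(QuotientGroup.quotientMulEquivOfEq ker_cylinderSigns.symm).trans
    (QuotientGroup.quotientKerEquivOfSurjective _ surjective_cylinderSigns)⟩

end Cylinder

/-! ### Invariance under foliated homeomorphisms -/

section Transport

variable {Z : Type u} [TopologicalSpace Z] {Z' : Type v} [TopologicalSpace Z']
  {Δ : Set (Set Z)} {Δ' : Set (Set Z')} {θ : Z ≃ₜ Z'}

theorem IsFoliated.comp {Z'' : Type w} [TopologicalSpace Z''] {Δ'' : Set (Set Z'')} {θ' : Z' ≃ₜ Z''}
    (hθ' : IsFoliated Δ' Δ'' θ') (hθ : IsFoliated Δ Δ' θ) : IsFoliated Δ Δ'' (θ.trans θ') := by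
  constructor
  · intro ω hω
    have h := hθ'.1 _ (hθ.1 _ hω)
    rwa [← image_comp] at h
  · intro ω hω
    have h := hθ.2 _ (hθ'.2 _ hω)
    rwa [← image_comp] at h

/-- Conjugation by a foliated homeomorphism. -/
def homeoGroupConj (hθ : IsFoliated Δ Δ' θ) : homeoGroup Δ ≃* homeoGroup Δ' where
  toFun g := ⟨(θ.symm.trans g.1).trans θ, hθ.comp (IsFoliated.comp g.2 hθ.symm)⟩
  invFun g := ⟨(θ.trans g.1).trans θ.symm, hθ.symm.comp (IsFoliated.comp g.2 hθ)⟩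
  left_inv g := Subtype.ext (Homeomorph.ext fun z => by simp)
  right_inv g := Subtype.ext (Homeomorph.ext fun z => by simp)
  map_mul' g g' := Subtype.ext (Homeomorph.ext fun z => by
    change θ (g.1 (g'.1 (θ.symm z))) = θ (g.1 (θ.symm (θ (g'.1 (θ.symm z)))))
    rw [θ.symm_apply_apply])

theorem continuous_homeoGroupConj (hθ : IsFoliated Δ Δ' θ) : Continuous (homeoGroupConj hθ) := by
  rw [(homeoGroup_isInducing Δ').continuous_iff]
  exact (ContinuousMap.continuous_postcomp (⟨θ, θ.continuous⟩ : C(Z, Z'))).comp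
    ((ContinuousMap.continuous_precomp (⟨θ.symm, θ.symm.continuous⟩ : C(Z', Z))).comp
      (homeoGroup_isInducing Δ).continuous)

theorem continuous_homeoGroupConj_symm (hθ : IsFoliated Δ Δ' θ) :
    Continuous (homeoGroupConj hθ).symm := by
  rw [(homeoGroup_isInducing Δ).continuous_iff]
  exact (ContinuousMap.continuous_postcomp (⟨θ.symm, θ.symm.continuous⟩ : C(Z', Z))).comp
    ((ContinuousMap.continuous_precomp (⟨θ, θ.continuous⟩ : C(Z, Z'))).comp
      (homeoGroup_isInducing Δ').continuous)

theorem homeoGroupConj_mem_identityComponent (hθ : IsFoliated Δ Δ' θ) (g : homeoGroup Δ) :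
    homeoGroupConj hθ g ∈ identityComponent Δ' ↔ g ∈ identityComponent Δ := by
  constructor
  · intro h
    have h1 := Joined.map (show Joined 1 (homeoGroupConj hθ g) from h)
      (continuous_homeoGroupConj_symm hθ)
    rw [map_one, MulEquiv.symm_apply_apply] at h1
    exact h1
  · intro h
    have h1 := Joined.map (show Joined 1 g from h) (continuous_homeoGroupConj hθ)
    rw [map_one] at h1
    exact h1

/-- A foliated homeomorphism identifies the identity components. -/
def identityComponentHomeo (hθ : IsFoliated Δ Δ' θ) :
    identityComponent Δ ≃ₜ identityComponent Δ' where
  toFun g := ⟨homeoGroupConj hθ g.1, (homeoGroupConj_mem_identityComponent hθ _).2 g.2⟩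
  invFun g := ⟨(homeoGroupConj hθ).symm g.1, (homeoGroupConj_mem_identityComponent hθ _).1 (by
    rw [MulEquiv.apply_symm_apply]; exact g.2)⟩
  left_inv g := Subtype.ext ((homeoGroupConj hθ).symm_apply_apply _)
  right_inv g := Subtype.ext ((homeoGroupConj hθ).apply_symm_apply _)
  continuous_toFun := ((continuous_homeoGroupConj hθ).comp continuous_subtype_val).subtype_mk _
  continuous_invFun :=
    ((continuous_homeoGroupConj_symm hθ).comp continuous_subtype_val).subtype_mk _

/-- A foliated homeomorphism identifies the homeotopy groups. -/
def homeotopyGroupCongr (hθ : IsFoliated Δ Δ' θ) : HomeotopyGroup Δ ≃* HomeotopyGroup Δ' :=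
  QuotientGroup.congr _ _ (homeoGroupConj hθ) (by
    ext g
    constructor
    · rintro ⟨g, hg, rfl⟩
      exact (homeoGroupConj_mem_identityComponent hθ g).2 hg
    · intro hg
      refine ⟨(homeoGroupConj hθ).symm g, (homeoGroupConj_mem_identityComponent hθ _).1 ?_,
        (homeoGroupConj hθ).apply_symm_apply g⟩
      rw [MulEquiv.apply_symm_apply]
      exact hg)

end Transport

/-! ### Atlases of the open cylinder with a single strip -/

section CylinderHeight

/-- The projection of the open cylinder to the circle whose fibres are the leaves. -/
def cylinderHeight : SignBand 1 → AddCircle (1 : ℝ) :=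
  Quot.lift (fun p => ((p.2 : ℝ) : AddCircle (1 : ℝ))) (by
    rintro ⟨x, t⟩ ⟨x', t'⟩ ⟨h1, h2, -⟩
    dsimp only at h1 h2 ⊢
    rw [h1, h2, Icc.coe_zero, Icc.coe_one, AddCircle.coe_zero]
    exact (AddCircle.coe_period 1).symm)

theorem continuous_cylinderHeight : Continuous cylinderHeight :=
  continuous_coinduced_dom.2
    ((AddCircle.continuous_mk' (1 : ℝ)).comp (continuous_subtype_val.comp continuous_snd))

theorem coe_add_int (t : ℝ) (n : ℤ) : ((t + n : ℝ) : AddCircle (1 : ℝ)) = t := by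
  rw [AddCircle.coe_add, add_eq_left]
  exact (AddCircle.coe_eq_zero_iff 1).2 ⟨n, by simp⟩

theorem cylinderHeight_bandCover (w : ℝ × ℝ) : cylinderHeight (bandCover 1 w) = w.2 := by
  change ((Int.fract w.2 : ℝ) : AddCircle (1 : ℝ)) = w.2
  rw [← coe_add_int (Int.fract w.2) ⌊w.2⌋, Int.fract_add_floor]

theorem mem_bandFoliation_iff {ω : Set (SignBand 1)} :
    ω ∈ bandFoliation (fun x => sgn 1 * x) ↔ ∃ c, ω = cylinderHeight ⁻¹' {c} := by
  have key : ∀ t : ℝ,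
      bandCover 1 '' {w | w.2 = t} = cylinderHeight ⁻¹' {(t : AddCircle (1 : ℝ))} := by
    intro t
    ext z
    constructor
    · rintro ⟨w, hw, rfl⟩
      rw [mem_preimage, cylinderHeight_bandCover, show w.2 = t from hw]
      rfl
    · intro hz
      obtain ⟨w, rfl⟩ := surjective_bandCover 1 z
      rw [mem_preimage, cylinderHeight_bandCover, mem_singleton_iff, ← sub_eq_zero,
        ← AddCircle.coe_sub] at hz
      obtain ⟨n, hn⟩ := (AddCircle.coe_eq_zero_iff 1).1 hz
      refine ⟨deck 1 (-n) w, ?_, bandCover_deck 1 _ w⟩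
      change w.2 + ((-n : ℤ) : ℝ) = t
      rw [zsmul_one] at hn
      push_cast
      linarith
  rw [bandFoliation_eq]
  constructor
  · rintro ⟨t, rfl⟩
    exact ⟨t, key t⟩
  · rintro ⟨c, rfl⟩
    obtain ⟨t, rfl⟩ := QuotientAddGroup.mk_surjective c
    exact ⟨t, key t⟩

/-- A transversal of the open cylinder that meets every leaf once. -/
theorem exists_cylinder_section :
    ∃ j : AddCircle (1 : ℝ) → SignBand 1, Continuous j ∧ ∀ c, cylinderHeight (j c) = c := by
  have hper : ∀ t : ℝ, bandCover 1 (0, t + 1) = bandCover 1 (0, t) := fun t => by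
    rw [← bandCover_deck 1 1 (0, t)]
    simp [deck]
  have hper' : Function.Periodic (fun t => bandCover 1 (0, t)) (1 : ℝ) := hper
  refine ⟨hper'.lift, continuous_coinduced_dom.2
    ((continuous_bandCover 1).comp (Continuous.prodMk_right 0)), fun c => ?_⟩
  obtain ⟨t, rfl⟩ := QuotientAddGroup.mk_surjective c
  exact cylinderHeight_bandCover (0, t)

/-- Two points separate the circle. -/
theorem circle_two_points {C : Set (AddCircle (1 : ℝ))} (hC : IsPreconnected C)
    {a b : AddCircle (1 : ℝ)} (h : C = {a, b}ᶜ) : a = b := by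
  obtain ⟨a, rfl⟩ := QuotientAddGroup.mk_surjective a
  by_contra hne
  -- a representative of the second point in the fundamental domain that starts at the first one
  obtain ⟨b, hb, rfl⟩ : ∃ b' ∈ Ico a (a + 1), ((b' : ℝ) : AddCircle (1 : ℝ)) = b := by
    have := AddCircle.coe_image_Ico_eq (1 : ℝ) a
    have h2 : b ∈ ((↑) : ℝ → AddCircle (1 : ℝ)) '' Ico a (a + 1) := by rw [this]; exact mem_univ _
    exact h2
  have hab : a < b := hb.1.lt_of_ne fun h => hne (by rw [h])
  have hinj : InjOn ((↑) : ℝ → AddCircle (1 : ℝ)) (Ico a (a + 1)) := by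
    intro x hx y hy hxy
    rw [← sub_eq_zero, ← AddCircle.coe_sub] at hxy
    obtain ⟨n, hn⟩ := (AddCircle.coe_eq_zero_iff 1).1 hxy
    rw [zsmul_one] at hn
    have h1 : (-1 : ℝ) < n := by linarith [hx.1, hy.2]
    have h2 : (n : ℝ) < 1 := by linarith [hx.2, hy.1]
    have h1' : -1 < n := by exact_mod_cast h1
    have h2' : n < 1 := by exact_mod_cast h2
    have h3 : n = 0 := by omega
    rw [h3, Int.cast_zero] at hn
    linarith
  have ho : ∀ x y : ℝ, IsOpen (((↑) : ℝ → AddCircle (1 : ℝ)) '' Ioo x y) := fun x y =>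
    QuotientAddGroup.isOpenMap_coe _ isOpen_Ioo
  have ha : a ∈ Ico a (a + 1) := ⟨le_rfl, by linarith⟩
  have hsub : C ⊆ (((↑) : ℝ → AddCircle (1 : ℝ)) '' Ioo a b) ∪ ((↑) '' Ioo b (a + 1)) := by
    intro c hc
    rw [h] at hc
    have h2 : c ∈ ((↑) : ℝ → AddCircle (1 : ℝ)) '' Ico a (a + 1) := by
      rw [AddCircle.coe_image_Ico_eq]; exact mem_univ _
    obtain ⟨t, ht, rfl⟩ := h2
    have hta : a ≠ t := by rintro rfl; exact hc (Or.inl rfl)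
    rcases lt_trichotomy t b with h3 | rfl | h3
    · exact Or.inl ⟨t, ⟨ht.1.lt_of_ne hta, h3⟩, rfl⟩
    · exact (hc (Or.inr rfl)).elim
    · exact Or.inr ⟨t, ⟨h3, ht.2⟩, rfl⟩
  have hmem : ∀ t ∈ Ico a (a + 1), t ≠ a → t ≠ b → (t : AddCircle (1 : ℝ)) ∈ C := by
    intro t ht h1 h2
    rw [h]
    rintro (h3 | h3)
    · exact h1 (hinj ht ha h3)
    · exact h2 (hinj ht hb h3)
  obtain ⟨t₁, ht₁⟩ := exists_between hab
  obtain ⟨t₂, ht₂⟩ := exists_between hb.2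
  obtain ⟨c, -, ⟨x, hx, rfl⟩, y, hy, hxy⟩ := hC _ _ (ho a b) (ho b (a + 1)) hsub
    ⟨_, hmem t₁ ⟨ht₁.1.le, ht₁.2.trans hb.2⟩ ht₁.1.ne' ht₁.2.ne, t₁, ht₁, rfl⟩
    ⟨_, hmem t₂ ⟨(hab.trans ht₂.1).le, ht₂.2⟩ (hab.trans ht₂.1).ne' ht₂.1.ne', t₂, ht₂, rfl⟩
  have := hinj ⟨(hab.trans hy.1).le, hy.2⟩ ⟨hx.1.le, hx.2.trans hb.2⟩ hxy
  linarith [hx.2, hy.1]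

end CylinderHeight

namespace StripedAtlas

variable {Z : Type u} [TopologicalSpace Z] {A : StripedAtlas.{u, v, w} Z}

/-- If a homeomorphism maps the canonical foliation to the foliation of the open cylinder, and there
is only one strip, then each side of the strip is a single boundary interval. The lines in the strip
form an arc in the circle of leaves. As a compact transversal meets all leaves, both ends of the arc
are leaves that come from the sides, and since the complement of the arc consists of these ends and
the circle is separated by any two points, both ends are the same leaf. -/
theorem existsUnique_halfEdge_of_cylinder (hA : A.IsAffine) [Subsingleton A.Λ] [Nonempty A.Λ]
    {θ : Z ≃ₜ SignBand 1} (hθ : IsFoliated A.foliation (bandFoliation fun x => sgn 1 * x) θ)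
    (s : ℤˣ) : ∃! e : HalfEdge A.S, e.side = s := by
  obtain ⟨l⟩ := ‹Nonempty A.Λ›
  set T : Strip := A.S l with hT
  set τ : Total A.S → AddCircle (1 : ℝ) := fun p => cylinderHeight (θ (A.q p)) with hτdef
  have hτc : Continuous τ :=
    continuous_cylinderHeight.comp (θ.continuous.comp A.isQuotientMap.continuous)
  -- the leaves are the fibres of the function `τ`
  have hleaf : ∀ L ∈ A.stripLeaves, ∀ p ∈ L, ∀ p', τ p = τ p' ↔ A.q p' ∈ A.q '' L := by
    intro L hL p hp p'
    obtain ⟨c, hc⟩ := mem_bandFoliation_iff.1 (hθ.1 _ ⟨L, hL, rfl⟩)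
    have h1 : ∀ r, A.q r ∈ A.q '' L ↔ τ r = c := by
      intro r
      rw [← θ.injective.mem_set_image, hc]
      rfl
    rw [h1, (h1 p).1 (mem_image_of_mem _ hp), eq_comm]
  have hrow : ∀ t ∈ Ioo T.lo T.hi, {p : Total A.S | p.1 = l ∧ p.y = t} ∈ A.stripLeaves :=
    fun t ht => Or.inl ⟨l, t, ht, rfl⟩
  have hedge : ∀ e : HalfEdge A.S, e.toSet ∈ A.stripLeaves := fun e => Or.inr ⟨e, rfl⟩
  set σ : Ioo T.lo T.hi → AddCircle (1 : ℝ) := fun t => τ (Total.mkInt l 0 t t.2) with hσ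
  have hσc : Continuous σ :=
    hτc.comp (Total.continuous_mkInt continuous_const continuous_subtype_val _)
  have hτσ : ∀ (p : Total A.S) (hp : p.y ∈ Ioo T.lo T.hi), τ p = σ ⟨p.y, hp⟩ := by
    intro p hp
    exact (hleaf _ (hrow p.y hp) p ⟨Subsingleton.elim _ _, rfl⟩ _).2
      (mem_image_of_mem _ ⟨rfl, rfl⟩)
  -- the limit of `τ` on the lines that approach the given side
  have hlim : ∀ s : ℤˣ, ∃ (U : Ultrafilter (Ioo T.lo T.hi)) (c : AddCircle (1 : ℝ)),
      Tendsto (fun t : Ioo T.lo T.hi => (t : ℝ)) U (𝓝 (T.level s)) ∧ Tendsto σ U (𝓝 c) := by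
    intro s
    have hne : (comap (fun t : Ioo T.lo T.hi => (t : ℝ)) (𝓝 (T.level s))).NeBot := by
      have h1 : T.level s ∈ closure (Ioo T.lo T.hi) := by
        rw [closure_Ioo T.lo_lt_hi.ne]
        rcases Int.units_eq_one_or s with rfl | rfl <;> simp [Strip.level, T.lo_lt_hi.le]
      exact mem_closure_iff_comap_neBot.1 h1
    set U := Ultrafilter.of (comap (fun t : Ioo T.lo T.hi => (t : ℝ)) (𝓝 (T.level s)))
    have hU : (U : Filter _) ≤ comap (fun t : Ioo T.lo T.hi => (t : ℝ)) (𝓝 (T.level s)) :=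
      Ultrafilter.of_le _
    obtain ⟨c, -, hc⟩ := isCompact_univ.ultrafilter_le_nhds (U.map σ) (by simp)
    exact ⟨U, c, tendsto_comap.mono_left hU, hc⟩
  choose U c hU hc using hlim
  have hval : ∀ (e : HalfEdge A.S) (p : Total A.S), p ∈ e.toSet → τ p = c e.side := by
    intro e p hp
    obtain ⟨h1, h2, h3⟩ := HalfEdge.mem_toSet.1 hp
    have hl : e.vertex = l := Subsingleton.elim _ _
    have h4 : Tendsto (fun t : Ioo T.lo T.hi => Total.mkInt (S := A.S) l p.x t t.2) (U e.side)
        (𝓝 p) := by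
      refine Total.tendsto_nhds_iff.2 ⟨Eventually.of_forall fun t => Subsingleton.elim _ _,
        tendsto_const_nhds, ?_⟩
      rw [h2, hl]
      exact hU e.side
    have h5 := (hτc.tendsto p).comp h4
    refine tendsto_nhds_unique h5 ((hc e.side).congr fun t => ?_)
    exact (hτσ (Total.mkInt l p.x t t.2) t.2).symm
  -- both sides contain boundary intervals, because the section of the cylinder is compact
  have hex : ∀ s : ℤˣ, ∃ e : HalfEdge A.S, e.side = s := by
    intro s
    obtain ⟨j, hj, hjc⟩ := exists_cylinder_section
    have h1 : ∀ t : Ioo T.lo T.hi, ∃ r : Total A.S, r.y = t ∧ A.q r = θ.symm (j (σ t)) := by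
      intro t
      obtain ⟨p, hp⟩ := A.isQuotientMap.surjective (θ.symm (j (σ t)))
      have h2 : σ t = τ p := by
        simp only [hτdef]
        rw [hp, θ.apply_symm_apply, hjc]
      obtain ⟨r, hr, hrp⟩ := (hleaf _ (hrow t t.2) (Total.mkInt l 0 t t.2) ⟨rfl, rfl⟩ p).1 h2
      exact ⟨r, hr.2, hrp.trans hp⟩
    choose r hr hrq using h1
    have h2 : Tendsto (fun t => A.q (r t)) (U s) (𝓝 (θ.symm (j (c s)))) := by
      simp only [hrq]
      exact ((θ.symm.continuous.comp hj).tendsto _).comp (hc s)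
    obtain ⟨(p : Total A.S), -, hp⟩ := (isProperMap_q hA).ultrafilter_le_nhds_of_tendsto (𝒰 := (U s).map r) h2
    have h3 : p.y = T.level s := by
      refine tendsto_nhds_unique ((Total.continuous_y.tendsto p).comp hp) ((hU s).congr fun t => ?_)
      exact (hr t).symm
    have h4 : p ∉ Total.interior A.S := by
      intro h5
      have h6 : p.y ∈ Ioo (A.S p.1).lo (A.S p.1).hi := h5
      rw [Subsingleton.elim p.1 l, h3] at h6
      exact HalfEdge.level_notMem_Ioo T s h6
    obtain ⟨e, he⟩ := HalfEdge.exists_mem_toSet h4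
    refine ⟨e, HalfEdge.level_injective T ?_⟩
    have h5 := (HalfEdge.mem_toSet.1 he).2.1
    rw [h3, Subsingleton.elim e.vertex l] at h5
    exact h5.symm
  -- both sides lie on the same leaf
  have hcc : c (-1) = c 1 := by
    refine circle_two_points (C := range σ) ?_ ?_
    · have : PreconnectedSpace (Ioo T.lo T.hi) :=
        Subtype.preconnectedSpace isPreconnected_Ioo
      exact isPreconnected_range hσc
    · ext v
      constructor
      · rintro ⟨t, rfl⟩ hv
        have h1 : ∃ s, σ t = c s := by
          rcases hv with hv | hv
          · exact ⟨_, hv⟩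
          · exact ⟨_, hv⟩
        obtain ⟨s, hs⟩ := h1
        obtain ⟨e, rfl⟩ := hex s
        obtain ⟨p, hp⟩ := e.toSet_nonempty
        rw [← hval e p hp] at hs
        obtain ⟨p', hp', hq⟩ := (hleaf _ (hedge e) p hp _).1 hs.symm
        rw [eq_comm, q_eq_iff_of_mem_interior hA t.2] at hq
        exact HalfEdge.notMem_interior hp' (hq ▸ t.2)
      · intro hv
        obtain ⟨z, rfl⟩ : ∃ z, cylinderHeight z = v := by
          obtain ⟨j, -, hj⟩ := exists_cylinder_section
          exact ⟨j v, hj v⟩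
        obtain ⟨z, rfl⟩ := θ.surjective z
        obtain ⟨(p : Total A.S), rfl⟩ := A.isQuotientMap.surjective z
        by_cases hp : p ∈ Total.interior A.S
        · have hp' : p.y ∈ Ioo T.lo T.hi := by
            have h6 : p.y ∈ Ioo (A.S p.1).lo (A.S p.1).hi := hp
            rwa [Subsingleton.elim p.1 l] at h6
          exact ⟨⟨p.y, hp'⟩, (hτσ p hp').symm⟩
        · obtain ⟨e, he⟩ := HalfEdge.exists_mem_toSet hp
          have h1 : cylinderHeight (θ (A.q p)) = c e.side := hval e p he
          refine (hv ?_).elim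
          rw [h1]
          rcases Int.units_eq_one_or e.side with h2 | h2 <;> rw [h2]
          · exact Or.inr rfl
          · exact Or.inl rfl
  have hce : ∀ s s', c s = c s' := by
    intro s s'
    rcases Int.units_eq_one_or s with rfl | rfl <;> rcases Int.units_eq_one_or s' with rfl | rfl
    exacts [rfl, hcc.symm, hcc, rfl]
  have hξ : ∀ e f : HalfEdge A.S, f = e ∨ f = A.ξ e := by
    intro e f
    obtain ⟨p, hp⟩ := e.toSet_nonempty
    obtain ⟨p', hp'⟩ := f.toSet_nonempty
    obtain ⟨r, hr, hrq⟩ := (hleaf _ (hedge e) p hp p').1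
      ((hval e p hp).trans ((hce _ _).trans (hval f p' hp').symm))
    obtain ⟨u, rfl⟩ := e.exists_pt_eq hA.1 hr
    rcases (q_pt_eq_iff hA).1 hrq with rfl | ⟨-, rfl⟩
    · exact Or.inl (HalfEdge.eq_of_mem_toSet hp' (HalfEdge.pt_mem _ _ _))
    · exact Or.inr (HalfEdge.eq_of_mem_toSet hp' (HalfEdge.pt_mem _ _ _))
  obtain ⟨e, he⟩ := hex s
  obtain ⟨f, hf⟩ := hex (-s)
  have hss : s ≠ -s := by rcases Int.units_eq_one_or s with rfl | rfl <;> decide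
  refine ⟨e, he, fun e' he' => ?_⟩
  by_contra hne
  have h1 := (hξ e e').resolve_left hne
  have h2 := (hξ e f).resolve_left (by rintro rfl; exact hss (he.symm.trans hf))
  exact hss (he'.symm.trans ((congrArg HalfEdge.side (h1.trans h2.symm)).trans hf))

end StripedAtlas

namespace StripedGraph

/-- An automorphism of a graph with one vertex and one half-edge on each side is determined by its two
signs, and all pairs of signs occur. -/
theorem nonempty_aut_mulEquiv (G : StripedGraph.{v, w}) [Subsingleton G.V] [Nonempty G.V]
    (hG : ∀ s, ∃! e : G.H, G.side e = s) : Nonempty (G.Aut ≃* ℤˣ × ℤˣ) := by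
  classical
  obtain ⟨l⟩ := ‹Nonempty G.V›
  choose E hE huniq using hG
  have hEe : ∀ e, e = E (G.side e) := fun e => huniq _ e rfl
  have hEs : ∀ s, G.side (E s) = s := hE
  have hηE : ∀ (a : G.Aut) s, a.η (E s) = E (a.tori l * s) := by
    intro a s
    rw [hEe (a.η (E s)), a.side_η, hEs, Subsingleton.elim (G.vertex (E s)) l]
  have hirr : ∀ {s e f}, e ∈ G.d l s → f ∈ G.d l s → ¬ G.lt e f := by
    rintro s e f ⟨-, he⟩ ⟨-, hf⟩ hlt
    rw [hEe e, hEe f, he, hf] at hlt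
    exact G.lt_irrefl _ hlt
  -- the involution either fixes both half-edges or interchanges them
  have hξ : ∃ δ : ℤˣ, ∀ s, G.ξ (E s) = E (δ * s) := by
    have h1 : ∀ s, G.ξ (E s) = E (G.side (G.ξ (E s))) := fun s => hEe _
    refine ⟨G.side (G.ξ (E 1)), fun s => ?_⟩
    rcases Int.units_eq_one_or s with rfl | rfl
    · rw [mul_one]; exact h1 1
    · have h2 : G.ξ (E (-1)) ≠ G.ξ (E 1) := fun h => by
        have h3 := congrArg G.ξ h
        rw [G.ξ_ξ, G.ξ_ξ] at h3
        have h4 := congrArg G.side h3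
        rw [hEs, hEs] at h4
        exact absurd h4 (by decide)
      have h3 : G.side (G.ξ (E (-1))) ≠ G.side (G.ξ (E 1)) := fun h => h2 (by
        rw [h1 (-1), h, ← h1 1])
      rw [h1 (-1)]
      congr 1
      rcases Int.units_eq_one_or (G.side (G.ξ (E 1))) with h4 | h4 <;>
        rcases Int.units_eq_one_or (G.side (G.ξ (E (-1)))) with h5 | h5 <;>
        rw [h4, h5] at h3 ⊢ <;> simp at h3 ⊢
  obtain ⟨δ, hδ⟩ := hξ
  set χ : G.Aut →* ℤˣ × ℤˣ := MonoidHom.mk' (fun a => (a.lori l, a.tori l)) fun a a' => by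
    change (a.lori (a'.ν l) * a'.lori l, a.tori (a'.ν l) * a'.tori l) = _
    rw [Subsingleton.elim (a'.ν l) l]
    rfl with hχ
  refine ⟨MulEquiv.ofBijective χ ⟨fun a a' h => ?_, ?_⟩⟩
  · have h1 : a.lori l = a'.lori l := congrArg Prod.fst h
    have h2 : a.tori l = a'.tori l := congrArg Prod.snd h
    apply Aut.ext
    · ext l
      exact Subsingleton.elim _ _
    · ext e
      rw [hEe e, hηE, hηE, h2]
    · ext1 l'
      rw [Subsingleton.elim l' l, h1]
    · ext1 l'
      rw [Subsingleton.elim l' l, h2]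
  · rintro ⟨lo, τ⟩
    have hinv : Function.Involutive fun e => E (τ * G.side e) := fun e => by
      dsimp only
      rw [hEs, ← mul_assoc, Int.units_mul_self, one_mul, ← hEe]
    refine ⟨{
      ν := 1
      η := hinv.toPerm
      lori := fun _ => lo
      tori := fun _ => τ
      image_d := ?_
      increasing := ?_
      decreasing := ?_
      comm_ξ := ?_
      gluing := ?_ }, rfl⟩
    · intro l' s
      ext e
      constructor
      · rintro ⟨f, ⟨-, hf⟩, rfl⟩
        exact ⟨Subsingleton.elim _ _, (hEs _).trans (by rw [hf])⟩
      · rintro ⟨-, he⟩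
        refine ⟨E s, ⟨Subsingleton.elim _ _, hEs s⟩, ?_⟩
        change E (τ * G.side (E s)) = e
        rw [hEs, ← he, ← hEe]
    · intro l' s _ e he f hf hef
      obtain rfl : l' = l := Subsingleton.elim _ _
      exact (hirr he hf hef).elim
    · intro l' s _ e he f hf hef
      obtain rfl : l' = l := Subsingleton.elim _ _
      exact (hirr he hf hef).elim
    · intro e
      change G.ξ (E (τ * G.side e)) = E (τ * G.side (G.ξ e))
      rw [hEe e, hδ, hδ, hEs, hEs, ← mul_assoc, ← mul_assoc, mul_comm δ τ]
    · intro e hne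
      change lo * G.σ e = G.σ (E (τ * G.side e)) * lo
      have hδ1 : δ = -1 := by
        rcases Int.units_eq_one_or δ with h1 | h1
        · refine (hne ?_).elim
          rw [hEe e, hδ, h1, one_mul]
        · exact h1
      rw [mul_comm]
      congr 1
      rcases Int.units_eq_one_or τ with h1 | h1
      · rw [h1, one_mul, ← hEe]
      · rw [h1, ← hδ1, ← hδ, ← hEe, G.σ_ξ]

end StripedGraph

/-! ### The exceptional surfaces -/

section Exceptional

variable {Z : Type u} [TopologicalSpace Z] {Δ : Set (Set Z)}

theorem isOpenCylinder_iff :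
    IsOpenCylinder Δ ↔ FoliatedHomeomorphic Δ (bandFoliation fun x => sgn 1 * x) := by
  rw [IsOpenCylinder, show (fun x : ℝ => sgn 1 * x) = fun x => x by ext x; simp [sgn]]

theorem isOpenMoebius_iff :
    IsOpenMoebius Δ ↔ FoliatedHomeomorphic Δ (bandFoliation fun x => sgn (-1) * x) := by
  rw [IsOpenMoebius, show (fun x : ℝ => sgn (-1) * x) = fun x => -x by ext x; simp [sgn]]

theorem nonempty_homotopyEquiv_circle_of_isOpenCylinder_or_isOpenMoebius
    (h : IsOpenCylinder Δ ∨ IsOpenMoebius Δ) :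
    Nonempty (ContinuousMap.HomotopyEquiv (identityComponent Δ) Circle) := by
  obtain ⟨ε, θ, hθ⟩ :
      ∃ ε : ℤˣ, FoliatedHomeomorphic Δ (bandFoliation fun x => sgn ε * x) :=
    h.elim (fun h => ⟨1, isOpenCylinder_iff.1 h⟩) fun h => ⟨-1, isOpenMoebius_iff.1 h⟩
  obtain ⟨e⟩ := nonempty_homotopyEquiv_circle ε
  exact ⟨(identityComponentHomeo hθ).toHomotopyEquiv.trans e⟩

/-- An atlas of the open cylinder with a single strip need not be reduced, but its graph still
computes the homeotopy group. -/
theorem StripedAtlas.nonempty_homeotopyGroup_mulEquiv_of_isOpenCylinder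
    {A : StripedAtlas.{u, v, w} Z} (hA : A.IsAffine) (hcard : Nat.card A.Λ = 1)
    (h : IsOpenCylinder A.foliation) :
    Nonempty (HomeotopyGroup A.foliation ≃* A.graph.Aut) := by
  obtain ⟨_, _⟩ := Nat.card_eq_one_iff_unique.1 hcard
  obtain ⟨θ, hθ⟩ := isOpenCylinder_iff.1 h
  obtain ⟨e⟩ := nonempty_homeotopyGroup_cylinder
  have : Subsingleton A.graph.V := ‹Subsingleton A.Λ›
  have : Nonempty A.graph.V := ‹Nonempty A.Λ›
  obtain ⟨f⟩ := A.graph.nonempty_aut_mulEquiv (A.existsUnique_halfEdge_of_cylinder hA hθ)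
  exact ⟨((homeotopyGroupCongr hθ).trans e).trans f.symm⟩

end Exceptional

end Striped

end

theorem mainTheorem1 {Z : Type u} [TopologicalSpace Z] [ConnectedSpace Z]
    (_hZ : Striped.IsSurface Z) (q : Striped.StripedAtlas.{u, v, w} Z) (_haff : q.IsAffine)
    (_hred : q.IsReduced ∨
      (Nat.card q.Λ = 1 ∧
        (Striped.IsOpenCylinder q.foliation ∨ Striped.IsOpenMoebius q.foliation))) :
    ((Striped.IsOpenCylinder q.foliation ∨ Striped.IsOpenMoebius q.foliation) →
      Nonempty
        (ContinuousMap.HomotopyEquiv (Striped.identityComponent q.foliation) Circle)) ∧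
    (¬ (Striped.IsOpenCylinder q.foliation ∨ Striped.IsOpenMoebius q.foliation) →
      ContractibleSpace (Striped.identityComponent q.foliation)) ∧
    ((q.IsReduced ∨ Striped.IsOpenCylinder q.foliation) →
      Nonempty (Striped.HomeotopyGroup q.foliation ≃* q.graph.Aut)) := by
  refine ⟨Striped.nonempty_homotopyEquiv_circle_of_isOpenCylinder_or_isOpenMoebius, fun h => ?_,
    fun h => ?_⟩
  · exact q.contractibleSpace_identityComponent _haff (_hred.resolve_right fun h' => h h'.2)
  · by_cases hr : q.IsReduced
    · exact q.nonempty_homeotopyGroup_mulEquiv _haff hr (q.graphAction_surjective _haff hr)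
    · exact q.nonempty_homeotopyGroup_mulEquiv_of_isOpenCylinder _haff (_hred.resolve_left hr).1
        (h.resolve_left hr)
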